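/- Let $n=n(N)\ge N$ and $\overline N=\overline N(N)\ge N$ be integers with $0<\liminf_N \frac Nn\le\limsup_N\frac Nn<1$. For each $N$ let $\Theta_1,\dots,\Theta_n$ be complex $N\times\overline N$ matrices, put $\Omega_i=\Theta_i\Theta_i^*$, and assume that there are constants $0<w_{\min}\le w_{\max}<\infty$, independent of $N$ and $i$, such that all eigenvalues of all $\Omega_i$ lie in $[w_{\min},w_{\max}]$. Let $\xi_1,\dots,\xi_n$ be independent random vectors in $\mathbb C^N$, where $\xi_i$ is a centered circular complex Gaussian vector with covariance $\Omega_i$ (i.e. $\xi_i$ is distributed as $\Theta_i x$, where $x$ has independent standard circular complex Gaussian entries), let $\Sigma=[\xi_1,\dots,\xi_n]$, and let $Q(z)=\big(\frac1n\Sigma\Sigma^*-zI_N\big)^{-1}$. For $z\in\mathbb C\setminus[0,\infty)$ let $\delta_1(z),\dots,\delta_n(z)$ be the unique solution, among Stieltjes transforms $\int\frac{d\mu(\lambda)}{\lambda-z}$ of finite non-negative measures $\mu$ on $[0,\infty)$, of the system $$\delta_i(z)=\frac1n\operatorname{tr}\Omega_iT_N(z),\qquad T_N(z)=\Big(\frac1n\sum_{j=1}^n\frac{\Omega_j}{1+\delta_j(z)}-zI_N\Big)^{-1},\qquad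 1\le i\le n,$$ and put $$\alpha_k(z)=\frac1n\operatorname{tr}\Omega_k\,\mathbb E[Q(z)],\qquad R_N(z)=\Big(\frac1n\sum_{k=1}^n\frac{\Omega_k}{1+\alpha_k(z)}-zI_N\Big)^{-1}.$$ Let $B=B_N(z)$ and $C=C_N(z)$ be the $n\times n$ matrices with entries $$B_{jk}=\frac1{n^2}\,\frac{\operatorname{tr}\big(\Omega_jR_N(z)\Omega_kR_N(z)^*\big)}{|1+\alpha_k(z)|^2},\qquad C_{jk}=\frac1{n^2}\,\frac{\operatorname{tr}\big(\Omega_jT_N(z)\Omega_kT_N(z)^*\big)}{|1+\delta_k(z)|^2}.$$ Write $\rho$ for the spectral radius, $\|A\|_\infty=\max_i\sum_j|A_{ij}|$, and $\mathbb C_+=\{z:\operatorname{Im}z>0\}$. 1. There are constants $K,\eta>0$, independent of $N$ and $z$, such that for all $N\ge1$ and all $z\in\mathbb C_+$, $\rho(C)<1$ and $$\|(I_n-C)^{-1}\|_\infty\le\frac{K(\eta^2+|z|^2)^2}{|\operatorname{Im}z|^4}.$$ 2. There are real polynomials $Q_1,Q_2$ with positive coefficients and constants $\tilde K,\tilde\eta>0$,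 all independent of $N$ and $z$, such that for all $N$ large enough and all $$z\in\mathcal E_N=\Big\{z\in\mathbb C_+:\ \frac1{N^2}\,Q_1(|z|)\,Q_2\big(|\operatorname{Im}z|^{-1}\big)\le\frac12\Big\}$$ one has $\rho(B)<1$ and $$\|(I_n-B)^{-1}\|_\infty\le\frac{\tilde K(\tilde\eta^2+|z|^2)^2}{|\operatorname{Im}z|^4}.$$ -/

import Mathlib

open Filter MeasureTheory ProbabilityTheory

/- The norm `‖A‖` of a square matrix is the maximal absolute row sum, i.e. the operator norm
induced by the sup norm on vectors. -/
attribute [local instance] Matrix.linftyOpNormedAddCommGroup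

noncomputable section

namespace CorrelatedGaussian

/-- The standard circular complex Gaussian law on `ℂ`: independent real and imaginary parts, both
centered with variance `1/2`. -/
def stdComplexGaussian : Measure ℂ :=
  ((gaussianReal 0 (1 / 2)).prod (gaussianReal 0 (1 / 2))).map (fun p : ℝ × ℝ => (⟨p.1, p.2⟩ : ℂ))

/-- The law of `A x`, where `x` has independent standard circular complex Gaussian entries; this is
the centered circular complex Gaussian law with covariance `A Aᴴ`. -/
def complexGaussian {N M : ℕ} (A : Matrix (Fin N) (Fin M) ℂ) : Measure (Fin N → ℂ) :=
  (Measure.pi (fun _ : Fin M => stdComplexGaussian)).map (fun x => A.mulVec x)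

/-- The covariances `Ω_i = Θ_i Θ_iᴴ`. -/
def cov {n N M : ℕ} (Θ : Fin n → Matrix (Fin N) (Fin M) ℂ) (i : Fin n) :
    Matrix (Fin N) (Fin N) ℂ :=
  Θ i * (Θ i).conjTranspose

/-- The Stieltjes transform `z ↦ ∫ dμ(t) / (t - z)`. -/
def stieltjes (μ : Measure ℝ) (z : ℂ) : ℂ := ∫ t, ((t : ℂ) - z)⁻¹ ∂μ

/-- The matrix `((1/n) ∑ᵢ Ω_i / (1 + d_i) - z I)⁻¹`. -/
def detResolvent {n N : ℕ} (Ω : Fin n → Matrix (Fin N) (Fin N) ℂ) (d : Fin n → ℂ) (z : ℂ) :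
    Matrix (Fin N) (Fin N) ℂ :=
  ((1 / (n : ℂ)) • ∑ i, (1 / (1 + d i)) • Ω i - z • (1 : Matrix (Fin N) (Fin N) ℂ))⁻¹

/-- The measures `μ_1, …, μ_n` are finite, carried by `[0, ∞)`, and their Stieltjes transforms
`δ_1, …, δ_n` satisfy
`δ_i(z) = (1/n) tr (Ω_i ((1/n) ∑ⱼ Ω_j / (1 + δ_j(z)) - z I)⁻¹)` for all `z ∈ ℂ \ [0, ∞)`. -/
structure SolvesSystem {n N : ℕ} (Ω : Fin n → Matrix (Fin N) (Fin N) ℂ)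
    (μ : Fin n → Measure ℝ) : Prop where
  finite : ∀ i, IsFiniteMeasure (μ i)
  carried : ∀ i, μ i (Set.Iio 0) = 0
  system : ∀ z : ℂ, ¬ (z.im = 0 ∧ 0 ≤ z.re) → ∀ i,
    stieltjes (μ i) z =
      (1 / (n : ℂ)) * (Ω i * detResolvent Ω (fun j => stieltjes (μ j) z) z).trace

/-- The solution of the system among Stieltjes transforms of finite positive measures (it exists and
is unique when the `Ω_i` are positive definite). -/
def delta {n N : ℕ} (Ω : Fin n → Matrix (Fin N) (Fin N) ℂ) (z : ℂ) (i : Fin n) : ℂ :=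
  stieltjes (Classical.epsilon (SolvesSystem Ω) i) z

/-- The matrix `T_N(z)`. -/
def matT {n N : ℕ} (Ω : Fin n → Matrix (Fin N) (Fin N) ℂ) (z : ℂ) : Matrix (Fin N) (Fin N) ℂ :=
  detResolvent Ω (delta Ω z) z

/-- The resolvent `((1/n) Σ Σᴴ - z I)⁻¹` of the matrix `Σ` with columns `x_1, …, x_n`. -/
def resolventQ {n N : ℕ} (x : Fin n → Fin N → ℂ) (z : ℂ) : Matrix (Fin N) (Fin N) ℂ :=
  let S : Matrix (Fin N) (Fin n) ℂ := Matrix.of fun a i => x i a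
  ((1 / (n : ℂ)) • (S * S.conjTranspose) - z • (1 : Matrix (Fin N) (Fin N) ℂ))⁻¹

/-- The entrywise expectation `𝔼 Q(z)`, for random columns `ξ_1, …, ξ_n`. -/
def meanQ {S : Type*} [MeasurableSpace S] (P : Measure S) {n N : ℕ}
    (ξ : Fin n → S → Fin N → ℂ) (z : ℂ) : Matrix (Fin N) (Fin N) ℂ :=
  Matrix.of fun a b => ∫ ω, resolventQ (fun i => ξ i ω) z a b ∂P

/-- `α_k(z) = (1/n) tr (Ω_k 𝔼 Q(z))`. -/
def alpha {S : Type*} [MeasurableSpace S] (P : Measure S) {n N : ℕ}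
    (Ω : Fin n → Matrix (Fin N) (Fin N) ℂ) (ξ : Fin n → S → Fin N → ℂ) (z : ℂ) (k : Fin n) : ℂ :=
  (1 / (n : ℂ)) * (Ω k * meanQ P ξ z).trace

/-- The matrix `R_N(z)`. -/
def matR {S : Type*} [MeasurableSpace S] (P : Measure S) {n N : ℕ}
    (Ω : Fin n → Matrix (Fin N) (Fin N) ℂ) (ξ : Fin n → S → Fin N → ℂ) (z : ℂ) :
    Matrix (Fin N) (Fin N) ℂ :=
  detResolvent Ω (alpha P Ω ξ z) z

/-- The `n × n` matrix with entries `C_{jk} = (1/n²) tr (Ω_j T Ω_k Tᴴ) / |1 + δ_k|²`. -/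
def matC {n N : ℕ} (Ω : Fin n → Matrix (Fin N) (Fin N) ℂ) (z : ℂ) : Matrix (Fin n) (Fin n) ℂ :=
  Matrix.of fun j k =>
    (1 / (n : ℂ) ^ 2) * (Ω j * matT Ω z * Ω k * (matT Ω z).conjTranspose).trace /
      ((‖1 + delta Ω z k‖ ^ 2 : ℝ) : ℂ)

/-- The `n × n` matrix with entries `B_{jk} = (1/n²) tr (Ω_j R Ω_k Rᴴ) / |1 + α_k|²`. -/
def matB {S : Type*} [MeasurableSpace S] (P : Measure S) {n N : ℕ}
    (Ω : Fin n → Matrix (Fin N) (Fin N) ℂ) (ξ : Fin n → S → Fin N → ℂ) (z : ℂ) :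
    Matrix (Fin n) (Fin n) ℂ :=
  Matrix.of fun j k =>
    (1 / (n : ℂ) ^ 2) * (Ω j * matR P Ω ξ z * Ω k * (matR P Ω ξ z).conjTranspose).trace /
      ((‖1 + alpha P Ω ξ z k‖ ^ 2 : ℝ) : ℂ)

/-- All coefficients up to the degree are positive (in particular the polynomial is nonzero). -/
def PosCoeffs (Q : Polynomial ℝ) : Prop := ∀ i ≤ Q.natDegree, 0 < Q.coeff i

/-- The region `{z ∈ ℂ₊ : N⁻² Q₁(|z|) Q₂(|Im z|⁻¹) ≤ 1/2}`. -/
def regionE (Q₁ Q₂ : Polynomial ℝ) (N : ℕ) : Set ℂ :=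
  {z | 0 < z.im ∧ 1 / (N : ℝ) ^ 2 * Q₁.eval ‖z‖ * Q₂.eval (|z.im|⁻¹) ≤ 1 / 2}

end CorrelatedGaussian

end

/-! Both matrices have the form `gainMatrix Ω d T`, with T the inverse of (1/n) ∑ Ω_j/(1+d_j) − z;
here d = δ gives C and d = α gives B. Call this entrywise nonnegative matrix G. If d_i = (1/n)
tr(Ω_i T), imaginary parts give Im d_i = (G Im d)_i + Im z (1/n) tr(Ω_i T Tᴴ). As Ω_i ≥ wmin and
‖T⁻¹‖ ≤ L = |z|(w/Im z + 1), the last term is at least β = Im z · wmin · N/(n L²). So v = Im d is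
positive, satisfies G v + β ≤ v, and is at most M = (N/n) w/Im z. A maximum principle for v gives
ρ(G) ≤ 1 − β/M and ‖(1−G)⁻¹‖ ≤ M/β, and M/β is a constant times L²/(Im z)². The argument tolerates
an error of size β/2 in the equation for d, at the cost of a factor 2; this is
`spectralRadius_and_norm_of_approx_solution`.

For B it remains to show that α solves the system up to O(1/n²), with a constant polynomial in |z|
and 1/Im z (`IsCircularLaw.norm_integral_traceRes_sub_le`); the region is chosen so that this error
is below β/2. The invariance of γ × γ under rotations of E × E yields both Gaussian integration by
parts and the Poincaré inequality. The former gives the equation for α, the latter bounds the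
variance and the fourth moment of (1/n) tr(B Q) by O(1/n²) and O(1/n⁴).

For C the equation is exact, but δ is defined by a choice, so a solution has to be shown to exist;
its uniqueness plays no role. Replacing Ω_i by m copies of Ω_i ⊗ 1_m leaves the deterministic system
unchanged and multiplies the dimensions by m. As m grows, the spectral measures of a typical
realization therefore solve the system up to an arbitrarily small error at finitely many points.
Compactness of the measures of bounded mass on [0,1], a compactification of [0,∞), turns these into
an exact solution (`exists_solvesSystem`). -/

noncomputable section

set_option linter.unusedSectionVars false

namespace CorrelatedGaussian

/-! ### Nonnegative matrices with a strictly subinvariant positive vector. -/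

section NonnegMatrix

variable {n : ℕ} {c : Matrix (Fin n) (Fin n) ℝ} {v : Fin n → ℝ} {b : ℝ}

/-- A maximum principle for nonnegative matrices `c` with `c v + b ≤ v` for a positive `v`. -/
theorem exists_ratio_le_of_subinvariant [Nonempty (Fin n)] (hc : ∀ i j, 0 ≤ c i j)
    (hv : ∀ i, 0 < v i) (h : ∀ i, ∑ j, c i j * v j + b ≤ v i) (w : Fin n → ℂ) :
    ∃ i₀ m, 0 ≤ m ∧ ‖w i₀‖ = m * v i₀ ∧ (∀ i, ‖w i‖ ≤ m * v i) ∧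
      ∑ j, c i₀ j * ‖w j‖ ≤ m * (v i₀ - b) := by
  -- The ratio is weighted by `v`: `m` is the norm of `w` in the weighted sup norm in which `c` is a
  -- strict contraction.
  obtain ⟨i₀, -, hi₀⟩ := Finset.exists_max_image Finset.univ (fun i => ‖w i‖ / v i)
    Finset.univ_nonempty
  have key : ∀ i, ‖w i‖ ≤ ‖w i₀‖ / v i₀ * v i := fun i =>
    (div_le_iff₀ (hv i)).1 (hi₀ i (Finset.mem_univ i))
  have hm : 0 ≤ ‖w i₀‖ / v i₀ := div_nonneg (norm_nonneg _) (hv i₀).le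
  refine ⟨i₀, ‖w i₀‖ / v i₀, hm, (div_mul_cancel₀ _ (hv i₀).ne').symm, key, ?_⟩
  calc ∑ j, c i₀ j * ‖w j‖ ≤ ∑ j, c i₀ j * (‖w i₀‖ / v i₀ * v j) :=
        Finset.sum_le_sum fun j _ => mul_le_mul_of_nonneg_left (key j) (hc _ _)
    _ = ‖w i₀‖ / v i₀ * ∑ j, c i₀ j * v j := by
        rw [Finset.mul_sum]; exact Finset.sum_congr rfl fun j _ => by ring
    _ ≤ _ := mul_le_mul_of_nonneg_left (by linarith [h i₀]) hm

theorem norm_mulVec_ofReal_le (hc : ∀ i j, 0 ≤ c i j) (w : Fin n → ℂ) (i : Fin n) :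
    ‖((c.map Complex.ofReal).mulVec w) i‖ ≤ ∑ j, c i j * ‖w j‖ := by
  refine (norm_sum_le Finset.univ fun j => c.map Complex.ofReal i j * w j).trans
    (Finset.sum_le_sum fun j _ => ?_)
  simp [abs_of_nonneg (hc i j)]

/-- For an eigenvector, the row where |w_i|/v_i is maximal gives |λ| v_i ≤ v_i − b. The bound `M`
makes the gap b/v_i uniform over the spectrum. -/
theorem spectralRadius_lt_one_of_subinvariant (hn : 0 < n) (hc : ∀ i j, 0 ≤ c i j)
    (hv : ∀ i, 0 < v i) (hb : 0 < b) (h : ∀ i, ∑ j, c i j * v j + b ≤ v i)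
    {M : ℝ} (hM : ∀ i, v i ≤ M) :
    spectralRadius ℂ (c.map Complex.ofReal) < 1 := by
  have : Nonempty (Fin n) := ⟨⟨0, hn⟩⟩
  have hMpos : 0 < M := (hv ⟨0, hn⟩).trans_le (hM _)
  have hlam : ∀ lam ∈ spectrum ℂ (c.map Complex.ofReal), ‖lam‖ ≤ 1 - b / M := by
    intro lam hlam
    rw [← Matrix.spectrum_toLin', ← Module.End.hasEigenvalue_iff_mem_spectrum] at hlam
    obtain ⟨w, hw⟩ := hlam.exists_hasEigenvector
    have hw0 := hw.2
    have hwe : (c.map Complex.ofReal).mulVec w = lam • w := by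
      have := hw.apply_eq_smul
      rwa [Matrix.toLin'_apply] at this
    obtain ⟨i₀, m, hm, h1, h2, h3⟩ := exists_ratio_le_of_subinvariant hc hv h w
    have hm0 : 0 < m := by
      refine lt_of_le_of_ne hm fun h0 => hw0 (funext fun i => ?_)
      have := h2 i
      rw [← h0, zero_mul] at this
      simpa using this
    have h4 : ‖lam‖ * (m * v i₀) ≤ m * (v i₀ - b) := by
      rw [← h1, ← norm_mul]
      have := norm_mulVec_ofReal_le hc w i₀
      rw [hwe] at this
      exact this.trans h3
    have h5 : ‖lam‖ * v i₀ ≤ v i₀ - b := by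
      have : m * (‖lam‖ * v i₀) ≤ m * (v i₀ - b) := by linarith
      exact le_of_mul_le_mul_left this hm0
    have h6 : ‖lam‖ ≤ 1 - b / v i₀ := by
      rw [one_sub_div (hv i₀).ne', le_div_iff₀ (hv i₀)]; exact h5
    have h7 : b / M ≤ b / v i₀ := div_le_div_of_nonneg_left hb.le (hv i₀) (hM i₀)
    linarith
  have hle : spectralRadius ℂ (c.map Complex.ofReal) ≤ ENNReal.ofReal (1 - b / M) := by
    refine iSup₂_le fun lam hl => ?_
    rw [← enorm_eq_nnnorm, ← ofReal_norm]
    exact ENNReal.ofReal_le_ofReal (hlam lam hl)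
  refine hle.trans_lt ?_
  rw [← ENNReal.ofReal_one, ENNReal.ofReal_lt_ofReal_iff one_pos]
  have := div_pos hb hMpos
  linarith

/-- If every entry of (1 − C)w is at most e, the maximal-ratio row gives m b ≤ e, hence |w| ≤ eM/b.
With e = 0 this is injectivity; with e = 1 it bounds the inverse. -/
theorem norm_inv_one_sub_le_of_subinvariant (hn : 0 < n) (hc : ∀ i j, 0 ≤ c i j)
    (hv : ∀ i, 0 < v i) (hb : 0 < b) (h : ∀ i, ∑ j, c i j * v j + b ≤ v i)
    {M : ℝ} (hM : ∀ i, v i ≤ M) :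
    ‖(1 - c.map Complex.ofReal : Matrix (Fin n) (Fin n) ℂ)⁻¹‖ ≤ M / b := by
  have : Nonempty (Fin n) := ⟨⟨0, hn⟩⟩
  have hMpos : 0 < M := (hv ⟨0, hn⟩).trans_le (hM _)
  set C := c.map Complex.ofReal with hC
  have hmax : ∀ (w : Fin n → ℂ) (e : ℝ), (∀ i, ‖((1 - C).mulVec w) i‖ ≤ e) →
      ∀ i, ‖w i‖ ≤ e * M / b := by
    intro w e he i
    obtain ⟨i₀, m, hm, h1, h2, h3⟩ := exists_ratio_le_of_subinvariant hc hv h w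
    have h4 : m * v i₀ ≤ e + m * (v i₀ - b) := by
      rw [← h1]
      have h5 : w i₀ = ((1 - C).mulVec w) i₀ + (C.mulVec w) i₀ := by
        simp [Matrix.sub_mulVec]
      calc ‖w i₀‖ ≤ ‖((1 - C).mulVec w) i₀‖ + ‖(C.mulVec w) i₀‖ := by
            conv_lhs => rw [h5]
            exact norm_add_le _ _
        _ ≤ _ := add_le_add (he i₀) ((norm_mulVec_ofReal_le hc w i₀).trans h3)
    have h6 : m ≤ e / b := by rw [le_div_iff₀ hb]; linarith
    have he0 : 0 ≤ e := (norm_nonneg _).trans (he i₀)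
    calc ‖w i‖ ≤ m * v i := h2 i
      _ ≤ e / b * M := mul_le_mul h6 (hM i) (hv i).le (by positivity)
      _ = _ := by ring
  have hunit : IsUnit (1 - C).det := by
    rw [isUnit_iff_ne_zero]
    intro h0
    obtain ⟨w, hw0, hw⟩ := Matrix.exists_mulVec_eq_zero_iff.2 h0
    refine hw0 (funext fun i => ?_)
    have := hmax w 0 (fun i => by simp [hw]) i
    simpa using this
  have hrow : ∀ i, ∑ j, ‖(1 - C)⁻¹ i j‖ ≤ M / b := by
    intro i
    -- The conjugate phases of row `i` form a vector of sup norm at most 1 on which the inverse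
    -- attains the absolute sum of that row.
    set x : Fin n → ℂ := fun j => if (1 - C)⁻¹ i j = 0 then 0 else
      (starRingEnd ℂ) ((1 - C)⁻¹ i j) / ‖(1 - C)⁻¹ i j‖ with hx
    have hx1 : ∀ j, ‖x j‖ ≤ 1 := by
      intro j
      simp only [hx]
      split_ifs with h0
      · simp
      · simp [div_self (norm_ne_zero_iff.2 h0)]
    have hsum : (((1 - C)⁻¹).mulVec x) i = ((∑ j, ‖(1 - C)⁻¹ i j‖ : ℝ) : ℂ) := by
      rw [Matrix.mulVec, dotProduct, Complex.ofReal_sum]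
      refine Finset.sum_congr rfl fun j _ => ?_
      simp only [hx]
      split_ifs with h0
      · simp [h0]
      · have h0' : (‖(1 - C)⁻¹ i j‖ : ℂ) ≠ 0 := by
          exact_mod_cast norm_ne_zero_iff.2 h0
        rw [← mul_div_assoc, Complex.mul_conj, Complex.normSq_eq_norm_sq]
        push_cast
        field_simp
    have := hmax (((1 - C)⁻¹).mulVec x) 1 (fun k => by
      rw [Matrix.mulVec_mulVec, Matrix.mul_nonsing_inv _ hunit, Matrix.one_mulVec]
      exact hx1 k) i
    rw [hsum, Complex.norm_real, one_mul] at this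
    exact (le_abs_self _).trans this
  rw [Matrix.linfty_opNorm_def]
  have hMb : 0 ≤ M / b := by positivity
  lift M / b to NNReal using hMb with r hr
  rw [NNReal.coe_le_coe]
  refine Finset.sup_le fun i _ => ?_
  rw [← NNReal.coe_le_coe]
  simpa using hrow i

end NonnegMatrix

end CorrelatedGaussian

namespace CorrelatedGaussian

/-! ### Euclidean operator norm, numerical range and traces. -/

section OperatorNorm

open scoped Matrix.Norms.L2Operator Matrix ComplexOrder

variable {κ ι m : Type*} [Fintype κ] [Fintype ι] [Fintype m] [DecidableEq κ] [DecidableEq m]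

/-- The Euclidean norm of a complex vector. -/
def vnorm (v : κ → ℂ) : ℝ := ‖(WithLp.toLp 2 v : EuclideanSpace ℂ κ)‖

theorem vnorm_nonneg (v : κ → ℂ) : 0 ≤ vnorm v := norm_nonneg _

theorem vnorm_sq (v : κ → ℂ) : vnorm v ^ 2 = ∑ a, ‖v a‖ ^ 2 := by
  rw [vnorm, EuclideanSpace.norm_sq_eq]

theorem vnorm_star (v : κ → ℂ) : vnorm (star v) = vnorm v := by
  rw [← sq_eq_sq₀ (vnorm_nonneg _) (vnorm_nonneg _), vnorm_sq, vnorm_sq]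
  simp

theorem norm_dotProduct_le (u v : κ → ℂ) : ‖u ⬝ᵥ v‖ ≤ vnorm u * vnorm v := by
  have h := norm_inner_le_norm (𝕜 := ℂ) (WithLp.toLp 2 (star u) : EuclideanSpace ℂ κ)
    (WithLp.toLp 2 v)
  rw [EuclideanSpace.inner_toLp_toLp, star_star, dotProduct_comm] at h
  exact h.trans_eq (by rw [← vnorm, ← vnorm, vnorm_star])

theorem star_dotProduct_self (v : κ → ℂ) : star v ⬝ᵥ v = ((vnorm v ^ 2 : ℝ) : ℂ) := by
  rw [vnorm_sq, dotProduct, Complex.ofReal_sum]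
  refine Finset.sum_congr rfl fun a _ => ?_
  rw [Pi.star_apply, mul_comm, ← starRingEnd_apply, Complex.mul_conj, Complex.normSq_eq_norm_sq]

theorem vnorm_mulVec_le (A : Matrix m κ ℂ) (v : κ → ℂ) : vnorm (A *ᵥ v) ≤ ‖A‖ * vnorm v :=
  Matrix.l2_opNorm_mulVec A (WithLp.toLp 2 v)

theorem opNorm_le_of_vnorm_le (A : Matrix m κ ℂ) {c : ℝ} (hc : 0 ≤ c)
    (h : ∀ v, vnorm (A *ᵥ v) ≤ c * vnorm v) : ‖A‖ ≤ c := by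
  rw [Matrix.l2_opNorm_def]
  exact ContinuousLinearMap.opNorm_le_bound _ hc fun v => h (WithLp.ofLp v)

theorem vnorm_single (a : κ) : vnorm (Pi.single a (1 : ℂ)) = 1 := by
  rw [← sq_eq_sq₀ (vnorm_nonneg _) zero_le_one, vnorm_sq]
  simp [Pi.single_apply, apply_ite]

theorem norm_apply_le_vnorm (v : κ → ℂ) (a : κ) : ‖v a‖ ≤ vnorm v :=
  PiLp.norm_apply_le (WithLp.toLp 2 v : EuclideanSpace ℂ κ) a

theorem vnorm_col_le (A : Matrix m κ ℂ) (a : κ) : vnorm (A.col a) ≤ ‖A‖ := by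
  have := vnorm_mulVec_le A (Pi.single a (1 : ℂ))
  rwa [vnorm_single, mul_one, Matrix.mulVec_single_one] at this

theorem norm_entry_le (A : Matrix m κ ℂ) (i : m) (a : κ) : ‖A i a‖ ≤ ‖A‖ :=
  (norm_apply_le_vnorm (A.col a) i).trans (vnorm_col_le A a)

theorem norm_trace_le (A : Matrix κ κ ℂ) : ‖A.trace‖ ≤ Fintype.card κ * ‖A‖ := by
  refine (norm_sum_le Finset.univ fun a => A a a).trans ?_
  refine (Finset.sum_le_sum fun a _ => norm_entry_le A a a).trans ?_
  simp

theorem opNorm_one_le : ‖(1 : Matrix κ κ ℂ)‖ ≤ 1 :=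
  opNorm_le_of_vnorm_le _ zero_le_one fun v => by simp

/-- A matrix whose numerical range lies in `{Im ≤ -y}` is invertible, with inverse bounded by
`1 / y`. -/
theorem isUnit_of_im_le {M : Matrix κ κ ℂ} {y : ℝ} (hy : 0 < y)
    (h : ∀ v, (star v ⬝ᵥ M *ᵥ v).im ≤ -y * vnorm v ^ 2) : IsUnit M ∧ ‖M⁻¹‖ ≤ 1 / y := by
  have key : ∀ v, y * vnorm v ≤ vnorm (M *ᵥ v) := by
    intro v
    -- Coercivity: y‖v‖² ≤ |⟨v, Mv⟩| ≤ ‖v‖‖Mv‖, which gives injectivity and the bound on the inverse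
    -- at once.
    have h1 : y * vnorm v ^ 2 ≤ vnorm v * vnorm (M *ᵥ v) := by
      calc y * vnorm v ^ 2 ≤ -(star v ⬝ᵥ M *ᵥ v).im := by linarith [h v]
        _ ≤ ‖star v ⬝ᵥ M *ᵥ v‖ := (neg_le_abs _).trans (Complex.abs_im_le_norm _)
        _ ≤ _ := by
          refine (norm_dotProduct_le _ _).trans ?_
          rw [vnorm_star]
    rcases (vnorm_nonneg v).eq_or_lt with h0 | h0
    · rw [← h0, mul_zero]; exact vnorm_nonneg _
    · refine le_of_mul_le_mul_left ?_ h0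
      linarith
  have hunit : IsUnit M.det := by
    rw [isUnit_iff_ne_zero]
    intro h0
    obtain ⟨w, hw0, hw⟩ := Matrix.exists_mulVec_eq_zero_iff.2 h0
    have h1 := key w
    rw [hw] at h1
    have h2 : vnorm (0 : κ → ℂ) = 0 := by simp [vnorm]
    rw [h2] at h1
    have h3 : vnorm w = 0 := by nlinarith [vnorm_nonneg w]
    exact hw0 (by simpa [vnorm] using h3)
  refine ⟨(Matrix.isUnit_iff_isUnit_det _).2 hunit, opNorm_le_of_vnorm_le _ (by positivity)
    fun v => ?_⟩
  have h1 := key (M⁻¹ *ᵥ v)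
  rw [Matrix.mulVec_mulVec, Matrix.mul_nonsing_inv _ hunit, Matrix.one_mulVec] at h1
  rw [div_mul_eq_mul_div, one_mul, le_div_iff₀ hy]
  linarith

theorem trace_mul_nonneg {A B : Matrix κ κ ℂ} (hA : A.PosSemidef) (hB : B.PosSemidef) :
    0 ≤ (A * B).trace := by
  obtain ⟨C, rfl⟩ : ∃ C : Matrix κ κ ℂ, A = Cᴴ * C := by
    open scoped MatrixOrder in
    exact CStarAlgebra.nonneg_iff_eq_star_mul_self.1 hA.nonneg
  rw [Matrix.mul_assoc, Matrix.trace_mul_comm]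
  exact (hB.mul_mul_conjTranspose_same C).trace_nonneg

end OperatorNorm

/-! ### The deterministic pencil and the imaginary part of its inverse. -/

section DetRes

open scoped Matrix.Norms.L2Operator Matrix ComplexOrder

variable {κ ι : Type*} [Fintype κ] [Fintype ι] [DecidableEq κ]

/-- The matrix inverted in `detResolvent`, over arbitrary index types. -/
def detPencil (Ω : ι → Matrix κ κ ℂ) (d : ι → ℂ) (z : ℂ) : Matrix κ κ ℂ :=
  (1 / (Fintype.card ι : ℂ)) • ∑ i, (1 / (1 + d i)) • Ω i - z • (1 : Matrix κ κ ℂ)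

theorem detResolvent_eq_inv {n N : ℕ} (Ω : Fin n → Matrix (Fin N) (Fin N) ℂ) (d : Fin n → ℂ)
    (z : ℂ) : detResolvent Ω d z = (detPencil Ω d z)⁻¹ := by
  simp [detResolvent, detPencil]

variable {Ω : ι → Matrix κ κ ℂ} {d : ι → ℂ} {z : ℂ}

/-- At d = −1 both sides are 0 by the convention for division by zero, so no side condition is
needed. -/
theorem im_one_div_one_add (d : ℂ) : (1 / (1 + d)).im = -d.im / ‖1 + d‖ ^ 2 := by
  rw [one_div, Complex.inv_im, Complex.normSq_eq_norm_sq]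
  simp

/-- Im d_i ≥ 0 makes Im 1/(1+d_i) ≤ 0, so the numerical range lies in {Im ≤ −Im z}. -/
theorem isUnit_detPencil (hΩ : ∀ i, (Ω i).PosSemidef) (hz : 0 < z.im) (hd : ∀ i, 0 ≤ (d i).im) :
    IsUnit (detPencil Ω d z) ∧ ‖(detPencil Ω d z)⁻¹‖ ≤ 1 / z.im := by
  refine isUnit_of_im_le hz fun v => ?_
  have hq : ∀ i, ∃ r : ℝ, 0 ≤ r ∧ star v ⬝ᵥ Ω i *ᵥ v = r := fun i => by
    have := (hΩ i).dotProduct_mulVec_nonneg v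
    exact ⟨_, (Complex.le_def.1 this).1, Complex.ext rfl (by simpa using (Complex.le_def.1 this).2.symm)⟩
  choose r hr0 hr using hq
  have h1 : star v ⬝ᵥ detPencil Ω d z *ᵥ v =
      (1 / (Fintype.card ι : ℂ)) * ∑ i, (1 / (1 + d i)) * (r i : ℂ) -
        z * ((vnorm v ^ 2 : ℝ) : ℂ) := by
    simp only [detPencil, Matrix.sub_mulVec, Matrix.smul_mulVec, dotProduct_sub, dotProduct_smul,
      Matrix.one_mulVec, star_dotProduct_self, smul_eq_mul, Matrix.sum_mulVec, dotProduct_sum, hr]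
  have h2 : (1 / (Fintype.card ι : ℂ)) = ((1 / (Fintype.card ι : ℝ) : ℝ) : ℂ) := by push_cast; rfl
  rw [h1, h2, Complex.sub_im, Complex.re_ofReal_mul |> fun _ => Complex.im_ofReal_mul,
    Complex.im_mul_ofReal, Complex.im_sum]
  have h3 : ∑ i, ((1 / (1 + d i)) * (r i : ℂ)).im ≤ 0 := by
    refine Finset.sum_nonpos fun i _ => ?_
    rw [Complex.im_mul_ofReal, im_one_div_one_add]
    refine mul_nonpos_of_nonpos_of_nonneg ?_ (hr0 i)
    exact div_nonpos_of_nonpos_of_nonneg (by simpa using hd i) (by positivity)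
  have h4 : (1 / (Fintype.card ι : ℝ)) * ∑ i, ((1 / (1 + d i)) * (r i : ℂ)).im ≤ 0 :=
    mul_nonpos_of_nonneg_of_nonpos (by positivity) h3
  linarith

/-- Im z ≤ Im(z(1+d)) ≤ |z||1+d|. This is where the second positivity property of Stieltjes
transforms of measures on [0,∞), Im(z d) ≥ 0, is used. -/
theorem norm_one_div_one_add_le {d : ℂ} (hz : 0 < z.im) (hd : 0 ≤ (z * d).im) :
    1 + d ≠ 0 ∧ ‖1 / (1 + d)‖ ≤ ‖z‖ / z.im := by
  have h1 : z.im ≤ ‖z‖ * ‖1 + d‖ := by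
    rw [← norm_mul]
    refine le_trans ?_ ((le_abs_self _).trans (Complex.abs_im_le_norm _))
    rw [mul_add, mul_one, Complex.add_im]
    linarith
  have h2 : 1 + d ≠ 0 := by
    intro h
    rw [h, norm_zero, mul_zero] at h1
    linarith
  refine ⟨h2, ?_⟩
  rw [norm_div, norm_one, div_le_div_iff₀ (norm_pos_iff.2 h2) hz]
  linarith

theorem norm_detPencil_le {w : ℝ} (hw : ∀ i, ‖Ω i‖ ≤ w) (hw0 : 0 ≤ w) (hz : 0 < z.im)
    (hd : ∀ i, 0 ≤ (z * d i).im) : ‖detPencil Ω d z‖ ≤ ‖z‖ * (w / z.im + 1) := by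
  have h1 : ‖∑ i, (1 / (1 + d i)) • Ω i‖ ≤ Fintype.card ι * (‖z‖ / z.im * w) := by
    refine (norm_sum_le _ _).trans ?_
    refine (Finset.sum_le_sum (g := fun _ => ‖z‖ / z.im * w) fun i _ => ?_).trans ?_
    · rw [norm_smul]
      exact mul_le_mul (norm_one_div_one_add_le hz (hd i)).2 (hw i) (norm_nonneg _) (by positivity)
    · simp
  have h2 : ‖(1 / (Fintype.card ι : ℂ)) • ∑ i, (1 / (1 + d i)) • Ω i‖ ≤ ‖z‖ / z.im * w := by
    rw [norm_smul]
    rcases isEmpty_or_nonempty ι with hι | hι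
    · simp; positivity
    · have hc : (0 : ℝ) < Fintype.card ι := by exact_mod_cast Fintype.card_pos
      refine (mul_le_mul_of_nonneg_left h1 (norm_nonneg _)).trans ?_
      rw [norm_div, norm_one, Complex.norm_natCast]
      field_simp
      exact le_rfl
  have h3 : ‖z • (1 : Matrix κ κ ℂ)‖ ≤ ‖z‖ := by
    rw [norm_smul]
    exact mul_le_of_le_one_right (norm_nonneg _) opNorm_one_le
  calc ‖detPencil Ω d z‖ ≤ _ := norm_sub_le _ _
    _ ≤ ‖z‖ / z.im * w + ‖z‖ := add_le_add h2 h3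
    _ = _ := by ring

/-- The entries `(1/n²) tr (Ω_j T Ω_k Tᴴ) / |1 + d_k|²`, as real numbers. -/
def gainMatrix (Ω : ι → Matrix κ κ ℂ) (d : ι → ℂ) (T : Matrix κ κ ℂ) : Matrix ι ι ℝ :=
  Matrix.of fun j k =>
    ((1 / (Fintype.card ι : ℂ) ^ 2) * (Ω j * T * Ω k * Tᴴ).trace).re / ‖1 + d k‖ ^ 2

theorem trace_conj_nonneg {A B : Matrix κ κ ℂ} (hA : A.PosSemidef) (hB : B.PosSemidef)
    (T : Matrix κ κ ℂ) : 0 ≤ (A * T * B * Tᴴ).trace := by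
  have : A * T * B * Tᴴ = A * (T * B * Tᴴ) := by simp only [Matrix.mul_assoc]
  rw [this]
  exact trace_mul_nonneg hA (hB.mul_mul_conjTranspose_same T)

theorem inv_card_sq_mul_trace_nonneg (hΩ : ∀ i, (Ω i).PosSemidef) (T : Matrix κ κ ℂ) (j k : ι) :
    0 ≤ (1 / (Fintype.card ι : ℂ) ^ 2) * (Ω j * T * Ω k * Tᴴ).trace := by
  refine mul_nonneg ?_ (trace_conj_nonneg (hΩ j) (hΩ k) T)
  have : (1 / (Fintype.card ι : ℂ) ^ 2) = ((1 / (Fintype.card ι : ℝ) ^ 2 : ℝ) : ℂ) := by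
    push_cast; rfl
  rw [this]
  exact_mod_cast (by positivity : (0 : ℝ) ≤ 1 / (Fintype.card ι : ℝ) ^ 2)

theorem gainMatrix_nonneg (hΩ : ∀ i, (Ω i).PosSemidef) (T : Matrix κ κ ℂ) (j k : ι) :
    0 ≤ gainMatrix Ω d T j k :=
  div_nonneg (Complex.le_def.1 (inv_card_sq_mul_trace_nonneg hΩ T j k)).1 (by positivity)

theorem ofReal_gainMatrix (hΩ : ∀ i, (Ω i).PosSemidef) (T : Matrix κ κ ℂ) :
    (gainMatrix Ω d T).map Complex.ofReal = Matrix.of fun j k =>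
      (1 / (Fintype.card ι : ℂ) ^ 2) * (Ω j * T * Ω k * Tᴴ).trace / ((‖1 + d k‖ ^ 2 : ℝ) : ℂ) := by
  ext j k
  simp only [gainMatrix, Matrix.map_apply, Matrix.of_apply, Complex.ofReal_div]
  congr 1
  exact Complex.ext rfl (Complex.le_def.1 (inv_card_sq_mul_trace_nonneg hΩ T j k)).2

theorem sub_conj_one_div (d : ℂ) : star (1 / (1 + d)) - 1 / (1 + d) =
    2 * Complex.I * ((d.im / ‖1 + d‖ ^ 2 : ℝ) : ℂ) := by
  have h : ∀ u : ℂ, star u - u = -(2 * Complex.I * (u.im : ℂ)) := fun u => by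
    apply Complex.ext
    · simp
    · simp; ring
  rw [h, im_one_div_one_add, neg_div, Complex.ofReal_neg, mul_neg, neg_neg]

/-- The imaginary part of `(1/n) tr (Ω_i T)`. -/
theorem im_trace_mul_detPencil_inv (hΩ : ∀ i, (Ω i).PosSemidef) (hz : 0 < z.im)
    (hd : ∀ i, 0 ≤ (d i).im) (i : ι) :
    ((1 / (Fintype.card ι : ℂ)) * (Ω i * (detPencil Ω d z)⁻¹).trace).im =
      ∑ j, gainMatrix Ω d (detPencil Ω d z)⁻¹ i j * (d j).im +
        z.im * (1 / (Fintype.card ι : ℝ)) *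
          (Ω i * ((detPencil Ω d z)⁻¹ * ((detPencil Ω d z)⁻¹)ᴴ)).trace.re := by
  set M := detPencil Ω d z with hM
  set T := M⁻¹ with hT
  have hdet : IsUnit M.det := (Matrix.isUnit_iff_isUnit_det _).1 (isUnit_detPencil hΩ hz hd).1
  have hTM : T * M = 1 := Matrix.nonsing_inv_mul _ hdet
  have hMT : Mᴴ * Tᴴ = 1 := by rw [← Matrix.conjTranspose_mul, hTM, Matrix.conjTranspose_one]
  have hdiff : T - Tᴴ = T * (Mᴴ - M) * Tᴴ := by
    rw [Matrix.mul_sub, Matrix.sub_mul, Matrix.mul_assoc, hMT, hTM, Matrix.mul_one, Matrix.one_mul]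
  have hMM : Mᴴ - M = (2 * Complex.I) • ((1 / (Fintype.card ι : ℂ)) •
      ∑ j, (((d j).im / ‖1 + d j‖ ^ 2 : ℝ) : ℂ) • Ω j + (z.im : ℂ) • (1 : Matrix κ κ ℂ)) := by
    have h1 : ∀ j, (Ω j)ᴴ = Ω j := fun j => (hΩ j).isHermitian.eq
    rw [hM, detPencil]
    simp only [Matrix.conjTranspose_sub, Matrix.conjTranspose_smul, Matrix.conjTranspose_sum,
      Matrix.conjTranspose_one, h1]
    have h2 : star (1 / (Fintype.card ι : ℂ)) = 1 / (Fintype.card ι : ℂ) := by simp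
    have h3 : star z - z = -(2 * Complex.I * z.im) := by
      apply Complex.ext
      · simp
      · simp; ring
    rw [h2, smul_add, smul_comm (2 * Complex.I), Finset.smul_sum (r := 2 * Complex.I)]
    simp only [smul_smul (2 * Complex.I), ← sub_conj_one_div, sub_smul, Finset.sum_sub_distrib,
      smul_sub]
    have h4 : (2 * Complex.I * z.im) • (1 : Matrix κ κ ℂ) = z • 1 - star z • 1 := by
      rw [← sub_smul, ← neg_sub, h3, neg_neg]
    rw [h4]
    abel
  have htr : (Ω i * T).trace - star (Ω i * T).trace =
      2 * Complex.I * ((1 / (Fintype.card ι : ℂ)) *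
        ∑ j, (((d j).im / ‖1 + d j‖ ^ 2 : ℝ) : ℂ) * (Ω i * T * Ω j * Tᴴ).trace +
        (z.im : ℂ) * (Ω i * (T * Tᴴ)).trace) := by
    rw [← Matrix.trace_conjTranspose, Matrix.conjTranspose_mul, (hΩ i).isHermitian.eq,
      Matrix.trace_mul_comm Tᴴ, ← Matrix.trace_sub, ← Matrix.mul_sub, hdiff, hMM]
    simp only [Matrix.mul_smul, Matrix.smul_mul, Matrix.mul_add, Matrix.add_mul, Matrix.mul_sum,
      Matrix.sum_mul, Matrix.trace_smul, Matrix.trace_add, Matrix.trace_sum, smul_eq_mul,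
      Matrix.mul_one, Matrix.mul_assoc]
  have hre : ∀ j, (((1 / (Fintype.card ι : ℂ) ^ 2) * (Ω i * T * Ω j * Tᴴ).trace).re) =
      1 / (Fintype.card ι : ℝ) ^ 2 * (Ω i * T * Ω j * Tᴴ).trace.re := fun j => by
    have : (1 / (Fintype.card ι : ℂ) ^ 2) = ((1 / (Fintype.card ι : ℝ) ^ 2 : ℝ) : ℂ) := by
      push_cast; rfl
    rw [this, Complex.re_ofReal_mul]
  have him : ∀ u : ℂ, u.im = ((u - star u) / (2 * Complex.I)).re := fun u => by
    have : u - star u = 2 * Complex.I * u.im := by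
      apply Complex.ext
      · simp
      · simp; ring
    rw [this, mul_div_cancel_left₀ _ (by simp)]
    simp
  have hc : (1 / (Fintype.card ι : ℂ)) = ((1 / (Fintype.card ι : ℝ) : ℝ) : ℂ) := by push_cast; rfl
  rw [hc, Complex.im_ofReal_mul, him, htr, mul_div_cancel_left₀ _ (by simp), hc, Complex.add_re,
    Complex.re_ofReal_mul, Complex.re_ofReal_mul, Complex.re_sum, mul_add, Finset.mul_sum,
    Finset.mul_sum]
  congr 1
  · refine Finset.sum_congr rfl fun j _ => ?_
    rw [Complex.re_ofReal_mul, gainMatrix, Matrix.of_apply, hre]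
    ring
  · ring

end DetRes

end CorrelatedGaussian

namespace CorrelatedGaussian

/-! ### Stability: an approximate solution of the system controls its gain matrix. -/

section Stability

open scoped Matrix ComplexOrder

section

open scoped Matrix.Norms.L2Operator

variable {κ : Type*} [Fintype κ] [DecidableEq κ]

/-- If `wmin ≤ Ω` and `‖T⁻¹‖ ≤ L` then `tr (Ω T Tᴴ) ≥ wmin N / L²`. -/
theorem le_re_trace_mul_inv {Ω M : Matrix κ κ ℂ} {wmin L : ℝ} (hwmin : 0 ≤ wmin)
    (hΩ : ∀ v, wmin * vnorm v ^ 2 ≤ (star v ⬝ᵥ Ω *ᵥ v).re) (hM : IsUnit M) (hL : ‖M‖ ≤ L)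
    (hL0 : 0 < L) :
    wmin * (Fintype.card κ / L ^ 2) ≤ (Ω * (M⁻¹ * (M⁻¹)ᴴ)).trace.re := by
  have hdet : IsUnit M.det := (Matrix.isUnit_iff_isUnit_det _).1 hM
  have h1 : (Ω * (M⁻¹ * (M⁻¹)ᴴ)).trace = ∑ a, star (M⁻¹.col a) ⬝ᵥ Ω *ᵥ (M⁻¹.col a) := by
    rw [← Matrix.mul_assoc, Matrix.trace_mul_comm, Matrix.trace]
    refine Finset.sum_congr rfl fun a _ => ?_
    rw [Matrix.diag_apply, Matrix.mul_apply]
    rfl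
  -- The pencil sends column a of its inverse to the unit vector e_a, so that column has norm at
  -- least 1/L.
  have h2 : ∀ a, 1 / L ^ 2 ≤ vnorm (M⁻¹.col a) ^ 2 := by
    intro a
    have h3 : M *ᵥ (M⁻¹.col a) = Pi.single a 1 := by
      rw [← Matrix.mulVec_single_one, Matrix.mulVec_mulVec, Matrix.mul_nonsing_inv _ hdet,
        Matrix.one_mulVec]
    have h4 := vnorm_mulVec_le M (M⁻¹.col a)
    rw [h3, vnorm_single] at h4
    have h5 : 1 ≤ L * vnorm (M⁻¹.col a) :=
      h4.trans (mul_le_mul_of_nonneg_right hL (vnorm_nonneg _))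
    rw [div_le_iff₀ (by positivity), ← mul_pow, mul_comm]
    exact one_le_pow₀ h5
  rw [h1, Complex.re_sum]
  calc wmin * (Fintype.card κ / L ^ 2) = ∑ _a : κ, wmin * (1 / L ^ 2) := by
        simp; ring
    _ ≤ _ := Finset.sum_le_sum fun a _ =>
        (mul_le_mul_of_nonneg_left (h2 a) hwmin).trans (hΩ _)

end

variable {n N : ℕ} {Ω : Fin n → Matrix (Fin N) (Fin N) ℂ} {d : Fin n → ℂ} {z : ℂ}

/-- Puts the ratio M/β into the form announced in the theorem, by (w + y)² ≤ 2(w² + y²) and y = Im z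
≤ |z|. -/
theorem detPencil_bound_le {w : ℝ} (hz : 0 < z.im) :
    (‖z‖ * (w / z.im + 1)) ^ 2 / z.im ^ 2 ≤ 2 * (w ^ 2 + ‖z‖ ^ 2) ^ 2 / |z.im| ^ 4 := by
  have hy : z.im ≤ ‖z‖ := (le_abs_self _).trans (Complex.abs_im_le_norm z)
  have h1 : (‖z‖ * (w / z.im + 1)) ^ 2 / z.im ^ 2 = ‖z‖ ^ 2 * (w + z.im) ^ 2 / z.im ^ 4 := by
    field_simp
  rw [h1, abs_of_pos hz]
  refine div_le_div_of_nonneg_right ?_ (by positivity)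
  have h2 : (w + z.im) ^ 2 ≤ 2 * (w ^ 2 + ‖z‖ ^ 2) := by
    nlinarith [sq_nonneg (w - z.im), hz, hy]
  calc ‖z‖ ^ 2 * (w + z.im) ^ 2 ≤ (w ^ 2 + ‖z‖ ^ 2) * (2 * (w ^ 2 + ‖z‖ ^ 2)) := by
        refine mul_le_mul ?_ h2 (by positivity) (by positivity)
        nlinarith [sq_nonneg w]
    _ = _ := by ring

open Matrix.Norms.L2Operator in
/-- An approximate solution `d` of the canonical system, with nonnegative imaginary parts, controls
the matrix of gains built from `d`. -/
theorem spectralRadius_and_norm_of_approx_solution_aux {wmin w : ℝ} (hn : 0 < n)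
    (hΩ : ∀ i, (Ω i).PosSemidef) (hwmin : 0 < wmin) (hw0 : 0 < w)
    (hlow : ∀ i v, wmin * vnorm v ^ 2 ≤ (star v ⬝ᵥ Ω i *ᵥ v).re) (hw : ∀ i, ‖Ω i‖ ≤ w)
    (hz : 0 < z.im) (hd : ∀ i, 0 ≤ (d i).im) (hzd : ∀ i, 0 ≤ (z * d i).im)
    (herr : ∀ i, ‖d i - (1 / (n : ℂ)) * (Ω i * detResolvent Ω d z).trace‖ ≤
      1 / 2 * (z.im * (1 / n) * (wmin * (N / (‖z‖ * (w / z.im + 1)) ^ 2)))) (i : Fin n) :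
    ∑ j, gainMatrix Ω d (detPencil Ω d z)⁻¹ i j * (d j).im +
      1 / 2 * (z.im * (1 / n) * (wmin * (N / (‖z‖ * (w / z.im + 1)) ^ 2))) ≤ (d i).im := by
  have hzn : 0 < ‖z‖ := norm_pos_iff.2 fun h => by simp [h] at hz
  have hpen := isUnit_detPencil hΩ hz hd (d := d)
  have h1 := im_trace_mul_detPencil_inv hΩ hz hd i (d := d)
  have h2 := le_re_trace_mul_inv hwmin.le (hlow i) hpen.1 (norm_detPencil_le hw hw0.le hz hzd)
    (by positivity)
  have h3 := herr i
  rw [detResolvent_eq_inv] at h3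
  have h4 := (Complex.abs_im_le_norm _).trans h3
  rw [Complex.sub_im, abs_le] at h4
  rw [Fintype.card_fin] at h1 h2
  rw [h1] at h4
  have h5 : z.im * (1 / n) * (wmin * (N / (‖z‖ * (w / z.im + 1)) ^ 2)) ≤
      z.im * (1 / n) * (Ω i * ((detPencil Ω d z)⁻¹ * ((detPencil Ω d z)⁻¹)ᴴ)).trace.re :=
    mul_le_mul_of_nonneg_left h2 (by positivity)
  linarith [h4.1]

-- The norm in the conclusion is the maximal row sum; the upper bound on Ω_i is therefore phrased
-- with `vnorm` rather than with an operator norm.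
theorem spectralRadius_and_norm_of_approx_solution {wmin w : ℝ} (hN : 0 < N) (hn : 0 < n)
    (hΩ : ∀ i, (Ω i).PosSemidef) (hwmin : 0 < wmin) (hw0 : 0 < w)
    (hlow : ∀ i v, wmin * vnorm v ^ 2 ≤ (star v ⬝ᵥ Ω i *ᵥ v).re)
    (hw : ∀ i v, vnorm (Ω i *ᵥ v) ≤ w * vnorm v)
    (hz : 0 < z.im) (hd : ∀ i, 0 ≤ (d i).im) (hzd : ∀ i, 0 ≤ (z * d i).im)
    (hdM : ∀ i, (d i).im ≤ N / n * (w / z.im))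
    (herr : ∀ i, ‖d i - (1 / (n : ℂ)) * (Ω i * detResolvent Ω d z).trace‖ ≤
      1 / 2 * (z.im * (1 / n) * (wmin * (N / (‖z‖ * (w / z.im + 1)) ^ 2))))
    {C : Matrix (Fin n) (Fin n) ℂ} (hC : C = Matrix.of fun j k =>
      (1 / (n : ℂ) ^ 2) * (Ω j * detResolvent Ω d z * Ω k * (detResolvent Ω d z)ᴴ).trace /
        ((‖1 + d k‖ ^ 2 : ℝ) : ℂ)) :
    spectralRadius ℂ C < 1 ∧
      ‖(1 - C)⁻¹‖ ≤ 4 * w / wmin * (w ^ 2 + ‖z‖ ^ 2) ^ 2 / |z.im| ^ 4 := by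
  have hzn : 0 < ‖z‖ := norm_pos_iff.2 fun h => by simp [h] at hz
  have hN' : (0 : ℝ) < N := by exact_mod_cast hN
  have hn' : (0 : ℝ) < n := by exact_mod_cast hn
  have hC' : C = (gainMatrix Ω d (detPencil Ω d z)⁻¹).map Complex.ofReal := by
    rw [hC, ofReal_gainMatrix hΩ, detResolvent_eq_inv, Fintype.card_fin]
  have hb := spectralRadius_and_norm_of_approx_solution_aux hn hΩ hwmin hw0 hlow
    (fun i => opNorm_le_of_vnorm_le _ hw0.le (hw i)) hz hd hzd herr
  set b := 1 / 2 * (z.im * (1 / n) * (wmin * (N / (‖z‖ * (w / z.im + 1)) ^ 2))) with hbdef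
  have hb0 : 0 < b := by positivity
  -- The imaginary parts become strictly positive: the gain matrix is nonnegative and the source
  -- term b is positive.
  replace hd : ∀ i, 0 < (d i).im := fun i => by
    have : 0 ≤ ∑ j, gainMatrix Ω d (detPencil Ω d z)⁻¹ i j * (d j).im :=
      Finset.sum_nonneg fun j _ => mul_nonneg (gainMatrix_nonneg hΩ _ i j) (hd j)
    linarith [hb i]
  rw [hC']
  refine ⟨spectralRadius_lt_one_of_subinvariant hn (gainMatrix_nonneg hΩ _) hd hb0 hb hdM, ?_⟩
  refine (norm_inv_one_sub_le_of_subinvariant hn (gainMatrix_nonneg hΩ _) hd hb0 hb hdM).trans ?_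
  have h1 := mul_le_mul_of_nonneg_left (detPencil_bound_le (z := z) (w := w) hz)
    (by positivity : 0 ≤ 2 * w / wmin)
  -- The ratio N/n occurs in both the upper bound and the source term and cancels, so the constant
  -- does not depend on N.
  calc N / n * (w / z.im) / b
      = 2 * w / wmin * ((‖z‖ * (w / z.im + 1)) ^ 2 / z.im ^ 2) := by
        rw [hbdef]; field_simp
    _ ≤ _ := h1
    _ = _ := by ring

end Stability

end CorrelatedGaussian

namespace CorrelatedGaussian

/-! ### Continuous functions of polynomial growth and their Gaussian integrability. -/

section PolyBdd

variable {E F : Type*} [NormedAddCommGroup E] [NormedAddCommGroup F]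

/-- Continuous functions of at most polynomial growth. -/
def PolyBdd (f : E → ℂ) : Prop :=
  Continuous f ∧ ∃ (C : ℝ) (k : ℕ), ∀ p, ‖f p‖ ≤ C * (1 + ‖p‖) ^ k

namespace PolyBdd

variable {f g : E → ℂ}

theorem exists_le (hf : PolyBdd f) :
    ∃ (C : ℝ) (k : ℕ), 0 ≤ C ∧ ∀ p, ‖f p‖ ≤ C * (1 + ‖p‖) ^ k := by
  obtain ⟨C, k, h⟩ := hf.2
  refine ⟨|C|, k, abs_nonneg C, fun p => (h p).trans ?_⟩
  exact mul_le_mul_of_nonneg_right (le_abs_self C) (by positivity)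

theorem of_bounded (hf : Continuous f) (C : ℝ) (h : ∀ p, ‖f p‖ ≤ C) : PolyBdd f :=
  ⟨hf, C, 0, fun p => by simpa using h p⟩

theorem const (c : ℂ) : PolyBdd fun _ : E => c := of_bounded continuous_const ‖c‖ fun _ => le_rfl

theorem add (hf : PolyBdd f) (hg : PolyBdd g) : PolyBdd fun p => f p + g p := by
  obtain ⟨C, k, hC, h⟩ := hf.exists_le
  obtain ⟨D, l, hD, h'⟩ := hg.exists_le
  refine ⟨hf.1.add hg.1, C + D, max k l, fun p => (norm_add_le _ _).trans ?_⟩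
  have h1 : (1 : ℝ) ≤ 1 + ‖p‖ := by linarith [norm_nonneg p]
  rw [add_mul]
  refine add_le_add ((h p).trans ?_) ((h' p).trans ?_)
  · exact mul_le_mul_of_nonneg_left (pow_le_pow_right₀ h1 (le_max_left _ _)) hC
  · exact mul_le_mul_of_nonneg_left (pow_le_pow_right₀ h1 (le_max_right _ _)) hD

theorem mul (hf : PolyBdd f) (hg : PolyBdd g) : PolyBdd fun p => f p * g p := by
  obtain ⟨C, k, hC, h⟩ := hf.exists_le
  obtain ⟨D, l, hD, h'⟩ := hg.exists_le
  refine ⟨hf.1.mul hg.1, C * D, k + l, fun p => ?_⟩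
  rw [norm_mul, pow_add, mul_mul_mul_comm]
  exact mul_le_mul (h p) (h' p) (norm_nonneg _) (by positivity)

theorem neg (hf : PolyBdd f) : PolyBdd fun p => -f p := by
  simpa using (const (-1)).mul hf

theorem sub (hf : PolyBdd f) (hg : PolyBdd g) : PolyBdd fun p => f p - g p := by
  simpa [sub_eq_add_neg] using hf.add hg.neg

theorem star (hf : PolyBdd f) : PolyBdd fun p => star (f p) :=
  ⟨hf.1.star, hf.2.imp fun C h => h.imp fun k h p => by simpa using h p⟩

theorem sum {ι : Type*} (s : Finset ι) {f : ι → E → ℂ} (h : ∀ i ∈ s, PolyBdd (f i)) :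
    PolyBdd fun p => ∑ i ∈ s, f i p := by
  classical
  induction s using Finset.induction_on with
  | empty => simpa using const (E := E) 0
  | insert a s ha ih =>
    simp only [Finset.sum_insert ha]
    exact (h a (by simp)).add (ih fun i hi => h i (by simp [hi]))

theorem ofReal_norm (hf : PolyBdd f) : PolyBdd fun p => ((‖f p‖ : ℝ) : ℂ) :=
  ⟨Complex.continuous_ofReal.comp hf.1.norm,
    hf.2.imp fun C h => h.imp fun k h p => by simpa using h p⟩

/-- Composition with a continuous map of at most linear growth. -/
theorem comp (hf : PolyBdd f) {u : F → E} (hu : Continuous u) {c : ℝ}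
    (h : ∀ p, ‖u p‖ ≤ c * (1 + ‖p‖)) : PolyBdd fun p => f (u p) := by
  obtain ⟨C, k, hC, h'⟩ := hf.exists_le
  refine ⟨hf.1.comp hu, C * (1 + |c|) ^ k, k, fun p => (h' (u p)).trans ?_⟩
  rw [mul_assoc, ← mul_pow]
  refine mul_le_mul_of_nonneg_left (pow_le_pow_left₀ (by positivity) ?_ k) hC
  have h1 : c * (1 + ‖p‖) ≤ |c| * (1 + ‖p‖) :=
    mul_le_mul_of_nonneg_right (le_abs_self c) (by positivity)
  linarith [h p, norm_nonneg p]

theorem fst {f : E → ℂ} (hf : PolyBdd f) : PolyBdd fun p : E × F => f p.1 :=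
  hf.comp continuous_fst (c := 1) fun p => by
    have := norm_fst_le p
    linarith

theorem snd {f : F → ℂ} (hf : PolyBdd f) : PolyBdd fun p : E × F => f p.2 :=
  hf.comp continuous_snd (c := 1) fun p => by
    have := norm_snd_le p
    linarith

variable [MeasurableSpace E] [BorelSpace E] [SecondCountableTopology E] [NormedSpace ℝ E]
  [CompleteSpace E]

theorem integrable_norm_pow (γ : Measure E) [IsGaussian γ] (k : ℕ) :
    Integrable (fun p => (1 + ‖p‖) ^ k) γ := by
  have h0 : MemLp (fun p : E => ‖p‖) k γ := (IsGaussian.memLp_id γ k (by simp)).norm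
  have h1 : MemLp (fun p : E => 1 + ‖p‖) k γ := (memLp_const (1 : ℝ)).add h0
  refine (h1.integrable_norm_pow').congr (ae_of_all _ fun p => ?_)
  simp only [Real.norm_eq_abs]
  rw [abs_of_nonneg (by positivity)]

theorem integrable (hf : PolyBdd f) (γ : Measure E) [IsGaussian γ] : Integrable f γ := by
  obtain ⟨C, k, hC, h⟩ := hf.exists_le
  exact ((integrable_norm_pow γ k).const_mul C).mono' hf.1.aestronglyMeasurable
    (ae_of_all _ h)

theorem integrable_norm_sq (hf : PolyBdd f) (γ : Measure E) [IsGaussian γ] :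
    Integrable (fun p => ‖f p‖ ^ 2) γ := by
  have := ((hf.ofReal_norm.mul hf.ofReal_norm).integrable γ).re
  refine this.congr (ae_of_all _ fun p => ?_)
  simp only [← Complex.ofReal_mul]
  simp [sq]

end PolyBdd

end PolyBdd

/-! ### Gaussian integration by parts and the Poincaré inequality from rotation invariance. -/

section Rotation

variable {E : Type*} [NormedAddCommGroup E] [NormedSpace ℝ E] [MeasurableSpace E] [BorelSpace E]
  [SecondCountableTopology E] [CompleteSpace E]

local notation "rot" => ContinuousLinearMap.rotation

theorem norm_rotation_le (t : ℝ) (p : E × E) :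
    ‖rot t p‖ ≤ 2 * ‖p‖ := by
  have hc := Real.abs_cos_le_one t
  have hs := Real.abs_sin_le_one t
  have h1 := norm_fst_le p
  have h2 := norm_snd_le p
  have key : ∀ a b : ℝ, |a| ≤ 1 → |b| ≤ 1 → ‖a • p.1 + b • p.2‖ ≤ 2 * ‖p‖ := by
    intro a b ha hb
    refine (norm_add_le _ _).trans ?_
    rw [norm_smul, norm_smul, Real.norm_eq_abs, Real.norm_eq_abs]
    nlinarith [abs_nonneg a, abs_nonneg b, norm_nonneg p.1, norm_nonneg p.2]
  rw [ContinuousLinearMap.rotation_apply, Prod.norm_mk]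
  exact max_le (key _ _ hc hs) (key _ _ (by rwa [abs_neg]) hc)

theorem rotation_add (s t : ℝ) (p : E × E) : 
    ContinuousLinearMap.rotation (s + t) p = rot s (rot t p) := by
  simp only [ContinuousLinearMap.rotation_apply, Real.cos_add, Real.sin_add]
  ext
  · simp only []; module
  · simp only []; module

theorem continuous_rotation : Continuous fun q : ℝ × (E × E) => rot q.1 q.2 := by
  simp only [ContinuousLinearMap.rotation_apply]
  fun_prop

theorem continuous_rotation_path (p : E × E) : Continuous fun t : ℝ => rot t p := by
  simp only [ContinuousLinearMap.rotation_apply]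
  fun_prop

/-- `ψ'` is the derivative of `ψ` along the rotations of `E × E`. -/
def HasRotDeriv (ψ ψ' : E × E → ℂ) : Prop :=
  ∀ p, HasDerivAt (fun t : ℝ => ψ (rot t p)) (ψ' p) 0

/-- The rotations form a one-parameter group, so differentiability at angle 0 at every point gives
it along the whole orbit. -/
theorem HasRotDeriv.hasDerivAt {ψ ψ' : E × E → ℂ} (h : HasRotDeriv ψ ψ') (p : E × E) (s : ℝ) :
    HasDerivAt (fun t : ℝ => ψ (rot t p)) (ψ' (rot s p)) s := by
  have h1 := h (rot s p)
  rw [← sub_self s] at h1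
  have h3 := h1.comp_sub_const s s
  simpa only [← rotation_add, sub_add_cancel] using h3

theorem HasRotDeriv.integral_eq {ψ ψ' : E × E → ℂ} (h : HasRotDeriv ψ ψ') (hψ' : Continuous ψ')
    (p : E × E) (c : ℝ) : ∫ t in (0 : ℝ)..c, ψ' (rot t p) = ψ (rot c p) - ψ p := by
  have hcont : Continuous fun t : ℝ => ψ' (rot t p) :=
    hψ'.comp (continuous_rotation_path p)
  have h1 := intervalIntegral.integral_eq_sub_of_hasDerivAt (a := 0) (b := c)
    (f := fun t : ℝ => ψ (rot t p)) (f' := fun t : ℝ => ψ' (rot t p))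
    (fun t _ => h.hasDerivAt p t) (hcont.intervalIntegrable _ _)
  have h0 : rot 0 p = p := by simp [ContinuousLinearMap.rotation_apply]
  rw [h1]
  simp only [h0]

variable {γ : Measure E} [IsGaussian γ]

theorem integral_comp_rotation (hγ : γ[id] = 0) {G : Type*} [NormedAddCommGroup G]
    [NormedSpace ℝ G] {f : E × E → G} (hf : Continuous f)
    (hs : SecondCountableTopology G) (t : ℝ) :
    ∫ p, f (rot t p) ∂(γ.prod γ) = ∫ p, f p ∂(γ.prod γ) := by
  borelize G
  conv_rhs => rw [← IsGaussian.map_rotation_eq_self hγ t]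
  rw [integral_map (by fun_prop) hf.aestronglyMeasurable]

/-- Averaging over a rotation path commutes with the expectation. -/
theorem integral_integral_rotation {f : E × E → ℂ} (hγ : γ[id] = 0) (hf : PolyBdd f) (c : ℝ) :
    ∫ p, (∫ t in (0 : ℝ)..c, f (rot t p)) ∂(γ.prod γ) = c • ∫ p, f p ∂(γ.prod γ) := by
  obtain ⟨C, k, hC, h⟩ := hf.exists_le
  have hint : Integrable (Function.uncurry fun (t : ℝ) (p : E × E) => f (rot t p))
      ((volume.restrict (Set.uIoc 0 c)).prod (γ.prod γ)) := by
    have hcont : Continuous (Function.uncurry fun (t : ℝ) (p : E × E) => f (rot t p)) :=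
      hf.1.comp continuous_rotation
    have hdom : Integrable (fun q : ℝ × (E × E) => (1 : ℝ) * (C * 2 ^ k * (1 + ‖q.2‖) ^ k))
        ((volume.restrict (Set.uIoc 0 c)).prod (γ.prod γ)) := by
      refine Integrable.mul_prod (f := fun _ : ℝ => (1 : ℝ))
        (g := fun p : E × E => C * 2 ^ k * (1 + ‖p‖) ^ k) ?_ ?_
      · have : IsFiniteMeasure (volume.restrict (Set.uIoc 0 c)) := by
          rw [Set.uIoc]; infer_instance
        exact integrable_const 1
      · exact (PolyBdd.integrable_norm_pow (γ.prod γ) k).const_mul _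
    refine hdom.mono' hcont.aestronglyMeasurable (ae_of_all _ fun q => ?_)
    refine (h (rot q.1 q.2)).trans ?_
    rw [one_mul, mul_assoc, ← mul_pow]
    refine mul_le_mul_of_nonneg_left (pow_le_pow_left₀ (by positivity) ?_ k) hC
    linarith [norm_rotation_le q.1 q.2]
  rw [← intervalIntegral_integral_swap hint]
  simp only [integral_comp_rotation hγ hf.1 inferInstance]
  simp

/-- Gaussian integration by parts: derivatives along rotations have mean zero. -/
theorem integral_rotDeriv_eq_zero {ψ ψ' : E × E → ℂ} (hγ : γ[id] = 0) (h : HasRotDeriv ψ ψ')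
    (hψ : PolyBdd ψ) (hψ' : PolyBdd ψ') : ∫ p, ψ' p ∂(γ.prod γ) = 0 := by
  -- The mean of ψ' equals the mean of its average along the path t ∈ [0,1], that is, of ψ∘rot₁ − ψ,
  -- and this vanishes by invariance. No derivative has to be taken under the expectation.
  have h1 := integral_integral_rotation (γ := γ) hγ hψ' 1
  simp only [h.integral_eq hψ'.1, one_smul] at h1
  have hrot : PolyBdd fun p : E × E => ψ (rot 1 p) :=
    hψ.comp (ContinuousLinearMap.continuous _) (c := 2) fun p => by
      linarith [norm_rotation_le 1 p]
  rw [← h1, integral_sub (hrot.integrable _) (hψ.integrable _),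
    integral_comp_rotation hγ hψ.1 inferInstance, sub_self]

/-- Cauchy–Schwarz on [0,c], from the nonnegativity of ∫ (‖f‖ − I/c)². -/
theorem norm_intervalIntegral_sq_le {f : ℝ → ℂ} (hf : Continuous f) {c : ℝ} (hc : 0 < c) :
    ‖∫ t in (0 : ℝ)..c, f t‖ ^ 2 ≤ c * ∫ t in (0 : ℝ)..c, ‖f t‖ ^ 2 := by
  set I := ∫ t in (0 : ℝ)..c, ‖f t‖ with hI
  have h1 : ‖∫ t in (0 : ℝ)..c, f t‖ ≤ I := intervalIntegral.norm_integral_le_integral_norm hc.le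
  have h2 : 0 ≤ ∫ t in (0 : ℝ)..c, (‖f t‖ - I / c) ^ 2 :=
    intervalIntegral.integral_nonneg hc.le fun t _ => sq_nonneg _
  have h3 : ∫ t in (0 : ℝ)..c, (‖f t‖ - I / c) ^ 2 =
      (∫ t in (0 : ℝ)..c, ‖f t‖ ^ 2) - I ^ 2 / c := by
    have : ∀ t, (‖f t‖ - I / c) ^ 2 = ‖f t‖ ^ 2 - (2 * (I / c)) * ‖f t‖ + (I / c) ^ 2 :=
      fun t => by ring
    simp only [this]
    rw [intervalIntegral.integral_add, intervalIntegral.integral_sub,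
      intervalIntegral.integral_const_mul, ← hI, intervalIntegral.integral_const]
    · simp only [smul_eq_mul, sub_zero]; field_simp; ring
    all_goals exact Continuous.intervalIntegrable (by fun_prop) _ _
  rw [h3] at h2
  have h4 : I ^ 2 ≤ c * ∫ t in (0 : ℝ)..c, ‖f t‖ ^ 2 := by
    rw [sub_nonneg, div_le_iff₀ hc] at h2
    linarith
  exact (pow_le_pow_left₀ (norm_nonneg _) h1 2).trans h4

/-- Write the increment as an integral of ψ' over a quarter turn, apply Cauchy–Schwarz in t, then
rotation invariance for each t. The resulting constant (π/2)² is at most 4. -/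
theorem integral_rotation_sub_sq_le {ψ ψ' : E × E → ℂ} (hγ : γ[id] = 0) (h : HasRotDeriv ψ ψ')
    (hψ : PolyBdd ψ) (hψ' : PolyBdd ψ') :
    ∫ p, ‖ψ (rot (Real.pi / 2) p) - ψ p‖ ^ 2 ∂(γ.prod γ) ≤ 4 * ∫ p, ‖ψ' p‖ ^ 2 ∂(γ.prod γ) := by
  have hpi : (0 : ℝ) < Real.pi / 2 := by positivity
  have hrot : PolyBdd fun p : E × E => ψ (rot (Real.pi / 2) p) :=
    hψ.comp (ContinuousLinearMap.continuous _) (c := 2) fun p => by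
      linarith [norm_rotation_le (Real.pi / 2) p]
  have hsq : PolyBdd fun p => ((‖ψ' p‖ ^ 2 : ℝ) : ℂ) := by
    have := hψ'.ofReal_norm.mul hψ'.ofReal_norm
    simpa [sq] using this
  have h1 := integral_integral_rotation (γ := γ) hγ hsq (Real.pi / 2)
  simp only [intervalIntegral.integral_ofReal, Complex.real_smul] at h1
  rw [integral_complex_ofReal, integral_complex_ofReal, ← Complex.ofReal_mul, Complex.ofReal_inj] at h1
  have hnn : 0 ≤ ∫ p, ‖ψ' p‖ ^ 2 ∂(γ.prod γ) := integral_nonneg fun p => sq_nonneg _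
  have hi2 : Integrable (fun p : E × E => ∫ t in (0 : ℝ)..(Real.pi / 2), ‖ψ' (rot t p)‖ ^ 2)
      (γ.prod γ) := by
    obtain ⟨C, k, hC, hb⟩ := hsq.exists_le
    refine ((PolyBdd.integrable_norm_pow (γ.prod γ) k).const_mul
      (C * 2 ^ k * (Real.pi / 2))).mono' ?_ (ae_of_all _ fun p => ?_)
    · refine Continuous.aestronglyMeasurable ?_
      refine intervalIntegral.continuous_parametric_intervalIntegral_of_continuous' ?_ _ _
      exact (hψ'.1.comp (continuous_rotation.comp continuous_swap)).norm.pow 2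
    · have h5 := intervalIntegral.norm_integral_le_of_norm_le_const (a := 0) (b := Real.pi / 2)
        (f := fun t => ‖ψ' (rot t p)‖ ^ 2) (C := C * 2 ^ k * (1 + ‖p‖) ^ k) fun t _ => by
          have h6 := hb (rot t p)
          rw [Complex.norm_real] at h6
          refine h6.trans ?_
          rw [mul_assoc, ← mul_pow]
          refine mul_le_mul_of_nonneg_left (pow_le_pow_left₀ (by positivity) ?_ k) hC
          linarith [norm_rotation_le t p]
      refine h5.trans_eq ?_
      rw [sub_zero, abs_of_pos hpi]
      ring
  calc ∫ p, ‖ψ (rot (Real.pi / 2) p) - ψ p‖ ^ 2 ∂(γ.prod γ)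
      ≤ ∫ p, Real.pi / 2 * (∫ t in (0 : ℝ)..(Real.pi / 2), ‖ψ' (rot t p)‖ ^ 2) ∂(γ.prod γ) := by
        refine integral_mono ((hrot.sub hψ).integrable_norm_sq _) (hi2.const_mul _) fun p => ?_
        have h2 := norm_intervalIntegral_sq_le (f := fun t => ψ' (rot t p))
          (hψ'.1.comp (continuous_rotation_path p)) hpi
        rwa [h.integral_eq hψ'.1] at h2
    _ = Real.pi / 2 * (Real.pi / 2 * ∫ p, ‖ψ' p‖ ^ 2 ∂(γ.prod γ)) := by
        rw [integral_const_mul, h1]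
    _ ≤ 4 * ∫ p, ‖ψ' p‖ ^ 2 ∂(γ.prod γ) := by
        have h3 : Real.pi / 2 ≤ 2 := by linarith [Real.pi_le_four]
        nlinarith [mul_le_mul_of_nonneg_right h3 hnn, mul_nonneg hpi.le hnn]

/-- The Gaussian Poincaré inequality. -/
theorem integral_norm_sub_mean_sq_le {f : E → ℂ} {f' : E × E → ℂ} (hγ : γ[id] = 0)
    (h : HasRotDeriv (fun p => f p.1) f') (hf : PolyBdd f) (hf' : PolyBdd f') :
    ∫ x, ‖f x - ∫ y, f y ∂γ‖ ^ 2 ∂γ ≤ 2 * ∫ x, ∫ y, ‖f' (x, y)‖ ^ 2 ∂γ ∂γ := by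
  set m := ∫ y, f y ∂γ with hm
  have hg : PolyBdd fun x => f x - m := hf.sub (PolyBdd.const m)
  have hg0 : ∫ x, (f x - m) ∂γ = 0 := by
    rw [integral_sub (hf.integrable γ) (integrable_const m)]
    simp [hm]
  have h1 := integral_rotation_sub_sq_le hγ h hf.fst hf'
  have h2 : ∀ p : E × E, ‖f (rot (Real.pi / 2) p).1 - f p.1‖ ^ 2 =
      ‖f p.2 - m‖ ^ 2 + ‖f p.1 - m‖ ^ 2 - 2 * ((f p.2 - m) * star (f p.1 - m)).re := by
    intro p
    -- A quarter turn replaces x by the independent copy y, so the quantity bounded is E|f(y) −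
    -- f(x)|², which is twice the variance.
    have h3 : (rot (Real.pi / 2) p).1 = p.2 := by simp [ContinuousLinearMap.rotation_apply]
    rw [h3]
    have h4 : f p.2 - f p.1 = (f p.2 - m) - (f p.1 - m) := by ring
    rw [h4, ← Complex.normSq_eq_norm_sq, ← Complex.normSq_eq_norm_sq, ← Complex.normSq_eq_norm_sq,
      Complex.normSq_sub]
    rfl
  have hcross : ∫ p : E × E, ((f p.2 - m) * star (f p.1 - m)).re ∂(γ.prod γ) = 0 := by
    have hi := (hg.snd (E := E) (F := E)).mul (hg.star.fst (E := E) (F := E))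
    have h5 := integral_prod_mul (μ := γ) (ν := γ) (fun x => star (f x - m)) (fun y => f y - m)
    rw [hg0, mul_zero] at h5
    have h6 : ∫ p : E × E, ((f p.2 - m) * star (f p.1 - m)).re ∂(γ.prod γ) =
        (∫ p : E × E, (f p.2 - m) * star (f p.1 - m) ∂(γ.prod γ)).re :=
      integral_re (hi.integrable (γ.prod γ))
    rw [h6]
    simp only [mul_comm (f _ - m)]
    rw [h5, Complex.zero_re]
  have hi1 := (hg.fst (E := E) (F := E)).integrable_norm_sq (γ.prod γ)
  have hi2 := (hg.snd (E := E) (F := E)).integrable_norm_sq (γ.prod γ)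
  have hi3 : Integrable (fun p : E × E => ((f p.2 - m) * star (f p.1 - m)).re) (γ.prod γ) :=
    (((hg.snd (E := E) (F := E)).mul (hg.star.fst (E := E) (F := E))).integrable (γ.prod γ)).re
  simp only [h2] at h1
  have hi12 : Integrable (fun p : E × E => ‖f p.2 - m‖ ^ 2 + ‖f p.1 - m‖ ^ 2) (γ.prod γ) :=
    hi2.add hi1
  rw [integral_sub hi12 (hi3.const_mul 2), integral_const_mul, hcross,
    integral_add hi2 hi1] at h1
  have h7 : ∫ p : E × E, ‖f p.1 - m‖ ^ 2 ∂(γ.prod γ) = ∫ x, ‖f x - m‖ ^ 2 ∂γ := by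
    rw [integral_prod _ hi1]; simp
  have h8 : ∫ p : E × E, ‖f p.2 - m‖ ^ 2 ∂(γ.prod γ) = ∫ x, ‖f x - m‖ ^ 2 ∂γ := by
    rw [integral_prod _ hi2]; simp
  rw [h7, h8, integral_prod _ (hf'.integrable_norm_sq _)] at h1
  linarith

end Rotation

end CorrelatedGaussian

namespace CorrelatedGaussian

/-! ### Products of Gaussian laws. -/

section GaussianProduct

variable {ι : Type*} [Fintype ι] {E : Type*} [NormedAddCommGroup E] [NormedSpace ℝ E]
  [MeasurableSpace E] [BorelSpace E] [SecondCountableTopology E] [CompleteSpace E]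

theorem isGaussian_pi (μ : ι → Measure E) [∀ i, IsGaussian (μ i)] :
    IsGaussian (Measure.pi μ) := by
  have h1 : iIndepFun (fun i (x : ι → E) => x i) (Measure.pi μ) :=
    iIndepFun_pi (X := fun _ => id) fun i => aemeasurable_id
  have h2 : ∀ i, HasGaussianLaw (fun x : ι → E => x i) (Measure.pi μ) := fun i => ⟨by
    have := (measurePreserving_eval μ i).map_eq
    exact this ▸ inferInstance⟩
  have h3 := (iIndepFun.hasGaussianLaw h2 h1).isGaussian_map
  rwa [show (fun (ω : ι → E) => fun x => ω x) = id from rfl, Measure.map_id] at h3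

theorem integral_id_pi (μ : ι → Measure E) [∀ i, IsGaussian (μ i)] (h : ∀ i, ∫ x, x ∂(μ i) = 0) :
    (Measure.pi μ)[id] = 0 := by
  have := isGaussian_pi μ
  have hi : Integrable (fun x : ι → E => x) (Measure.pi μ) := IsGaussian.integrable_id
  funext i
  have h1 := (ContinuousLinearMap.proj (R := ℝ) (φ := fun _ : ι => E) i).integral_comp_comm hi
  simp only [ContinuousLinearMap.proj_apply] at h1
  simp only [id, Pi.zero_apply]
  rw [← h1, integral_comp_eval (μ := μ) (f := fun x => x) (by fun_prop), h i]

theorem integral_mul_pi_of_ne (μ : ι → Measure E) [∀ i, IsProbabilityMeasure (μ i)] {k l : ι}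
    (hkl : k ≠ l) {f g : E → ℂ} (hf : Continuous f) (hg : Continuous g) :
    ∫ x, f (x k) * g (x l) ∂(Measure.pi μ) = (∫ x, f x ∂(μ k)) * ∫ x, g x ∂(μ l) := by
  have h1 : iIndepFun (fun i (x : ι → E) => x i) (Measure.pi μ) :=
    iIndepFun_pi (X := fun _ => id) fun i => aemeasurable_id
  have h2 := ((h1.indepFun hkl).comp hf.measurable hg.measurable).integral_fun_mul_eq_mul_integral
    (by exact (hf.comp (continuous_apply k)).aestronglyMeasurable)
    (by exact (hg.comp (continuous_apply l)).aestronglyMeasurable)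
  simp only [Function.comp] at h2
  rw [h2, integral_comp_eval (μ := μ) (f := f) hf.aestronglyMeasurable,
    integral_comp_eval (μ := μ) (f := g) hg.aestronglyMeasurable]

end GaussianProduct

/-! ### Moments of the standard complex Gaussian law. -/

section StdComplex

instance : IsGaussian stdComplexGaussian := by
  have : stdComplexGaussian = ((gaussianReal 0 (1 / 2)).prod (gaussianReal 0 (1 / 2))).map
      (Complex.equivRealProdCLM.symm : ℝ × ℝ →L[ℝ] ℂ) := by
    rw [stdComplexGaussian]
    congr 1
  rw [this]
  infer_instance

theorem continuous_complex_mk : Continuous fun p : ℝ × ℝ => (⟨p.1, p.2⟩ : ℂ) :=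
  Complex.equivRealProdCLM.symm.continuous

theorem integral_stdComplexGaussian {f : ℂ → ℂ} (hf : Continuous f) :
    ∫ x, f x ∂stdComplexGaussian =
      ∫ p : ℝ × ℝ, f ⟨p.1, p.2⟩ ∂((gaussianReal 0 (1 / 2)).prod (gaussianReal 0 (1 / 2))) := by
  rw [stdComplexGaussian, integral_map continuous_complex_mk.aemeasurable hf.aestronglyMeasurable]

theorem integral_id_stdComplexGaussian : ∫ x, x ∂stdComplexGaussian = 0 := by
  have hi : Integrable (fun p : ℝ × ℝ => p)
    ((gaussianReal 0 (1 / 2)).prod (gaussianReal 0 (1 / 2))) := IsGaussian.integrable_id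
  rw [integral_stdComplexGaussian (f := fun x => x) continuous_id]
  have h1 : ∀ p : ℝ × ℝ, (⟨p.1, p.2⟩ : ℂ) = (p.1 : ℂ) + (p.2 : ℂ) * Complex.I := fun p => by
    apply Complex.ext <;> simp
  simp only [h1]
  rw [integral_add (hi.fst.ofReal) (hi.snd.ofReal.mul_const _), integral_mul_const]
  rw [integral_fun_fst (f := fun x : ℝ => (x : ℂ)), integral_fun_snd (f := fun x : ℝ => (x : ℂ)),
    integral_complex_ofReal]
  simp [integral_id_gaussianReal]

theorem integral_sq_gaussianReal_half : ∫ x, x ^ 2 ∂(gaussianReal 0 (1 / 2)) = 1 / 2 := by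
  have h := variance_id_gaussianReal (μ := 0) (v := 1 / 2)
  rw [variance_of_integral_eq_zero aemeasurable_id (by simp [integral_id_gaussianReal])] at h
  simpa using h

theorem integral_sq_and_norm_sq_stdComplexGaussian :
    ∫ x, x * x ∂stdComplexGaussian = 0 ∧ ∫ x, x * star x ∂stdComplexGaussian = 1 := by
  have hsq : Integrable (fun x : ℝ => ((x ^ 2 : ℝ) : ℂ)) (gaussianReal 0 (1 / 2)) :=
    (memLp_id_gaussianReal 2).integrable_sq.ofReal
  have hid : Integrable (fun x : ℝ => ((x : ℝ) : ℂ)) (gaussianReal 0 (1 / 2)) :=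
    ((memLp_id_gaussianReal 1).integrable le_rfl).ofReal
  have h1 : Integrable (fun p : ℝ × ℝ => ((p.1 ^ 2 : ℝ) : ℂ))
      ((gaussianReal 0 (1 / 2)).prod (gaussianReal 0 (1 / 2))) := hsq.comp_fst _
  have h2 : Integrable (fun p : ℝ × ℝ => ((p.2 ^ 2 : ℝ) : ℂ))
      ((gaussianReal 0 (1 / 2)).prod (gaussianReal 0 (1 / 2))) := hsq.comp_snd _
  have h3 : Integrable (fun p : ℝ × ℝ => (p.1 : ℂ) * (p.2 : ℂ))
      ((gaussianReal 0 (1 / 2)).prod (gaussianReal 0 (1 / 2))) := hid.mul_prod hid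
  have i1 : ∫ p : ℝ × ℝ, ((p.1 ^ 2 : ℝ) : ℂ)
      ∂((gaussianReal 0 (1 / 2)).prod (gaussianReal 0 (1 / 2))) = 1 / 2 := by
    rw [integral_fun_fst (f := fun x : ℝ => ((x ^ 2 : ℝ) : ℂ)), integral_complex_ofReal,
      integral_sq_gaussianReal_half]
    simp
  have i2 : ∫ p : ℝ × ℝ, ((p.2 ^ 2 : ℝ) : ℂ)
      ∂((gaussianReal 0 (1 / 2)).prod (gaussianReal 0 (1 / 2))) = 1 / 2 := by
    rw [integral_fun_snd (f := fun x : ℝ => ((x ^ 2 : ℝ) : ℂ)), integral_complex_ofReal,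
      integral_sq_gaussianReal_half]
    simp
  have i3 : ∫ p : ℝ × ℝ, (p.1 : ℂ) * (p.2 : ℂ)
      ∂((gaussianReal 0 (1 / 2)).prod (gaussianReal 0 (1 / 2))) = 0 := by
    rw [integral_prod_mul (fun x : ℝ => (x : ℂ)) (fun x : ℝ => (x : ℂ)), integral_complex_ofReal]
    simp [integral_id_gaussianReal]
  constructor
  · rw [integral_stdComplexGaussian (f := fun x => x * x) (by fun_prop)]
    have h : ∀ p : ℝ × ℝ, (⟨p.1, p.2⟩ : ℂ) * ⟨p.1, p.2⟩ =
        ((p.1 ^ 2 : ℝ) : ℂ) - ((p.2 ^ 2 : ℝ) : ℂ) + 2 * Complex.I * ((p.1 : ℂ) * (p.2 : ℂ)) :=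
      fun p => by
        apply Complex.ext
        · simp [pow_two]
        · simp [pow_two]; ring
    simp only [h]
    have h12 : Integrable (fun p : ℝ × ℝ => ((p.1 ^ 2 : ℝ) : ℂ) - ((p.2 ^ 2 : ℝ) : ℂ))
      ((gaussianReal 0 (1 / 2)).prod (gaussianReal 0 (1 / 2))) := h1.sub h2
    rw [integral_add h12 (h3.const_mul _), integral_sub h1 h2, integral_const_mul, i1, i2,
      i3]
    simp
  · rw [integral_stdComplexGaussian (f := fun x => x * star x) (by fun_prop)]
    have h : ∀ p : ℝ × ℝ, (⟨p.1, p.2⟩ : ℂ) * star ⟨p.1, p.2⟩ =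
        ((p.1 ^ 2 : ℝ) : ℂ) + ((p.2 ^ 2 : ℝ) : ℂ) :=
      fun p => by
        apply Complex.ext
        · simp [pow_two]
        · simp [pow_two]; ring
    simp only [h]
    rw [integral_add h1 h2, i1, i2]
    norm_num

end StdComplex

/-! ### Circularity and covariance of the Gaussian columns. -/

section Columns

open scoped Matrix

variable {ι κ m : Type*} [Fintype ι] [Fintype κ] [Fintype m] [DecidableEq ι] [DecidableEq m]

/-- `γ` is a centered Gaussian law on families of columns, circular, with independent columns of
covariances `Ω_i`. -/
structure IsCircularLaw (γ : Measure (ι → κ → ℂ)) (Ω : ι → Matrix κ κ ℂ) : Prop where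
  gaussian : IsGaussian γ
  centered : γ[id] = 0
  pseudoCov : ∀ k l a b, ∫ y, y k a * y l b ∂γ = 0
  cov : ∀ k l a b, ∫ y, y k a * star (y l b) ∂γ = if k = l then Ω k a b else 0

theorem continuous_coord (k : ι) (a : κ) : Continuous fun x : ι → κ → ℂ => x k a :=
  (continuous_apply a).comp (continuous_apply k)

theorem polyBdd_eval (p : m) : PolyBdd fun x : m → ℂ => x p :=
  ⟨continuous_apply p, 1, 1, fun x => by
    have := norm_le_pi_norm x p
    linarith⟩

theorem polyBdd_coord (k : ι) (a : κ) : PolyBdd fun x : ι → κ → ℂ => x k a :=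
  ⟨continuous_coord k a, 1, 1, fun x => by
    have h1 := norm_le_pi_norm x k
    have h2 := norm_le_pi_norm (x k) a
    linarith⟩

/-- The complex Gaussian law with covariance `A Aᴴ`, over arbitrary index types. -/
def gaussianLaw (A : Matrix κ m ℂ) : Measure (κ → ℂ) :=
  (Measure.pi (fun _ : m => stdComplexGaussian)).map (fun x => A *ᵥ x)

theorem isGaussian_gaussianLaw (A : Matrix κ m ℂ) : IsGaussian (gaussianLaw A) := by
  have := isGaussian_pi fun _ : m => stdComplexGaussian
  have h : gaussianLaw A = (Measure.pi (fun _ : m => stdComplexGaussian)).map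
      (LinearMap.toContinuousLinearMap ((Matrix.mulVecLin A).restrictScalars ℝ)) := rfl
  rw [h]
  infer_instance

theorem continuous_mulVec_right (A : Matrix κ m ℂ) : Continuous fun x : m → ℂ => A *ᵥ x :=
  Continuous.matrix_mulVec continuous_const continuous_id

theorem integral_gaussianLaw (A : Matrix κ m ℂ) {G : Type*} [NormedAddCommGroup G]
    [NormedSpace ℝ G] [SecondCountableTopology G] {f : (κ → ℂ) → G} (hf : Continuous f) :
    ∫ y, f y ∂(gaussianLaw A) = ∫ x, f (A *ᵥ x) ∂(Measure.pi fun _ : m => stdComplexGaussian) := by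
  borelize G
  rw [gaussianLaw, integral_map (continuous_mulVec_right A).aemeasurable hf.aestronglyMeasurable]

theorem integral_id_gaussianLaw (A : Matrix κ m ℂ) : ∫ y, y ∂(gaussianLaw A) = 0 := by
  have := isGaussian_pi fun _ : m => stdComplexGaussian
  have h0 := integral_id_pi (fun _ : m => stdComplexGaussian)
    fun _ => integral_id_stdComplexGaussian
  rw [integral_gaussianLaw A (f := fun y => y) continuous_id]
  have h := (LinearMap.toContinuousLinearMap
    ((Matrix.mulVecLin A).restrictScalars ℝ)).integral_comp_comm
    (IsGaussian.integrable_id (μ := Measure.pi fun _ : m => stdComplexGaussian))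
  rw [h0, map_zero] at h
  exact h

theorem integral_mul_std (p q : m) :
    ∫ x, x p * x q ∂(Measure.pi fun _ : m => stdComplexGaussian) = 0 := by
  by_cases h : p = q
  · subst h
    rw [integral_comp_eval (μ := fun _ : m => stdComplexGaussian) (f := fun x => x * x)
      (by fun_prop)]
    exact integral_sq_and_norm_sq_stdComplexGaussian.1
  · rw [integral_mul_pi_of_ne _ h (f := fun x => x) (g := fun x => x) continuous_id continuous_id,
      integral_id_stdComplexGaussian, mul_zero]

theorem integral_mul_star_std (p q : m) :
    ∫ x, x p * star (x q) ∂(Measure.pi fun _ : m => stdComplexGaussian) =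
      if p = q then 1 else 0 := by
  split_ifs with h
  · subst h
    rw [integral_comp_eval (μ := fun _ : m => stdComplexGaussian) (f := fun x => x * star x)
      (by fun_prop)]
    exact integral_sq_and_norm_sq_stdComplexGaussian.2
  · rw [integral_mul_pi_of_ne _ h (f := fun x => x) (g := fun x => star x) continuous_id
      continuous_star, integral_id_stdComplexGaussian, zero_mul]

theorem integral_mul_gaussianLaw (A : Matrix κ m ℂ) (a b : κ) :
    ∫ y, y a * y b ∂(gaussianLaw A) = 0 := by
  have := isGaussian_pi fun _ : m => stdComplexGaussian
  rw [integral_gaussianLaw A (f := fun y => y a * y b) (by fun_prop)]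
  simp only [Matrix.mulVec, dotProduct, Finset.sum_mul_sum]
  have h : ∀ p q, PolyBdd fun x : m → ℂ => A a p * x p * (A b q * x q) := fun p q =>
    ((PolyBdd.const _).mul (polyBdd_eval p)).mul ((PolyBdd.const _).mul (polyBdd_eval q))
  rw [integral_finsetSum _ fun p _ => (PolyBdd.sum _ fun q _ => h p q).integrable _]
  refine Finset.sum_eq_zero fun p _ => ?_
  rw [integral_finsetSum _ fun q _ => (h p q).integrable _]
  refine Finset.sum_eq_zero fun q _ => ?_
  simp only [mul_mul_mul_comm]
  rw [integral_const_mul, integral_mul_std, mul_zero]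

theorem integral_mul_star_gaussianLaw (A : Matrix κ m ℂ) (a b : κ) :
    ∫ y, y a * star (y b) ∂(gaussianLaw A) = (A * Aᴴ) a b := by
  have := isGaussian_pi fun _ : m => stdComplexGaussian
  rw [integral_gaussianLaw A (f := fun y => y a * star (y b)) (by fun_prop)]
  simp only [Matrix.mulVec, dotProduct, star_sum, star_mul', Finset.sum_mul_sum]
  have h : ∀ p q, PolyBdd fun x : m → ℂ => A a p * x p * (star (A b q) * star (x q)) := fun p q =>
    ((PolyBdd.const _).mul (polyBdd_eval p)).mul ((PolyBdd.const _).mul (polyBdd_eval q).star)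
  rw [integral_finsetSum _ fun p _ => (PolyBdd.sum _ fun q _ => h p q).integrable _,
    Matrix.mul_apply]
  refine Finset.sum_congr rfl fun p _ => ?_
  rw [integral_finsetSum _ fun q _ => (h p q).integrable _]
  have h1 : ∀ q, ∫ x, A a p * x p * (star (A b q) * star (x q))
      ∂(Measure.pi fun _ : m => stdComplexGaussian) =
      A a p * star (A b q) * if p = q then 1 else 0 := fun q => by
    rw [← integral_mul_star_std, ← integral_const_mul]
    exact integral_congr_ae (ae_of_all _ fun x => by ring)
  rw [Finset.sum_congr rfl fun q _ => h1 q]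
  simp

theorem isCircularLaw_pi (Θ : ι → Matrix κ m ℂ) :
    IsCircularLaw (Measure.pi fun i => gaussianLaw (Θ i)) (fun i => Θ i * (Θ i)ᴴ) := by
  have hg : ∀ i, IsGaussian (gaussianLaw (Θ i)) := fun i => isGaussian_gaussianLaw _
  have hpi := isGaussian_pi fun i => gaussianLaw (Θ i)
  have h0 : ∀ i a, ∫ y, y a ∂(gaussianLaw (Θ i)) = 0 := fun i a => by
    have h := (ContinuousLinearMap.proj (R := ℝ) (φ := fun _ : κ => ℂ) a).integral_comp_comm
      (IsGaussian.integrable_id (μ := gaussianLaw (Θ i)))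
    have h1 := integral_id_gaussianLaw (Θ i)
    exact h.trans ((congrArg _ h1).trans (map_zero _))
  refine ⟨hpi, integral_id_pi _ fun i => integral_id_gaussianLaw (Θ i), fun k l a b => ?_,
    fun k l a b => ?_⟩
  · by_cases hkl : k = l
    · subst hkl
      rw [integral_comp_eval (μ := fun i => gaussianLaw (Θ i)) (f := fun y => y a * y b)
        (Continuous.aestronglyMeasurable (by fun_prop)), integral_mul_gaussianLaw]
    · rw [integral_mul_pi_of_ne (fun i => gaussianLaw (Θ i)) hkl (f := fun y => y a)
        (g := fun y => y b) (by fun_prop) (by fun_prop), h0, zero_mul]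
  · split_ifs with hkl
    · subst hkl
      rw [integral_comp_eval (μ := fun i => gaussianLaw (Θ i)) (f := fun y => y a * star (y b))
        (Continuous.aestronglyMeasurable (by fun_prop)), integral_mul_star_gaussianLaw]
    · rw [integral_mul_pi_of_ne (fun i => gaussianLaw (Θ i)) hkl (f := fun y => y a)
        (g := fun y => star (y b)) (by fun_prop) (by fun_prop), h0, zero_mul]

end Columns

end CorrelatedGaussian

namespace CorrelatedGaussian

open scoped Matrix

/-! ### Entrywise differentiation and growth of matrix-valued functions. -/

section MatrixCalculus

variable {l m κ : Type*} [Fintype l] [Fintype m] [Fintype κ] [DecidableEq κ]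

/-- Entrywise derivative of a path of matrices. -/
def HasMatrixDerivAt (F : ℝ → Matrix l m ℂ) (F' : Matrix l m ℂ) (t : ℝ) : Prop :=
  ∀ a b, HasDerivAt (fun s => F s a b) (F' a b) t

namespace HasMatrixDerivAt

variable {F : ℝ → Matrix l m ℂ} {F' : Matrix l m ℂ} {t : ℝ}

theorem const (A : Matrix l m ℂ) (t : ℝ) : HasMatrixDerivAt (fun _ => A) 0 t :=
  fun a b => hasDerivAt_const t (A a b)

theorem sub_const (h : HasMatrixDerivAt F F' t) (A : Matrix l m ℂ) :
    HasMatrixDerivAt (fun s => F s - A) F' t := fun a b => (h a b).sub_const (A a b)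

theorem const_smul (h : HasMatrixDerivAt F F' t) (c : ℂ) :
    HasMatrixDerivAt (fun s => c • F s) (c • F') t := fun a b => (h a b).const_mul c

theorem conjTranspose (h : HasMatrixDerivAt F F' t) :
    HasMatrixDerivAt (fun s => (F s)ᴴ) F'ᴴ t := fun a b => (h b a).star

theorem mul {G : ℝ → Matrix m κ ℂ} {G' : Matrix m κ ℂ} (hF : HasMatrixDerivAt F F' t)
    (hG : HasMatrixDerivAt G G' t) :
    HasMatrixDerivAt (fun s => F s * G s) (F' * G t + F t * G') t := by
  intro a b
  simp only [Matrix.mul_apply, Matrix.add_apply, ← Finset.sum_add_distrib]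
  exact HasDerivAt.fun_sum fun c _ => (hF a c).mul (hG c b)

theorem const_mul {G : ℝ → Matrix m κ ℂ} {G' : Matrix m κ ℂ} (A : Matrix l m ℂ)
    (hG : HasMatrixDerivAt G G' t) : HasMatrixDerivAt (fun s => A * G s) (A * G') t := by
  simpa using (const A t).mul hG

theorem trace {F : ℝ → Matrix κ κ ℂ} {F' : Matrix κ κ ℂ} (hF : HasMatrixDerivAt F F' t) :
    HasDerivAt (fun s => (F s).trace) F'.trace t := HasDerivAt.fun_sum fun a _ => hF a a

theorem hasDerivAt {F : ℝ → Matrix κ κ ℂ} {F' : Matrix κ κ ℂ} (h : HasMatrixDerivAt F F' t) :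
    HasDerivAt F F' t := by
  refine hasDerivAt_pi.2 fun a => hasDerivAt_pi.2 fun b => h a b

theorem of_hasDerivAt {F : ℝ → Matrix κ κ ℂ} {F' : Matrix κ κ ℂ} (h : HasDerivAt F F' t) :
    HasMatrixDerivAt F F' t := fun a b => (hasDerivAt_pi.1 (hasDerivAt_pi.1 h a)) b

open scoped Matrix.Norms.L2Operator in
theorem inv {F : ℝ → Matrix κ κ ℂ} {F' : Matrix κ κ ℂ} (h : HasMatrixDerivAt F F' t)
    (hu : IsUnit (F t)) :
    HasMatrixDerivAt (fun s => (F s)⁻¹) (-((F t)⁻¹ * F' * (F t)⁻¹)) t := by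
  refine of_hasDerivAt ?_
  obtain ⟨u, hu⟩ := hu
  have h1 := hasFDerivAt_ringInverse (𝕜 := ℝ) u
  rw [hu] at h1
  have h2 := h1.comp_hasDerivAt t h.hasDerivAt
  simp only [Function.comp_def, ← Matrix.nonsing_inv_eq_ringInverse] at h2
  refine HasDerivAt.congr_deriv h2 ?_
  rw [← hu, ← Matrix.coe_units_inv]
  simp

end HasMatrixDerivAt

variable {E : Type*} [NormedAddCommGroup E]

/-- Matrix-valued functions whose entries are continuous of at most polynomial growth. -/
def MatrixPolyBdd (F : E → Matrix l m ℂ) : Prop := ∀ a b, PolyBdd fun x => F x a b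

namespace MatrixPolyBdd

variable {F : E → Matrix l m ℂ}

theorem const (A : Matrix l m ℂ) : MatrixPolyBdd fun _ : E => A := fun a b => PolyBdd.const (A a b)

theorem add {G : E → Matrix l m ℂ} (hF : MatrixPolyBdd F) (hG : MatrixPolyBdd G) :
    MatrixPolyBdd fun x => F x + G x := fun a b => (hF a b).add (hG a b)

theorem const_smul (hF : MatrixPolyBdd F) (c : ℂ) : MatrixPolyBdd fun x => c • F x :=
  fun a b => (PolyBdd.const c).mul (hF a b)

theorem neg (hF : MatrixPolyBdd F) : MatrixPolyBdd fun x => -F x := fun a b => (hF a b).neg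

theorem conjTranspose (hF : MatrixPolyBdd F) : MatrixPolyBdd fun x => (F x)ᴴ :=
  fun a b => (hF b a).star

theorem mul {G : E → Matrix m κ ℂ} (hF : MatrixPolyBdd F) (hG : MatrixPolyBdd G) :
    MatrixPolyBdd fun x => F x * G x := fun a b => by
  simp only [Matrix.mul_apply]
  exact PolyBdd.sum _ fun c _ => (hF a c).mul (hG c b)

theorem trace {F : E → Matrix κ κ ℂ} (hF : MatrixPolyBdd F) : PolyBdd fun x => (F x).trace :=
  PolyBdd.sum _ fun a _ => hF a a

theorem fst {E' : Type*} [NormedAddCommGroup E'] (hF : MatrixPolyBdd F) :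
    MatrixPolyBdd fun p : E × E' => F p.1 := fun a b => (hF a b).fst

theorem snd {E' : Type*} [NormedAddCommGroup E'] (hF : MatrixPolyBdd F) :
    MatrixPolyBdd fun p : E' × E => F p.2 := fun a b => (hF a b).snd

end MatrixPolyBdd

end MatrixCalculus

/-! ### The resolvent of the normalized Gram matrix and its rotational derivative. -/

section Resolvent

open scoped ComplexOrder Matrix.Norms.L2Operator

variable {ι κ : Type*} [Fintype ι] [Fintype κ] [DecidableEq ι] [DecidableEq κ]

/-- The matrix with the given columns. -/
def colMat (x : ι → κ → ℂ) : Matrix κ ι ℂ := Matrix.of fun a i => x i a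

/-- The normalized Gram matrix `(1/n) Σ Σᴴ`. -/
def gram (x : ι → κ → ℂ) : Matrix κ κ ℂ :=
  (1 / (Fintype.card ι : ℂ)) • (colMat x * (colMat x)ᴴ)

/-- The resolvent of the normalized Gram matrix, over arbitrary index types. -/
def res (z : ℂ) (x : ι → κ → ℂ) : Matrix κ κ ℂ := (gram x - z • (1 : Matrix κ κ ℂ))⁻¹

theorem resolventQ_eq_res {n N : ℕ} (x : Fin n → Fin N → ℂ) (z : ℂ) :
    resolventQ x z = res z x := by
  simp [resolventQ, res, gram, colMat]

theorem gram_posSemidef (x : ι → κ → ℂ) : (gram x).PosSemidef := by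
  refine (Matrix.posSemidef_self_mul_conjTranspose _).smul ?_
  have : (1 / (Fintype.card ι : ℂ)) = ((1 / (Fintype.card ι : ℝ) : ℝ) : ℂ) := by push_cast; rfl
  rw [this]
  exact_mod_cast (by positivity : (0 : ℝ) ≤ 1 / (Fintype.card ι : ℝ))

variable {z : ℂ} (x : ι → κ → ℂ)

theorem isUnit_gram_sub (hz : 0 < z.im) :
    IsUnit (gram x - z • (1 : Matrix κ κ ℂ)) ∧ ‖res z x‖ ≤ 1 / z.im := by
  refine isUnit_of_im_le hz fun v => ?_
  have h := (gram_posSemidef x).dotProduct_mulVec_nonneg v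
  have h1 := (Complex.le_def.1 h).2
  rw [Matrix.sub_mulVec, dotProduct_sub, Complex.sub_im, ← h1, Matrix.smul_mulVec,
    Matrix.one_mulVec, dotProduct_smul, star_dotProduct_self, smul_eq_mul, Complex.im_mul_ofReal]
  simp

theorem res_mul_gram (hz : 0 < z.im) : res z x * gram x = 1 + z • res z x := by
  have h := Matrix.nonsing_inv_mul _ ((Matrix.isUnit_iff_isUnit_det _).1 (isUnit_gram_sub x hz).1)
  rw [Matrix.mul_sub, Matrix.mul_smul, Matrix.mul_one, sub_eq_iff_eq_add] at h
  exact h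

theorem gram_mul_res (hz : 0 < z.im) : gram x * res z x = 1 + z • res z x := by
  have h := Matrix.mul_nonsing_inv _ ((Matrix.isUnit_iff_isUnit_det _).1 (isUnit_gram_sub x hz).1)
  rw [Matrix.sub_mul, Matrix.smul_mul, Matrix.one_mul, sub_eq_iff_eq_add] at h
  exact h

theorem colMat_mul_conjTranspose [Nonempty ι] :
    colMat x * (colMat x)ᴴ = (Fintype.card ι : ℂ) • gram x := by
  rw [gram, smul_smul, mul_one_div_cancel (by simp), one_smul]

theorem norm_one_add_smul_res_le (hz : 0 < z.im) : ‖1 + z • res z x‖ ≤ 1 + ‖z‖ / z.im := by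
  refine (norm_add_le _ _).trans (add_le_add opNorm_one_le ?_)
  rw [norm_smul, div_eq_mul_one_div]
  exact mul_le_mul_of_nonneg_left (isUnit_gram_sub x hz).2 (norm_nonneg _)

/-- `Q Σ` has norm of order `√n`. -/
theorem norm_res_mul_colMat_sq_le [Nonempty ι] (hz : 0 < z.im) :
    ‖res z x * colMat x‖ ^ 2 ≤ Fintype.card ι * ((1 + ‖z‖ / z.im) / z.im) := by
  rw [sq, ← Matrix.l2_opNorm_conjTranspose (res z x * colMat x),
    ← Matrix.l2_opNorm_conjTranspose_mul_self, Matrix.conjTranspose_conjTranspose,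
    Matrix.conjTranspose_mul]
  -- QΣΣᴴQᴴ = n Q·gram·Qᴴ = n(1 + zQ)Qᴴ, so no bound on Σ itself is needed.
  have h : res z x * colMat x * ((colMat x)ᴴ * (res z x)ᴴ) =
      (Fintype.card ι : ℂ) • ((1 + z • res z x) * (res z x)ᴴ) := by
    rw [← res_mul_gram x hz, ← Matrix.mul_assoc, Matrix.mul_assoc (res z x),
      colMat_mul_conjTranspose, Matrix.mul_smul, Matrix.smul_mul]
  rw [h, norm_smul, Complex.norm_natCast]
  refine mul_le_mul_of_nonneg_left ?_ (Nat.cast_nonneg _)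
  refine (Matrix.l2_opNorm_mul _ _).trans ?_
  rw [Matrix.l2_opNorm_conjTranspose, div_eq_mul_one_div]
  exact mul_le_mul (norm_one_add_smul_res_le x hz) (isUnit_gram_sub x hz).2 (norm_nonneg _)
    (by positivity)

theorem norm_conjTranspose_colMat_mul_res_sq_le [Nonempty ι] (hz : 0 < z.im) :
    ‖(colMat x)ᴴ * res z x‖ ^ 2 ≤ Fintype.card ι * ((1 + ‖z‖ / z.im) / z.im) := by
  rw [sq, ← Matrix.l2_opNorm_conjTranspose_mul_self, Matrix.conjTranspose_mul,
    Matrix.conjTranspose_conjTranspose]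
  have h : (res z x)ᴴ * colMat x * ((colMat x)ᴴ * res z x) =
      (Fintype.card ι : ℂ) • ((res z x)ᴴ * (1 + z • res z x)) := by
    rw [← gram_mul_res x hz, ← Matrix.mul_assoc, Matrix.mul_assoc (res z x)ᴴ,
      colMat_mul_conjTranspose, Matrix.mul_smul, Matrix.smul_mul, Matrix.mul_assoc]
  rw [h, norm_smul, Complex.norm_natCast]
  refine mul_le_mul_of_nonneg_left ?_ (Nat.cast_nonneg _)
  refine (Matrix.l2_opNorm_mul _ _).trans ?_
  rw [Matrix.l2_opNorm_conjTranspose, div_eq_mul_one_div, mul_comm]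
  exact mul_le_mul (norm_one_add_smul_res_le x hz) (isUnit_gram_sub x hz).2 (norm_nonneg _)
    (by positivity)

theorem matrixPolyBdd_colMat : MatrixPolyBdd fun x : ι → κ → ℂ => colMat x :=
  fun a i => polyBdd_coord i a

theorem continuous_colMat : Continuous fun x : ι → κ → ℂ => colMat x :=
  continuous_matrix fun a i => continuous_coord i a

theorem continuous_gram : Continuous fun x : ι → κ → ℂ => gram x :=
  (continuous_colMat.matrix_mul continuous_colMat.matrix_conjTranspose).fun_const_smul _

/-- The inverse is the adjugate divided by a determinant that never vanishes when Im z > 0. -/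
theorem continuous_res (hz : 0 < z.im) : Continuous fun x : ι → κ → ℂ => res z x := by
  have hc : Continuous fun x : ι → κ → ℂ => gram x - z • (1 : Matrix κ κ ℂ) :=
    continuous_gram.sub continuous_const
  have : (fun x : ι → κ → ℂ => res z x) = fun x => (gram x - z • (1 : Matrix κ κ ℂ)).det⁻¹ •
      (gram x - z • (1 : Matrix κ κ ℂ)).adjugate := by
    funext x
    rw [res, Matrix.inv_def, Ring.inverse_eq_inv']
  rw [this]
  refine (hc.matrix_det.inv₀ fun x => ?_).smul hc.matrix_adjugate
  exact ((Matrix.isUnit_iff_isUnit_det _).1 (isUnit_gram_sub x hz).1).ne_zero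

theorem matrixPolyBdd_res (hz : 0 < z.im) : MatrixPolyBdd fun x : ι → κ → ℂ => res z x :=
  fun a b => PolyBdd.of_bounded
    (((continuous_apply b).comp (continuous_apply a)).comp (continuous_res hz)) (1 / z.im)
    fun x => (norm_entry_le _ a b).trans (isUnit_gram_sub x hz).2

local notation "rot" => ContinuousLinearMap.rotation

variable (p : (ι → κ → ℂ) × (ι → κ → ℂ))

theorem hasMatrixDerivAt_colMat_fst :
    HasMatrixDerivAt (fun t : ℝ => colMat (rot t p).1) (colMat p.2) 0 := by
  intro a i
  have h1 := ((Real.hasDerivAt_cos 0).smul_const (p.1 i a)).fun_add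
    ((Real.hasDerivAt_sin 0).smul_const (p.2 i a))
  simpa [colMat, ContinuousLinearMap.rotation_apply] using h1

theorem hasMatrixDerivAt_colMat_snd :
    HasMatrixDerivAt (fun t : ℝ => colMat (rot t p).2) (-colMat p.1) 0 := by
  intro a i
  have h1 := ((Real.hasDerivAt_sin 0).neg.smul_const (p.1 i a)).fun_add
    ((Real.hasDerivAt_cos 0).smul_const (p.2 i a))
  simpa [colMat, ContinuousLinearMap.rotation_apply] using h1

theorem rotation_zero_apply : rot 0 p = p := by simp [ContinuousLinearMap.rotation_apply]

/-- The derivative of the resolvent at `p.1` in the direction `p.2`. -/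
def resDeriv (z : ℂ) (p : (ι → κ → ℂ) × (ι → κ → ℂ)) : Matrix κ κ ℂ :=
  -(res z p.1 * ((1 / (Fintype.card ι : ℂ)) •
    (colMat p.2 * (colMat p.1)ᴴ + colMat p.1 * (colMat p.2)ᴴ)) * res z p.1)

theorem hasMatrixDerivAt_res (hz : 0 < z.im) :
    HasMatrixDerivAt (fun t : ℝ => res z (rot t p).1) (resDeriv z p) 0 := by
  have h1 := hasMatrixDerivAt_colMat_fst p
  have h2 := ((h1.mul h1.conjTranspose).const_smul (1 / (Fintype.card ι : ℂ))).sub_const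
    (z • (1 : Matrix κ κ ℂ))
  have h3 := h2.inv (isUnit_gram_sub (rot 0 p).1 hz).1
  simp only [rotation_zero_apply] at h3
  exact h3

theorem matrixPolyBdd_resDeriv (hz : 0 < z.im) :
    MatrixPolyBdd fun p : (ι → κ → ℂ) × (ι → κ → ℂ) => resDeriv z p := by
  have hx : MatrixPolyBdd fun p : (ι → κ → ℂ) × (ι → κ → ℂ) => colMat p.1 :=
    matrixPolyBdd_colMat.fst
  have hy : MatrixPolyBdd fun p : (ι → κ → ℂ) × (ι → κ → ℂ) => colMat p.2 :=
    matrixPolyBdd_colMat.snd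
  have hQ : MatrixPolyBdd fun p : (ι → κ → ℂ) × (ι → κ → ℂ) => res z p.1 :=
    (matrixPolyBdd_res hz).fst
  exact ((hQ.mul (((hy.mul hx.conjTranspose).add (hx.mul hy.conjTranspose)).const_smul _)).mul
    hQ).neg

end Resolvent

end CorrelatedGaussian

namespace CorrelatedGaussian

open scoped Matrix Matrix.Norms.L2Operator

/-! ### Second moments of linear and quadratic expressions in the columns. -/

section SecondMoments

variable {ι κ m m' : Type*} [Fintype ι] [Fintype κ] [Fintype m] [Fintype m'] [DecidableEq ι]
  [DecidableEq κ] {γ : Measure (ι → κ → ℂ)} {Ω : ι → Matrix κ κ ℂ}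

theorem IsCircularLaw.integral_mul_mul (hγ : IsCircularLaw γ Ω) (D : Matrix m κ ℂ)
    (D' : Matrix m' κ ℂ) (p : m) (p' : m') (k l : ι) :
    ∫ y, (D * colMat y) p k * (D' * colMat y) p' l ∂γ = 0 := by
  have := hγ.gaussian
  simp only [Matrix.mul_apply, Finset.sum_mul_sum]
  have h : ∀ a b, PolyBdd fun y : ι → κ → ℂ => D p a * colMat y a k * (D' p' b * colMat y b l) :=
    fun a b => ((PolyBdd.const _).mul (polyBdd_coord k a)).mul
      ((PolyBdd.const _).mul (polyBdd_coord l b))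
  rw [integral_finsetSum _ fun a _ => (PolyBdd.sum _ fun b _ => h a b).integrable _]
  refine Finset.sum_eq_zero fun a _ => ?_
  rw [integral_finsetSum _ fun b _ => (h a b).integrable _]
  refine Finset.sum_eq_zero fun b _ => ?_
  have h1 := hγ.pseudoCov k l a b
  calc ∫ y, D p a * colMat y a k * (D' p' b * colMat y b l) ∂γ
      = ∫ y, D p a * D' p' b * (y k a * y l b) ∂γ :=
        integral_congr_ae (ae_of_all _ fun y => by simp only [colMat, Matrix.of_apply]; ring)
    _ = 0 := by rw [integral_const_mul, h1, mul_zero]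

theorem IsCircularLaw.integral_mul_conj_mul (hγ : IsCircularLaw γ Ω) (D : Matrix m κ ℂ)
    (D' : Matrix κ m' ℂ) (p : m) (p' : m') (k l : ι) :
    ∫ y, (D * colMat y) p k * ((colMat y)ᴴ * D') l p' ∂γ =
      if k = l then (D * Ω k * D') p p' else 0 := by
  have := hγ.gaussian
  have e : ∀ y : ι → κ → ℂ, (D * colMat y) p k * ((colMat y)ᴴ * D') l p' =
      ∑ a, ∑ b, D p a * D' b p' * (y k a * star (y l b)) := fun y => by
    simp only [Matrix.mul_apply, Finset.sum_mul_sum, Matrix.conjTranspose_apply, colMat,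
      Matrix.of_apply]
    exact Finset.sum_congr rfl fun a _ => Finset.sum_congr rfl fun b _ => by ring
  simp only [e]
  have h : ∀ a b, PolyBdd fun y : ι → κ → ℂ => D p a * D' b p' * (y k a * star (y l b)) :=
    fun a b => (PolyBdd.const _).mul ((polyBdd_coord k a).mul (polyBdd_coord l b).star)
  rw [integral_finsetSum _ fun a _ => (PolyBdd.sum _ fun b _ => h a b).integrable _]
  have h2 : ∀ a, ∫ y, ∑ b, D p a * D' b p' * (y k a * star (y l b)) ∂γ =
      ∑ b, D p a * D' b p' * if k = l then Ω k a b else 0 := fun a => by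
    rw [integral_finsetSum _ fun b _ => (h a b).integrable _]
    refine Finset.sum_congr rfl fun b _ => ?_
    rw [integral_const_mul, hγ.cov k l a b]
  rw [Finset.sum_congr rfl fun a _ => h2 a]
  split_ifs with hkl
  · simp only [Matrix.mul_apply, Finset.sum_mul]
    rw [Finset.sum_comm]
    exact Finset.sum_congr rfl fun b _ => Finset.sum_congr rfl fun a _ => by ring
  · simp

theorem IsCircularLaw.integral_conj_mul_mul (hγ : IsCircularLaw γ Ω) (C : Matrix κ κ ℂ)
    (k l : ι) : ∫ y, ((colMat y)ᴴ * C * colMat y) k l ∂γ =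
      if k = l then (C * Ω l).trace else 0 := by
  have := hγ.gaussian
  have e : ∀ y : ι → κ → ℂ, ((colMat y)ᴴ * C * colMat y) k l =
      ∑ b, ((1 : Matrix κ κ ℂ) * colMat y) b l * ((colMat y)ᴴ * C) k b := fun y => by
    rw [Matrix.mul_apply, Matrix.one_mul]
    exact Finset.sum_congr rfl fun b _ => mul_comm _ _
  simp only [e]
  have hX : MatrixPolyBdd fun y : ι → κ → ℂ => colMat y := matrixPolyBdd_colMat
  rw [integral_finsetSum _ fun b _ => ((((MatrixPolyBdd.const 1).mul hX) b l).mul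
    ((hX.conjTranspose.mul (MatrixPolyBdd.const C)) k b)).integrable _]
  simp only [hγ.integral_mul_conj_mul, eq_comm (a := l)]
  split_ifs with hkl
  · rw [Matrix.one_mul, Matrix.trace_mul_comm]; rfl
  · simp

theorem IsCircularLaw.integral_vnorm_sq (hγ : IsCircularLaw γ Ω) (j : ι) :
    ∫ y, vnorm (y j) ^ 2 ∂γ = (Ω j).trace.re := by
  have h := hγ.integral_conj_mul_mul 1 j j
  rw [if_pos rfl, Matrix.one_mul] at h
  rw [← h]
  have e : ∀ y : ι → κ → ℂ, ((colMat y)ᴴ * (1 : Matrix κ κ ℂ) * colMat y) j j =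
      ((vnorm (y j) ^ 2 : ℝ) : ℂ) :=
    fun y => by rw [Matrix.mul_one, ← star_dotProduct_self]; rfl
  simp only [e]
  rw [integral_complex_ofReal, Complex.ofReal_re]

theorem sum_vnorm_col_sq_le (M : Matrix m κ ℂ) [DecidableEq m] :
    ∑ a, vnorm (M.col a) ^ 2 ≤ Fintype.card κ * ‖M‖ ^ 2 := by
  refine (Finset.sum_le_sum (g := fun _ => ‖M‖ ^ 2) fun a _ =>
    pow_le_pow_left₀ (vnorm_nonneg _) (vnorm_col_le M a) 2).trans ?_
  simp

/-- By independence of the columns the left side is ∑_k (M Ω_k Mᴴ)_kk, at most w times the squared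
Frobenius norm of M, which has card κ columns of norm at most ‖M‖. -/
theorem IsCircularLaw.integral_norm_trace_mul_sq_le (hγ : IsCircularLaw γ Ω) {w : ℝ}
    (hw : ∀ i, ‖Ω i‖ ≤ w) (M : Matrix ι κ ℂ) :
    ∫ y, ‖(M * colMat y).trace‖ ^ 2 ∂γ ≤ w * (Fintype.card κ * ‖M‖ ^ 2) := by
  have := hγ.gaussian
  have hX : MatrixPolyBdd fun y : ι → κ → ℂ => colMat y := matrixPolyBdd_colMat
  have e : ∀ y : ι → κ → ℂ, ((‖(M * colMat y).trace‖ ^ 2 : ℝ) : ℂ) =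
      ∑ k, ∑ l, (M * colMat y) k k * ((colMat y)ᴴ * Mᴴ) l l := fun y => by
    rw [← Finset.sum_mul_sum, ← Complex.normSq_eq_norm_sq, ← Complex.mul_conj, starRingEnd_apply,
      ← Matrix.trace_conjTranspose, Matrix.conjTranspose_mul]
    rfl
  have hp : ∀ k l, PolyBdd fun y : ι → κ → ℂ => (M * colMat y) k k * ((colMat y)ᴴ * Mᴴ) l l :=
    fun k l => (((MatrixPolyBdd.const M).mul hX) k k).mul
      ((hX.conjTranspose.mul (MatrixPolyBdd.const Mᴴ)) l l)
  have h1 : ((∫ y, ‖(M * colMat y).trace‖ ^ 2 ∂γ : ℝ) : ℂ) = ∑ k, (M * Ω k * Mᴴ) k k := by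
    rw [← integral_complex_ofReal]
    simp only [e]
    rw [integral_finsetSum _ fun k _ => (PolyBdd.sum _ fun l _ => hp k l).integrable _]
    refine Finset.sum_congr rfl fun k _ => ?_
    rw [integral_finsetSum _ fun l _ => (hp k l).integrable _]
    simp only [hγ.integral_mul_conj_mul, Finset.sum_ite_eq, Finset.mem_univ, if_true]
  have h2 : ∀ k, ‖(M * Ω k * Mᴴ) k k‖ ≤ w * ∑ a, ‖M k a‖ ^ 2 := fun k => by
    have h3 : (M * Ω k * Mᴴ) k k = (M k) ⬝ᵥ (Ω k *ᵥ star (M k)) := by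
      rw [Matrix.mul_assoc, Matrix.mul_apply]
      rfl
    rw [h3, ← vnorm_sq]
    refine (norm_dotProduct_le _ _).trans ?_
    have h4 := (vnorm_mulVec_le (Ω k) (star (M k))).trans
      (mul_le_mul_of_nonneg_right (hw k) (vnorm_nonneg _))
    rw [vnorm_star] at h4
    calc vnorm (M k) * vnorm (Ω k *ᵥ star (M k)) ≤ vnorm (M k) * (w * vnorm (M k)) :=
          mul_le_mul_of_nonneg_left h4 (vnorm_nonneg _)
      _ = _ := by ring
  have h5 : ∑ k, ∑ a, ‖M k a‖ ^ 2 = ∑ a, vnorm (M.col a) ^ 2 := by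
    rw [Finset.sum_comm]
    exact Finset.sum_congr rfl fun a _ => by rw [vnorm_sq]; rfl
  calc ∫ y, ‖(M * colMat y).trace‖ ^ 2 ∂γ ≤ ‖((∫ y, ‖(M * colMat y).trace‖ ^ 2 ∂γ : ℝ) : ℂ)‖ := by
        rw [Complex.norm_real]; exact le_abs_self _
    _ ≤ ∑ k, w * ∑ a, ‖M k a‖ ^ 2 := by
        rw [h1]
        exact (norm_sum_le _ _).trans (Finset.sum_le_sum fun k _ => h2 k)
    _ = w * ∑ a, vnorm (M.col a) ^ 2 := by rw [← Finset.mul_sum, h5]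
    _ ≤ _ := by
        -- The sign of `w` follows from the bound on some Ω_i, which requires an index.
        rcases isEmpty_or_nonempty ι with hι | ⟨⟨i⟩⟩
        · have h6 : ∀ a, vnorm (M.col a) ^ 2 = 0 := fun a => by rw [vnorm_sq]; simp
          have h7 : M = 0 := by ext i; exact isEmptyElim i
          have h8 : ‖M‖ = 0 := by rw [h7]; exact norm_zero
          rw [Finset.sum_eq_zero fun a _ => h6 a, h8]; simp
        · exact mul_le_mul_of_nonneg_left (sum_vnorm_col_sq_le M) ((norm_nonneg _).trans (hw i))

end SecondMoments

/-! ### Variance and fourth moment of normalized traces of the resolvent. -/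

section Variance

variable {ι κ : Type*} [Fintype ι] [Fintype κ] [DecidableEq ι] [DecidableEq κ]

/-- The normalized trace `(1/n) tr (B Q(z))`. -/
def traceRes (B : Matrix κ κ ℂ) (z : ℂ) (x : ι → κ → ℂ) : ℂ :=
  (1 / (Fintype.card ι : ℂ)) * (B * res z x).trace

/-- The rotational derivative of `traceRes`. -/
def traceResDeriv (B : Matrix κ κ ℂ) (z : ℂ) (p : (ι → κ → ℂ) × (ι → κ → ℂ)) : ℂ :=
  (1 / (Fintype.card ι : ℂ)) * (B * resDeriv z p).trace

variable {γ : Measure (ι → κ → ℂ)} {Ω : ι → Matrix κ κ ℂ} {z : ℂ} (B : Matrix κ κ ℂ)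

theorem polyBdd_traceRes (hz : 0 < z.im) : PolyBdd fun x : ι → κ → ℂ => traceRes B z x :=
  (PolyBdd.const _).mul ((MatrixPolyBdd.const B).mul (matrixPolyBdd_res hz)).trace

theorem polyBdd_traceResDeriv (hz : 0 < z.im) :
    PolyBdd fun p : (ι → κ → ℂ) × (ι → κ → ℂ) => traceResDeriv B z p :=
  (PolyBdd.const _).mul ((MatrixPolyBdd.const B).mul (matrixPolyBdd_resDeriv hz)).trace

theorem hasRotDeriv_traceRes (hz : 0 < z.im) :
    HasRotDeriv (fun p : (ι → κ → ℂ) × (ι → κ → ℂ) => traceRes B z p.1) (traceResDeriv B z) :=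
  fun p => ((hasMatrixDerivAt_res p hz).const_mul B).trace.const_mul _

theorem traceResDeriv_eq (p : (ι → κ → ℂ) × (ι → κ → ℂ)) :
    traceResDeriv B z p = -(1 / (Fintype.card ι : ℂ) ^ 2) *
      (((colMat p.1)ᴴ * res z p.1 * B * res z p.1 * colMat p.2).trace +
        ((colMat p.2)ᴴ * (res z p.1 * B * res z p.1 * colMat p.1)).trace) := by
  have h1 : (B * (res z p.1 * (colMat p.2 * (colMat p.1)ᴴ) * res z p.1)).trace =
      ((colMat p.1)ᴴ * res z p.1 * B * res z p.1 * colMat p.2).trace := by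
    have e : B * (res z p.1 * (colMat p.2 * (colMat p.1)ᴴ) * res z p.1) =
        (B * res z p.1 * colMat p.2) * ((colMat p.1)ᴴ * res z p.1) := by
      simp only [Matrix.mul_assoc]
    rw [e, Matrix.trace_mul_comm]
    simp only [Matrix.mul_assoc]
  have h2 : (B * (res z p.1 * (colMat p.1 * (colMat p.2)ᴴ) * res z p.1)).trace =
      ((colMat p.2)ᴴ * (res z p.1 * B * res z p.1 * colMat p.1)).trace := by
    have e : B * (res z p.1 * (colMat p.1 * (colMat p.2)ᴴ) * res z p.1) =
        (B * res z p.1 * colMat p.1) * ((colMat p.2)ᴴ * res z p.1) := by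
      simp only [Matrix.mul_assoc]
    rw [e, Matrix.trace_mul_comm]
    simp only [Matrix.mul_assoc]
  rw [traceResDeriv, resDeriv, Matrix.mul_smul, Matrix.smul_mul, Matrix.mul_neg, Matrix.mul_smul,
    Matrix.trace_neg, Matrix.trace_smul, Matrix.mul_add, Matrix.add_mul, Matrix.mul_add,
    Matrix.trace_add, h1, h2, smul_eq_mul]
  ring

/-- The bound on the conditional second moment of the derivative of `traceRes B`. -/
def gradBound (w : ℝ) (z : ℂ) (n : ℕ) : ℝ :=
  4 * w * ((1 + ‖z‖ / z.im) / z.im) / (z.im ^ 2 * n ^ 2)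

/-- The derivative is −n⁻²(tr(M y) + tr(yᴴ M')) with M = xᴴQBQ and M' = QBQx. One factor Q is kept
next to x, so that ‖M‖² and ‖M'‖² are of order n. The second moment is then of order n⁻⁴ · n · n =
n⁻². -/
theorem IsCircularLaw.integral_norm_traceResDeriv_sq_le [Nonempty ι] (hγ : IsCircularLaw γ Ω)
    {w : ℝ} (hw : ∀ i, ‖Ω i‖ ≤ w) (hcard : Fintype.card κ ≤ Fintype.card ι) (hz : 0 < z.im)
    {b : ℝ} (hB : ‖B‖ ≤ b) (x : ι → κ → ℂ) :
    ∫ y, ‖traceResDeriv B z (x, y)‖ ^ 2 ∂γ ≤ b ^ 2 * gradBound w z (Fintype.card ι) := by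
  have := hγ.gaussian
  set n : ℝ := (Fintype.card ι : ℝ) with hn
  have hn0 : 0 < n := by rw [hn]; exact_mod_cast Fintype.card_pos
  have hw0 : 0 ≤ w := (norm_nonneg _).trans (hw (Classical.arbitrary ι))
  have hb0 : 0 ≤ b := (norm_nonneg _).trans hB
  have hcard' : (Fintype.card κ : ℝ) ≤ n := by rw [hn]; exact_mod_cast hcard
  set c := (1 + ‖z‖ / z.im) / z.im with hc
  have hc0 : 0 ≤ c := by positivity
  set M := (colMat x)ᴴ * res z x * B * res z x with hM
  set M' := res z x * B * res z x * colMat x with hM'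
  have hBQ : ‖B * res z x‖ ≤ b * (1 / z.im) := (Matrix.l2_opNorm_mul _ _).trans
    (mul_le_mul hB (isUnit_gram_sub x hz).2 (norm_nonneg _) hb0)
  have hQB : ‖res z x * B‖ ≤ b * (1 / z.im) := by
    rw [mul_comm b]
    exact (Matrix.l2_opNorm_mul _ _).trans
      (mul_le_mul (isUnit_gram_sub x hz).2 hB (norm_nonneg _) (by positivity))
  have hMn : ‖M‖ ^ 2 ≤ n * c * (b * (1 / z.im)) ^ 2 := by
    have h1 : ‖M‖ ≤ ‖(colMat x)ᴴ * res z x‖ * ‖B * res z x‖ := by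
      rw [hM, Matrix.mul_assoc _ B]; exact Matrix.l2_opNorm_mul _ _
    refine (pow_le_pow_left₀ (norm_nonneg _) h1 2).trans ?_
    rw [mul_pow]
    exact mul_le_mul (norm_conjTranspose_colMat_mul_res_sq_le x hz)
      (pow_le_pow_left₀ (norm_nonneg _) hBQ 2) (by positivity) (by positivity)
  have hMn' : ‖M'ᴴ‖ ^ 2 ≤ n * c * (b * (1 / z.im)) ^ 2 := by
    have h1 : ‖M'‖ ≤ ‖res z x * B‖ * ‖res z x * colMat x‖ := by
      rw [hM', Matrix.mul_assoc (res z x * B)]; exact Matrix.l2_opNorm_mul _ _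
    rw [Matrix.l2_opNorm_conjTranspose]
    refine (pow_le_pow_left₀ (norm_nonneg _) h1 2).trans ?_
    rw [mul_pow, mul_comm]
    exact mul_le_mul (norm_res_mul_colMat_sq_le x hz)
      (pow_le_pow_left₀ (norm_nonneg _) hQB 2) (by positivity) (by positivity)
  have hX : MatrixPolyBdd fun y : ι → κ → ℂ => colMat y := matrixPolyBdd_colMat
  have hi1 : Integrable (fun y : ι → κ → ℂ => ‖(M * colMat y).trace‖ ^ 2) γ :=
    (((MatrixPolyBdd.const M).mul hX).trace).integrable_norm_sq γ
  have hi2 : Integrable (fun y : ι → κ → ℂ => ‖(M'ᴴ * colMat y).trace‖ ^ 2) γ :=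
    (((MatrixPolyBdd.const M'ᴴ).mul hX).trace).integrable_norm_sq γ
  have hpt : ∀ y, ‖traceResDeriv B z (x, y)‖ ^ 2 ≤
      2 / n ^ 4 * (‖(M * colMat y).trace‖ ^ 2 + ‖(M'ᴴ * colMat y).trace‖ ^ 2) := fun y => by
    have h1 : ‖((colMat y)ᴴ * M').trace‖ = ‖(M'ᴴ * colMat y).trace‖ := by
      rw [← norm_star, ← Matrix.trace_conjTranspose, Matrix.conjTranspose_mul,
        Matrix.conjTranspose_conjTranspose]
    have h3 : ‖-(1 / (Fintype.card ι : ℂ) ^ 2)‖ = 1 / n ^ 2 := by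
      rw [norm_neg, norm_div, norm_one, norm_pow, Complex.norm_natCast]
    rw [traceResDeriv_eq, norm_mul, h3, ← hM, ← hM', mul_pow, ← h1]
    have h4 := norm_add_le (M * colMat y).trace ((colMat y)ᴴ * M').trace
    have h5 : ‖(M * colMat y).trace + ((colMat y)ᴴ * M').trace‖ ^ 2 ≤
        2 * (‖(M * colMat y).trace‖ ^ 2 + ‖((colMat y)ᴴ * M').trace‖ ^ 2) := by
      refine (pow_le_pow_left₀ (norm_nonneg _) h4 2).trans ?_
      nlinarith [sq_nonneg (‖(M * colMat y).trace‖ - ‖((colMat y)ᴴ * M').trace‖)]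
    calc (1 / n ^ 2) ^ 2 * ‖(M * colMat y).trace + ((colMat y)ᴴ * M').trace‖ ^ 2
        ≤ (1 / n ^ 2) ^ 2 * (2 * (‖(M * colMat y).trace‖ ^ 2 + ‖((colMat y)ᴴ * M').trace‖ ^ 2)) :=
          mul_le_mul_of_nonneg_left h5 (by positivity)
      _ = _ := by ring
  have hT := hγ.integral_norm_trace_mul_sq_le hw M
  have hT' := hγ.integral_norm_trace_mul_sq_le hw M'ᴴ
  have hfin : ∀ r, r ≤ n * c * (b * (1 / z.im)) ^ 2 →
      w * (Fintype.card κ * r) ≤ w * (n * (n * c * (b * (1 / z.im)) ^ 2)) := fun r hr =>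
    mul_le_mul_of_nonneg_left ((mul_le_mul_of_nonneg_left hr (Nat.cast_nonneg _)).trans
      (mul_le_mul_of_nonneg_right hcard' (by positivity))) hw0
  calc ∫ y, ‖traceResDeriv B z (x, y)‖ ^ 2 ∂γ
      ≤ ∫ y, 2 / n ^ 4 * (‖(M * colMat y).trace‖ ^ 2 + ‖(M'ᴴ * colMat y).trace‖ ^ 2) ∂γ := by
        refine integral_mono_of_nonneg (ae_of_all _ fun y => sq_nonneg _)
          ((hi1.add hi2).const_mul _) (ae_of_all _ hpt)
    _ = 2 / n ^ 4 * (∫ y, ‖(M * colMat y).trace‖ ^ 2 ∂γ +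
          ∫ y, ‖(M'ᴴ * colMat y).trace‖ ^ 2 ∂γ) := by
        rw [integral_const_mul, integral_add hi1 hi2]
    _ ≤ 2 / n ^ 4 * (w * (n * (n * c * (b * (1 / z.im)) ^ 2)) +
          w * (n * (n * c * (b * (1 / z.im)) ^ 2))) :=
        mul_le_mul_of_nonneg_left (add_le_add (hT.trans (hfin _ hMn)) (hT'.trans (hfin _ hMn')))
          (by positivity)
    _ = _ := by
        rw [gradBound, ← hn, ← hc]
        field_simp
        ring

theorem gradBound_nonneg {w : ℝ} (hw : 0 ≤ w) (hz : 0 < z.im) (n : ℕ) : 0 ≤ gradBound w z n := by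
  unfold gradBound; positivity

/-- The variance of `(1/n) tr (B Q)` is of order `1/n²`. -/
theorem IsCircularLaw.variance_traceRes_le [Nonempty ι] (hγ : IsCircularLaw γ Ω)
    {w : ℝ} (hw : ∀ i, ‖Ω i‖ ≤ w) (hcard : Fintype.card κ ≤ Fintype.card ι) (hz : 0 < z.im)
    {b : ℝ} (hB : ‖B‖ ≤ b) :
    ∫ x, ‖traceRes B z x - ∫ x', traceRes B z x' ∂γ‖ ^ 2 ∂γ ≤
      2 * (b ^ 2 * gradBound w z (Fintype.card ι)) := by
  have := hγ.gaussian
  refine (integral_norm_sub_mean_sq_le hγ.centered (hasRotDeriv_traceRes B hz)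
    (polyBdd_traceRes B hz) (polyBdd_traceResDeriv B hz)).trans ?_
  refine mul_le_mul_of_nonneg_left ?_ zero_le_two
  have hi := ((polyBdd_traceResDeriv B hz).integrable_norm_sq (γ.prod γ)).integral_prod_left
  refine (integral_mono hi (integrable_const _) fun x =>
    hγ.integral_norm_traceResDeriv_sq_le B hw hcard hz hB x).trans ?_
  simp

/-- The fourth centered moment of `(1/n) tr (B Q)` is of order `1/n⁴`. -/
theorem IsCircularLaw.fourthMoment_traceRes_le [Nonempty ι] (hγ : IsCircularLaw γ Ω)
    {w : ℝ} (hw : ∀ i, ‖Ω i‖ ≤ w) (hcard : Fintype.card κ ≤ Fintype.card ι) (hz : 0 < z.im)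
    {b : ℝ} (hB : ‖B‖ ≤ b) :
    ∫ x, ‖(traceRes B z x - ∫ x', traceRes B z x' ∂γ) ^ 2‖ ^ 2 ∂γ ≤
      40 * (b ^ 2 * gradBound w z (Fintype.card ι)) ^ 2 := by
  have := hγ.gaussian
  set m := ∫ x', traceRes B z x' ∂γ with hm
  set G := b ^ 2 * gradBound w z (Fintype.card ι) with hG
  have hw0 : 0 ≤ w := (norm_nonneg _).trans (hw (Classical.arbitrary ι))
  have hG0 : 0 ≤ G := mul_nonneg (sq_nonneg _) (gradBound_nonneg hw0 hz _)
  have hg : PolyBdd fun x : ι → κ → ℂ => traceRes B z x - m :=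
    (polyBdd_traceRes B hz).sub (PolyBdd.const m)
  have hg2 : PolyBdd fun x : ι → κ → ℂ => (traceRes B z x - m) ^ 2 := by
    simpa only [sq] using hg.mul hg
  have hd2 : PolyBdd fun p : (ι → κ → ℂ) × (ι → κ → ℂ) =>
      2 * (traceRes B z p.1 - m) * traceResDeriv B z p :=
    ((PolyBdd.const 2).mul hg.fst).mul (polyBdd_traceResDeriv B hz)
  -- The fourth moment comes from the Poincaré inequality applied to the square of the centered
  -- trace; the gradient of the square brings back the variance.
  have hrot : HasRotDeriv (fun p : (ι → κ → ℂ) × (ι → κ → ℂ) => (traceRes B z p.1 - m) ^ 2)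
      (fun p => 2 * (traceRes B z p.1 - m) * traceResDeriv B z p) := fun p => by
    have h1 := ((hasRotDeriv_traceRes B hz p).sub_const m).fun_pow 2
    simpa [rotation_zero_apply] using h1
  have hV := hγ.variance_traceRes_le B hw hcard hz hB
  rw [← hm, ← hG] at hV
  have hP := integral_norm_sub_mean_sq_le hγ.centered hrot hg2 hd2
  set m2 := ∫ x, (traceRes B z x - m) ^ 2 ∂γ with hm2
  have hinner : ∫ x, ∫ y, ‖2 * (traceRes B z x - m) * traceResDeriv B z (x, y)‖ ^ 2 ∂γ ∂γ ≤
      8 * G ^ 2 := by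
    have hi := (hd2.integrable_norm_sq (γ.prod γ)).integral_prod_left
    have h1 : ∀ x, ∫ y, ‖2 * (traceRes B z x - m) * traceResDeriv B z (x, y)‖ ^ 2 ∂γ ≤
        4 * G * ‖traceRes B z x - m‖ ^ 2 := fun x => by
      have h2 := hγ.integral_norm_traceResDeriv_sq_le B hw hcard hz hB x
      have h3 : ∀ y, ‖2 * (traceRes B z x - m) * traceResDeriv B z (x, y)‖ ^ 2 =
          4 * ‖traceRes B z x - m‖ ^ 2 * ‖traceResDeriv B z (x, y)‖ ^ 2 := fun y => by
        rw [norm_mul, norm_mul]; norm_num; ring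
      simp only [h3]
      rw [integral_const_mul]
      calc _ ≤ 4 * ‖traceRes B z x - m‖ ^ 2 * G := mul_le_mul_of_nonneg_left h2 (by positivity)
        _ = _ := by ring
    refine (integral_mono hi ((hg.integrable_norm_sq γ).const_mul _) h1).trans ?_
    rw [integral_const_mul]
    calc 4 * G * ∫ x, ‖traceRes B z x - m‖ ^ 2 ∂γ ≤ 4 * G * (2 * G) :=
          mul_le_mul_of_nonneg_left hV (by positivity)
      _ = _ := by ring
  have hm2n : ‖m2‖ ≤ 2 * G := by
    refine (norm_integral_le_integral_norm _).trans ?_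
    simpa only [norm_pow] using hV
  have hpt : ∀ x : ι → κ → ℂ, ‖(traceRes B z x - m) ^ 2‖ ^ 2 ≤
      2 * ‖(traceRes B z x - m) ^ 2 - m2‖ ^ 2 + 2 * (2 * G) ^ 2 := fun x => by
    have h1 := norm_add_le ((traceRes B z x - m) ^ 2 - m2) m2
    rw [sub_add_cancel] at h1
    have h2 := pow_le_pow_left₀ (norm_nonneg _) (h1.trans (add_le_add le_rfl hm2n)) 2
    refine h2.trans ?_
    nlinarith [sq_nonneg (‖(traceRes B z x - m) ^ 2 - m2‖ - 2 * G)]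
  have hi4 : Integrable (fun x : ι → κ → ℂ => 2 * ‖(traceRes B z x - m) ^ 2 - m2‖ ^ 2) γ :=
    ((hg2.sub (PolyBdd.const m2)).integrable_norm_sq γ).const_mul 2
  -- The constant: Poincaré gives 2 · 8G² for the fluctuation of the square and its mean is at most
  -- 2G, so the total is 2 · 16G² + 2 · 4G² = 40G².
  calc ∫ x, ‖(traceRes B z x - m) ^ 2‖ ^ 2 ∂γ
      ≤ ∫ x, (2 * ‖(traceRes B z x - m) ^ 2 - m2‖ ^ 2 + 2 * (2 * G) ^ 2) ∂γ :=
        integral_mono (hg2.integrable_norm_sq γ) (hi4.add (integrable_const _)) hpt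
    _ = 2 * ∫ x, ‖(traceRes B z x - m) ^ 2 - m2‖ ^ 2 ∂γ + 2 * (2 * G) ^ 2 := by
        rw [integral_add hi4 (integrable_const _), integral_const_mul]; simp
    _ ≤ 40 * G ^ 2 := by linarith

end Variance

end CorrelatedGaussian

namespace CorrelatedGaussian

open scoped Matrix Matrix.Norms.L2Operator

/-! ### Integration by parts for quadratic forms in a column. -/

section IntegrationByParts

variable {ι κ : Type*} [Fintype ι] [Fintype κ] [DecidableEq ι] [DecidableEq κ]
  {γ : Measure (ι → κ → ℂ)} {Ω : ι → Matrix κ κ ℂ} {z : ℂ}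

/-- The quadratic form `(1/n) x_jᴴ C x_j`. -/
def colForm (C : Matrix κ κ ℂ) (x : ι → κ → ℂ) (j : ι) : ℂ :=
  (1 / (Fintype.card ι : ℂ)) * ((colMat x)ᴴ * C * colMat x) j j

local notation "rot" => ContinuousLinearMap.rotation

/-- The rotational derivative of `(x, y) ↦ (c - (1/n) tr (B Q)) x_jᴴ A Q y_j`. -/
def formDeriv (A B : Matrix κ κ ℂ) (z c : ℂ) (j : ι) (p : (ι → κ → ℂ) × (ι → κ → ℂ)) : ℂ :=
  (((colMat p.2)ᴴ * (A * res z p.1) + (colMat p.1)ᴴ * (A * resDeriv z p)) * colMat p.2 +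
    (colMat p.1)ᴴ * (A * res z p.1) * (-colMat p.1)) j j * (c - traceRes B z p.1) +
  ((colMat p.1)ᴴ * (A * res z p.1) * colMat p.2) j j * (-traceResDeriv B z p)

theorem hasRotDeriv_form (A B : Matrix κ κ ℂ) (hz : 0 < z.im) (c : ℂ) (j : ι) :
    HasRotDeriv (fun p : (ι → κ → ℂ) × (ι → κ → ℂ) =>
      ((colMat p.1)ᴴ * (A * res z p.1) * colMat p.2) j j * (c - traceRes B z p.1))
      (formDeriv A B z c j) := fun p => by
  have h1 := (((hasMatrixDerivAt_colMat_fst p).conjTranspose.mul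
    ((hasMatrixDerivAt_res p hz).const_mul A)).mul (hasMatrixDerivAt_colMat_snd p)) j j
  have h2 := (hasRotDeriv_traceRes B hz p).const_sub c
  have h3 := h1.fun_mul h2
  simp only [rotation_zero_apply] at h3
  exact h3

theorem polyBdd_formDeriv (A B : Matrix κ κ ℂ) (hz : 0 < z.im) (c : ℂ) (j : ι) :
    PolyBdd fun p : (ι → κ → ℂ) × (ι → κ → ℂ) => formDeriv A B z c j p := by
  have hx : MatrixPolyBdd fun p : (ι → κ → ℂ) × (ι → κ → ℂ) => colMat p.1 :=
    matrixPolyBdd_colMat.fst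
  have hy : MatrixPolyBdd fun p : (ι → κ → ℂ) × (ι → κ → ℂ) => colMat p.2 :=
    matrixPolyBdd_colMat.snd
  have hQ : MatrixPolyBdd fun p : (ι → κ → ℂ) × (ι → κ → ℂ) => A * res z p.1 :=
    (MatrixPolyBdd.const A).mul (matrixPolyBdd_res hz).fst
  have hQ' : MatrixPolyBdd fun p : (ι → κ → ℂ) × (ι → κ → ℂ) => A * resDeriv z p :=
    (MatrixPolyBdd.const A).mul (matrixPolyBdd_resDeriv hz)
  refine PolyBdd.add (PolyBdd.mul ?_ ((PolyBdd.const c).sub (polyBdd_traceRes B hz).fst))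
    (PolyBdd.mul (((hx.conjTranspose.mul hQ).mul hy) j j) (polyBdd_traceResDeriv B hz).neg)
  exact ((((hy.conjTranspose.mul hQ).add (hx.conjTranspose.mul hQ')).mul hy).add
    ((hx.conjTranspose.mul hQ).mul hx.neg)) j j

/-- Sorts the derivative by its dependence on y at fixed x: two terms in which y enters twice
without conjugate, three in which y is paired with its conjugate, and one free of y. -/
theorem formDeriv_eq (A B : Matrix κ κ ℂ) (z c : ℂ) (j : ι) (x y : ι → κ → ℂ) :
    formDeriv A B z c j (x, y) = (c - traceRes B z x) * ((colMat y)ᴴ * (A * res z x) * colMat y) j j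
      - (c - traceRes B z x) * (1 / (Fintype.card ι : ℂ)) *
        ∑ k, ((colMat x)ᴴ * A * res z x * colMat y) j k * ((colMat x)ᴴ * res z x * colMat y) k j
      - (c - traceRes B z x) * (1 / (Fintype.card ι : ℂ)) *
        ∑ k, ((colMat x)ᴴ * (A * res z x) * colMat x) j k *
          ((colMat y)ᴴ * res z x * colMat y) k j
      - (c - traceRes B z x) * ((colMat x)ᴴ * (A * res z x) * colMat x) j j
      + 1 / (Fintype.card ι : ℂ) ^ 2 * ∑ k, ((colMat x)ᴴ * A * res z x * colMat y) j j *
          ((colMat x)ᴴ * res z x * B * res z x * colMat y) k k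
      + 1 / (Fintype.card ι : ℂ) ^ 2 * ∑ k, ((colMat x)ᴴ * A * res z x * colMat y) j j *
          ((colMat y)ᴴ * (res z x * B * res z x * colMat x)) k k := by
  have h1 : (colMat x)ᴴ * (A * resDeriv z (x, y)) * colMat y =
      -((1 / (Fintype.card ι : ℂ)) • ((colMat x)ᴴ * A * res z x * colMat y *
        ((colMat x)ᴴ * res z x * colMat y) + (colMat x)ᴴ * (A * res z x) * colMat x *
        ((colMat y)ᴴ * res z x * colMat y))) := by
    simp only [resDeriv, Matrix.mul_neg, Matrix.neg_mul, Matrix.mul_smul, Matrix.smul_mul,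
      Matrix.mul_add, Matrix.add_mul, Matrix.mul_assoc]
  have h2 : ((colMat x)ᴴ * (A * resDeriv z (x, y)) * colMat y) j j =
      -((1 / (Fintype.card ι : ℂ)) * (∑ k, ((colMat x)ᴴ * A * res z x * colMat y) j k *
        ((colMat x)ᴴ * res z x * colMat y) k j +
        ∑ k, ((colMat x)ᴴ * (A * res z x) * colMat x) j k *
          ((colMat y)ᴴ * res z x * colMat y) k j)) := by
    rw [h1, Matrix.neg_apply, Matrix.smul_apply, Matrix.add_apply, Matrix.mul_apply,
      Matrix.mul_apply (M := (colMat x)ᴴ * (A * res z x) * colMat x), smul_eq_mul]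
  rw [formDeriv, traceResDeriv_eq, Matrix.add_mul, Matrix.add_apply, Matrix.add_apply, h2,
    Matrix.mul_neg, Matrix.neg_apply, ← Finset.mul_sum, ← Finset.mul_sum]
  simp only [Matrix.trace, Matrix.diag_apply, Matrix.mul_assoc]
  ring

/-- Circularity kills the two terms without a conjugate. In the others, independence leaves only k =
j in the sums over columns: the self-pairings of y_j give the traces, and the last sum gives the
correction of relative order 1/n². -/
theorem IsCircularLaw.integral_formDeriv (hγ : IsCircularLaw γ Ω) [Nonempty ι]
    (A : Matrix κ κ ℂ) (z c : ℂ) (j : ι) (x : ι → κ → ℂ) :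
    ∫ y, formDeriv A (Ω j) z c j (x, y) ∂γ = (Fintype.card ι : ℂ) *
      (traceRes (Ω j * A) z x * (c - traceRes (Ω j) z x) -
        colForm (A * res z x) x j * (1 + traceRes (Ω j) z x) * (c - traceRes (Ω j) z x) +
        1 / (Fintype.card ι : ℂ) ^ 2 *
          colForm (A * res z x * Ω j * res z x * Ω j * res z x) x j) := by
  have := hγ.gaussian
  have hn : (Fintype.card ι : ℂ) ≠ 0 := by simp
  have hX : MatrixPolyBdd fun y : ι → κ → ℂ => colMat y := matrixPolyBdd_colMat
  have pC : ∀ (C : Matrix κ κ ℂ) k l, PolyBdd fun y : ι → κ → ℂ =>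
      ((colMat y)ᴴ * C * colMat y) k l := fun C k l =>
    ((hX.conjTranspose.mul (MatrixPolyBdd.const C)).mul hX) k l
  have pD : ∀ (D : Matrix ι κ ℂ) k l, PolyBdd fun y : ι → κ → ℂ => (D * colMat y) k l :=
    fun D k l => ((MatrixPolyBdd.const D).mul hX) k l
  have pD' : ∀ (D : Matrix κ ι ℂ) k l, PolyBdd fun y : ι → κ → ℂ => ((colMat y)ᴴ * D) k l :=
    fun D k l => (hX.conjTranspose.mul (MatrixPolyBdd.const D)) k l
  simp only [formDeriv_eq]
  set φ := c - traceRes (Ω j) z x with hφ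
  set D := (colMat x)ᴴ * A * res z x with hD
  set D' := (colMat x)ᴴ * res z x with hD'
  set U := (colMat x)ᴴ * (A * res z x) * colMat x with hU
  set M := D' * Ω j * res z x with hM
  set M' := res z x * Ω j * res z x * colMat x with hM'
  have f1 : PolyBdd fun y : ι → κ → ℂ => φ * ((colMat y)ᴴ * (A * res z x) * colMat y) j j :=
    (PolyBdd.const φ).mul (pC _ j j)
  have s2 : ∀ k, PolyBdd fun y : ι → κ → ℂ => (D * colMat y) j k * (D' * colMat y) k j :=
    fun k => (pD D j k).mul (pD D' k j)
  have f2 : PolyBdd fun y : ι → κ → ℂ => φ * (1 / (Fintype.card ι : ℂ)) *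
      ∑ k, (D * colMat y) j k * (D' * colMat y) k j :=
    (PolyBdd.const _).mul (PolyBdd.sum _ fun k _ => s2 k)
  have s3 : ∀ k, PolyBdd fun y : ι → κ → ℂ => U j k * ((colMat y)ᴴ * res z x * colMat y) k j :=
    fun k => (PolyBdd.const _).mul (pC _ k j)
  have f3 : PolyBdd fun y : ι → κ → ℂ => φ * (1 / (Fintype.card ι : ℂ)) *
      ∑ k, U j k * ((colMat y)ᴴ * res z x * colMat y) k j :=
    (PolyBdd.const _).mul (PolyBdd.sum _ fun k _ => s3 k)
  have f4 : PolyBdd fun _ : ι → κ → ℂ => φ * U j j := PolyBdd.const _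
  have s5 : ∀ k, PolyBdd fun y : ι → κ → ℂ => (D * colMat y) j j * (M * colMat y) k k :=
    fun k => (pD D j j).mul (pD M k k)
  have f5 : PolyBdd fun y : ι → κ → ℂ => 1 / (Fintype.card ι : ℂ) ^ 2 *
      ∑ k, (D * colMat y) j j * (M * colMat y) k k :=
    (PolyBdd.const _).mul (PolyBdd.sum _ fun k _ => s5 k)
  have s6 : ∀ k, PolyBdd fun y : ι → κ → ℂ => (D * colMat y) j j * ((colMat y)ᴴ * M') k k :=
    fun k => (pD D j j).mul (pD' M' k k)
  have f6 : PolyBdd fun y : ι → κ → ℂ => 1 / (Fintype.card ι : ℂ) ^ 2 *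
      ∑ k, (D * colMat y) j j * ((colMat y)ᴴ * M') k k :=
    (PolyBdd.const _).mul (PolyBdd.sum _ fun k _ => s6 k)
  rw [integral_add (((((f1.sub f2).sub f3).sub f4).add f5).integrable γ) (f6.integrable γ),
    integral_add ((((f1.sub f2).sub f3).sub f4).integrable γ) (f5.integrable γ),
    integral_sub (((f1.sub f2).sub f3).integrable γ) (f4.integrable γ),
    integral_sub ((f1.sub f2).integrable γ) (f3.integrable γ),
    integral_sub (f1.integrable γ) (f2.integrable γ)]
  simp only [integral_const_mul, integral_const]
  rw [integral_finsetSum _ fun k _ => (s2 k).integrable γ,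
    integral_finsetSum _ fun k _ => (s3 k).integrable γ,
    integral_finsetSum _ fun k _ => (s5 k).integrable γ,
    integral_finsetSum _ fun k _ => (s6 k).integrable γ]
  simp only [integral_const_mul, hγ.integral_mul_mul, hγ.integral_conj_mul_mul,
    hγ.integral_mul_conj_mul, if_true, Finset.sum_const_zero, mul_zero, mul_ite,
    Finset.sum_ite_eq, Finset.sum_ite_eq', Finset.mem_univ]
  have e1 : (A * res z x * Ω j).trace = (Fintype.card ι : ℂ) * traceRes (Ω j * A) z x := by
    rw [traceRes, ← mul_assoc, mul_one_div_cancel hn, one_mul, Matrix.trace_mul_comm,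
      Matrix.mul_assoc]
  have e2 : (res z x * Ω j).trace = (Fintype.card ι : ℂ) * traceRes (Ω j) z x := by
    rw [traceRes, ← mul_assoc, mul_one_div_cancel hn, one_mul, Matrix.trace_mul_comm]
  have e3 : U j j = (Fintype.card ι : ℂ) * colForm (A * res z x) x j := by
    rw [colForm, ← mul_assoc, mul_one_div_cancel hn, one_mul]
  have e4 : (D * Ω j * M') j j = (Fintype.card ι : ℂ) *
      colForm (A * res z x * Ω j * res z x * Ω j * res z x) x j := by
    rw [colForm, ← mul_assoc, mul_one_div_cancel hn, one_mul, hD, hM']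
    simp only [Matrix.mul_assoc]
  rw [e1, e2, e3, e4]
  simp only [probReal_univ, one_smul]
  field_simp
  ring

/-- The Gaussian integration by parts formula for `x_jᴴ A Q x_j`. -/
theorem IsCircularLaw.integral_by_parts (hγ : IsCircularLaw γ Ω) [Nonempty ι] (hz : 0 < z.im)
    (A : Matrix κ κ ℂ) (c : ℂ) (j : ι) :
    ∫ x, (traceRes (Ω j * A) z x * (c - traceRes (Ω j) z x) -
        colForm (A * res z x) x j * (1 + traceRes (Ω j) z x) * (c - traceRes (Ω j) z x) +
        1 / (Fintype.card ι : ℂ) ^ 2 *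
          colForm (A * res z x * Ω j * res z x * Ω j * res z x) x j) ∂γ = 0 := by
  have := hγ.gaussian
  have hx : MatrixPolyBdd fun p : (ι → κ → ℂ) × (ι → κ → ℂ) => colMat p.1 :=
    matrixPolyBdd_colMat.fst
  have hy : MatrixPolyBdd fun p : (ι → κ → ℂ) × (ι → κ → ℂ) => colMat p.2 :=
    matrixPolyBdd_colMat.snd
  have hQ : MatrixPolyBdd fun p : (ι → κ → ℂ) × (ι → κ → ℂ) => A * res z p.1 :=
    (MatrixPolyBdd.const A).mul (matrixPolyBdd_res hz).fst
  -- The mean of the derivative over (x, y) vanishes; by Fubini, y can be integrated out first at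
  -- fixed x.
  have h1 := integral_rotDeriv_eq_zero hγ.centered (hasRotDeriv_form A (Ω j) hz c j)
    ((((hx.conjTranspose.mul hQ).mul hy) j j).mul
      ((PolyBdd.const c).sub (polyBdd_traceRes (Ω j) hz).fst))
    (polyBdd_formDeriv A (Ω j) hz c j)
  rw [integral_prod _ ((polyBdd_formDeriv A (Ω j) hz c j).integrable _)] at h1
  simp only [hγ.integral_formDeriv] at h1
  rw [integral_const_mul] at h1
  exact (mul_eq_zero.1 h1).resolve_left (by simp)

end IntegrationByParts

end CorrelatedGaussian

namespace CorrelatedGaussian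

open scoped Matrix Matrix.Norms.L2Operator ComplexOrder

/-! ### The means α solve the canonical system up to O(1/n²). -/

section MainEstimate

variable {ι κ : Type*} [Fintype ι] [Fintype κ] [DecidableEq ι] [DecidableEq κ]
  {γ : Measure (ι → κ → ℂ)} {Ω : ι → Matrix κ κ ℂ} {z : ℂ}

theorem polyBdd_colForm {F : (ι → κ → ℂ) → Matrix κ κ ℂ} (hF : MatrixPolyBdd F) (j : ι) :
    PolyBdd fun x : ι → κ → ℂ => colForm (F x) x j :=
  (PolyBdd.const _).mul
    (((matrixPolyBdd_colMat.conjTranspose.mul hF).mul matrixPolyBdd_colMat) j j)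

theorem norm_colForm_sq_le [Nonempty ι] (hz : 0 < z.im) {C : Matrix κ κ ℂ} {b : ℝ}
    (hC : ‖C‖ ≤ b) (x : ι → κ → ℂ) (j : ι) :
    ‖colForm (C * res z x) x j‖ ^ 2 ≤
      b ^ 2 * ((1 + ‖z‖ / z.im) / z.im) / Fintype.card ι * vnorm (x j) ^ 2 := by
  set n : ℝ := (Fintype.card ι : ℝ) with hn
  have hn0 : 0 < n := by rw [hn]; exact_mod_cast Fintype.card_pos
  have hb0 : 0 ≤ b := (norm_nonneg _).trans hC
  set c := (1 + ‖z‖ / z.im) / z.im with hc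
  have e : ((colMat x)ᴴ * (C * res z x) * colMat x) j j =
      star (x j) ⬝ᵥ (C *ᵥ ((res z x * colMat x).col j)) := by
    have : (colMat x)ᴴ * (C * res z x) * colMat x = (colMat x)ᴴ * (C * (res z x * colMat x)) := by
      simp only [Matrix.mul_assoc]
    rw [this, Matrix.mul_apply]
    rfl
  have h1 : ‖((colMat x)ᴴ * (C * res z x) * colMat x) j j‖ ≤
      vnorm (x j) * (b * ‖res z x * colMat x‖) := by
    rw [e]
    refine (norm_dotProduct_le _ _).trans ?_
    rw [vnorm_star]
    refine mul_le_mul_of_nonneg_left ((vnorm_mulVec_le _ _).trans ?_) (vnorm_nonneg _)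
    exact mul_le_mul hC (vnorm_col_le _ _) (vnorm_nonneg _) hb0
  have h2 : ‖((colMat x)ᴴ * (C * res z x) * colMat x) j j‖ ^ 2 ≤
      vnorm (x j) ^ 2 * (b ^ 2 * (n * c)) := by
    refine (pow_le_pow_left₀ (norm_nonneg _) h1 2).trans ?_
    rw [mul_pow, mul_pow]
    exact mul_le_mul_of_nonneg_left
      (mul_le_mul_of_nonneg_left (norm_res_mul_colMat_sq_le x hz) (by positivity)) (by positivity)
  rw [colForm, norm_mul, mul_pow, norm_div, norm_one, Complex.norm_natCast, ← hn]
  calc (1 / n) ^ 2 * ‖((colMat x)ᴴ * (C * res z x) * colMat x) j j‖ ^ 2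
      ≤ (1 / n) ^ 2 * (vnorm (x j) ^ 2 * (b ^ 2 * (n * c))) :=
        mul_le_mul_of_nonneg_left h2 (by positivity)
    _ = _ := by field_simp

theorem polyBdd_vnorm_sq (j : ι) : PolyBdd fun x : ι → κ → ℂ => ((vnorm (x j) ^ 2 : ℝ) : ℂ) := by
  have e : (fun x : ι → κ → ℂ => ((vnorm (x j) ^ 2 : ℝ) : ℂ)) =
      fun x => ∑ a, x j a * star (x j a) := by
    funext x
    rw [← star_dotProduct_self, dotProduct_comm]
    rfl
  rw [e]
  exact PolyBdd.sum _ fun a _ => (polyBdd_coord j a).mul (polyBdd_coord j a).star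

theorem IsCircularLaw.integral_vnorm_sq_le (hγ : IsCircularLaw γ Ω) {w : ℝ}
    (hw : ∀ i, ‖Ω i‖ ≤ w) (j : ι) : ∫ x, vnorm (x j) ^ 2 ∂γ ≤ Fintype.card κ * w := by
  rw [hγ.integral_vnorm_sq]
  refine (Complex.re_le_norm _).trans ((norm_trace_le _).trans ?_)
  exact mul_le_mul_of_nonneg_left (hw j) (Nat.cast_nonneg _)

/-- The quadratic form is bounded in L² uniformly in n: ‖QΣ‖² and E‖x_j‖² are each at most of order
n, against the prefactor 1/n². The matrix `C` may depend on x, which the remainder of the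
integration by parts requires. -/
theorem IsCircularLaw.integral_norm_colForm_sq_le [Nonempty ι] (hγ : IsCircularLaw γ Ω)
    {w : ℝ} (hw : ∀ i, ‖Ω i‖ ≤ w) (hcard : Fintype.card κ ≤ Fintype.card ι) (hz : 0 < z.im)
    {C : (ι → κ → ℂ) → Matrix κ κ ℂ} {b : ℝ} (hC : ∀ x, ‖C x‖ ≤ b) (hCp : MatrixPolyBdd C)
    (j : ι) :
    ∫ x, ‖colForm (C x * res z x) x j‖ ^ 2 ∂γ ≤ b ^ 2 * ((1 + ‖z‖ / z.im) / z.im) * w := by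
  have := hγ.gaussian
  set n : ℝ := (Fintype.card ι : ℝ) with hn
  have hn0 : 0 < n := by rw [hn]; exact_mod_cast Fintype.card_pos
  have hw0 : 0 ≤ w := (norm_nonneg _).trans (hw j)
  have hcard' : (Fintype.card κ : ℝ) ≤ n := by rw [hn]; exact_mod_cast hcard
  have hi : Integrable (fun x : ι → κ → ℂ => vnorm (x j) ^ 2) γ := by
    exact ((polyBdd_vnorm_sq j).integrable γ).re
  set c := (1 + ‖z‖ / z.im) / z.im with hc
  have hc0 : 0 ≤ c := by positivity
  refine (integral_mono ((polyBdd_colForm (hCp.mul (matrixPolyBdd_res hz)) j).integrable_norm_sq γ)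
    (hi.const_mul _) fun x => norm_colForm_sq_le hz (hC x) x j).trans ?_
  rw [integral_const_mul]
  calc b ^ 2 * c / n * ∫ x, vnorm (x j) ^ 2 ∂γ ≤ b ^ 2 * c / n * (n * w) := by
        refine mul_le_mul_of_nonneg_left ((hγ.integral_vnorm_sq_le hw j).trans ?_) (by positivity)
        exact mul_le_mul_of_nonneg_right hcard' hw0
    _ = _ := by field_simp

/-- Young's inequality with a free weight `r`, used in place of Cauchy–Schwarz to avoid square
roots. -/
theorem norm_integral_mul_le {E : Type*} [NormedAddCommGroup E] [NormedSpace ℝ E]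
    [MeasurableSpace E] [BorelSpace E] [SecondCountableTopology E] [CompleteSpace E]
    {μ : Measure E} [IsGaussian μ] {f g : E → ℂ} (hf : PolyBdd f) (hg : PolyBdd g) {r F G : ℝ}
    (hr : 0 < r) (hF : ∫ x, ‖f x‖ ^ 2 ∂μ ≤ F) (hG : ∫ x, ‖g x‖ ^ 2 ∂μ ≤ G) :
    ‖∫ x, f x * g x ∂μ‖ ≤ (r * F + G / r) / 2 := by
  have hpt : ∀ x, ‖f x * g x‖ ≤ r / 2 * ‖f x‖ ^ 2 + 1 / (2 * r) * ‖g x‖ ^ 2 := fun x => by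
    rw [norm_mul]
    have h1 : r / 2 * ‖f x‖ ^ 2 + 1 / (2 * r) * ‖g x‖ ^ 2 - ‖f x‖ * ‖g x‖ =
        (r * ‖f x‖ - ‖g x‖) ^ 2 / (2 * r) := by field_simp; ring
    have h2 : 0 ≤ (r * ‖f x‖ - ‖g x‖) ^ 2 / (2 * r) := by positivity
    linarith
  have i1 := (hf.integrable_norm_sq μ).const_mul (r / 2)
  have i2 := (hg.integrable_norm_sq μ).const_mul (1 / (2 * r))
  refine (norm_integral_le_integral_norm _).trans ?_
  refine (integral_mono ((hf.mul hg).integrable μ).norm (i1.add i2) hpt).trans ?_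
  simp only [Pi.add_apply]
  rw [integral_add i1 i2, integral_const_mul, integral_const_mul]
  have h3 := mul_le_mul_of_nonneg_left hF (by positivity : 0 ≤ r / 2)
  have h4 := mul_le_mul_of_nonneg_left hG (by positivity : 0 ≤ 1 / (2 * r))
  calc _ ≤ r / 2 * F + 1 / (2 * r) * G := add_le_add h3 h4
    _ = _ := by field_simp

/-- The constant in the approximation of the canonical equation. -/
def errorConst (w : ℝ) (z : ℂ) : ℝ :=
  4 * w ^ 3 * ((1 + ‖z‖ / z.im) / z.im) / z.im ^ 2 *
      ((w / z.im) ^ 2 * ((1 + ‖z‖ / z.im) / z.im) * w / 2 + 21 + (w / z.im) ^ 2) +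
    (1 + (w ^ 3 / z.im ^ 3) ^ 2 * ((1 + ‖z‖ / z.im) / z.im) * w) / 2

/-- Column by column, E (1/n) x_jᴴ A Q x_j equals E (1/n) tr(Ω_j A Q) / (1+α_j) up to O(1/n²), for
deterministic A. -/
theorem IsCircularLaw.norm_colForm_sub_traceRes_le [Nonempty ι] (hγ : IsCircularLaw γ Ω)
    {w : ℝ} (hw0 : 0 < w) (hw : ∀ i, ‖Ω i‖ ≤ w) (hcard : Fintype.card κ ≤ Fintype.card ι)
    (hz : 0 < z.im) {A : Matrix κ κ ℂ} (hA : ‖A‖ ≤ w / z.im) (j : ι) :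
    ‖(1 + ∫ x, traceRes (Ω j) z x ∂γ) *
      ((1 + ∫ x, traceRes (Ω j) z x ∂γ) * ∫ x, colForm (A * res z x) x j ∂γ -
        ∫ x, traceRes (Ω j * A) z x ∂γ)‖ ≤ errorConst w z / (Fintype.card ι : ℝ) ^ 2 := by
  have := hγ.gaussian
  set n : ℝ := (Fintype.card ι : ℝ) with hn
  have hn0 : 0 < n := by rw [hn]; exact_mod_cast Fintype.card_pos
  set c := (1 + ‖z‖ / z.im) / z.im with hc
  have hc0 : 0 < c := by positivity
  set α := ∫ x, traceRes (Ω j) z x ∂γ with hα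
  set τ := ∫ x, traceRes (Ω j * A) z x ∂γ with hτ
  set b := w / z.im with hb
  have hb0 : 0 < b := by positivity
  set G := w ^ 2 * gradBound w z (Fintype.card ι) with hG
  have hGeq : G = 4 * w ^ 3 * c / z.im ^ 2 / n ^ 2 := by
    rw [hG, gradBound, ← hc, ← hn]
    field_simp
  have hG0 : 0 < G := by rw [hGeq]; positivity
  have pa : PolyBdd fun x : ι → κ → ℂ => traceRes (Ω j) z x - α :=
    (polyBdd_traceRes _ hz).sub (PolyBdd.const _)
  have pa2 : PolyBdd fun x : ι → κ → ℂ => (traceRes (Ω j) z x - α) ^ 2 := by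
    simpa only [sq] using pa.mul pa
  have pt0 : PolyBdd fun x : ι → κ → ℂ => traceRes (Ω j * A) z x := polyBdd_traceRes _ hz
  have pt : PolyBdd fun x : ι → κ → ℂ => traceRes (Ω j * A) z x - τ := pt0.sub (PolyBdd.const _)
  have ps : PolyBdd fun x : ι → κ → ℂ => colForm (A * res z x) x j :=
    polyBdd_colForm ((MatrixPolyBdd.const A).mul (matrixPolyBdd_res hz)) j
  have pC : MatrixPolyBdd fun x : ι → κ → ℂ => A * res z x * Ω j * res z x * Ω j :=
    (((((MatrixPolyBdd.const A).mul (matrixPolyBdd_res hz)).mul (MatrixPolyBdd.const _)).mul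
      (matrixPolyBdd_res hz)).mul (MatrixPolyBdd.const _))
  have pr : PolyBdd fun x : ι → κ → ℂ =>
      colForm (A * res z x * Ω j * res z x * Ω j * res z x) x j :=
    polyBdd_colForm (pC.mul (matrixPolyBdd_res hz)) j
  have hmean : ∫ x, (traceRes (Ω j) z x - α) ∂γ = 0 := by
    rw [integral_sub ((polyBdd_traceRes _ hz).integrable γ) (integrable_const _)]
    simp [hα]
  -- The choice c = 1 + 2α gives (1+t)(c−t) = (1+α)² − (t−α)² with t = (1/n) tr(Ω_j Q). The
  -- fluctuation of t thus meets the quadratic form only at second order. In the trace term the part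
  -- linear in t − α has mean zero or multiplies another centered trace.
  have hibp := hγ.integral_by_parts hz A (1 + 2 * α) j
  have e : ∀ x : ι → κ → ℂ, traceRes (Ω j * A) z x * (1 + 2 * α - traceRes (Ω j) z x) -
        colForm (A * res z x) x j * (1 + traceRes (Ω j) z x) *
          (1 + 2 * α - traceRes (Ω j) z x) +
        1 / (Fintype.card ι : ℂ) ^ 2 *
          colForm (A * res z x * Ω j * res z x * Ω j * res z x) x j =
      (1 + α) * traceRes (Ω j * A) z x -
        (traceRes (Ω j * A) z x - τ) * (traceRes (Ω j) z x - α) -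
        τ * (traceRes (Ω j) z x - α) - (1 + α) ^ 2 * colForm (A * res z x) x j +
        colForm (A * res z x) x j * (traceRes (Ω j) z x - α) ^ 2 +
        1 / (Fintype.card ι : ℂ) ^ 2 *
          colForm (A * res z x * Ω j * res z x * Ω j * res z x) x j := fun x => by ring
  simp only [e] at hibp
  have g1 := (PolyBdd.const (1 + α)).mul pt0
  have g2 := pt.mul pa
  have g3 := (PolyBdd.const τ).mul pa
  have g4 := (PolyBdd.const ((1 + α) ^ 2)).mul ps
  have g5 := ps.mul pa2
  have g6 := (PolyBdd.const (1 / (Fintype.card ι : ℂ) ^ 2)).mul pr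
  rw [integral_add (((((g1.sub g2).sub g3).sub g4).add g5).integrable γ) (g6.integrable γ),
    integral_add ((((g1.sub g2).sub g3).sub g4).integrable γ) (g5.integrable γ),
    integral_sub (((g1.sub g2).sub g3).integrable γ) (g4.integrable γ),
    integral_sub ((g1.sub g2).integrable γ) (g3.integrable γ),
    integral_sub (g1.integrable γ) (g2.integrable γ), integral_const_mul, integral_const_mul,
    integral_const_mul, integral_const_mul, hmean, mul_zero, sub_zero] at hibp
  have key : (1 + α) * ((1 + α) * ∫ x, colForm (A * res z x) x j ∂γ - τ) =
      ∫ x, colForm (A * res z x) x j * (traceRes (Ω j) z x - α) ^ 2 ∂γ -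
      ∫ x, (traceRes (Ω j * A) z x - τ) * (traceRes (Ω j) z x - α) ∂γ +
      1 / (Fintype.card ι : ℂ) ^ 2 *
        ∫ x, 1 * colForm (A * res z x * Ω j * res z x * Ω j * res z x) x j ∂γ := by
    simp only [one_mul]
    linear_combination -hibp
  have hV := hγ.variance_traceRes_le (Ω j) hw hcard hz (hw j)
  have hV4 := hγ.fourthMoment_traceRes_le (Ω j) hw hcard hz (hw j)
  have hVt := hγ.variance_traceRes_le (Ω j * A) hw hcard hz
    ((Matrix.l2_opNorm_mul _ _).trans (mul_le_mul (hw j) hA (norm_nonneg _) hw0.le))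
  rw [← hα, ← hG] at hV hV4
  have hVt' : ∫ x, ‖traceRes (Ω j * A) z x - τ‖ ^ 2 ∂γ ≤ 2 * (b ^ 2 * G) := by
    refine hVt.trans_eq ?_
    rw [hG]; ring
  have hs := hγ.integral_norm_colForm_sq_le hw hcard hz (C := fun _ => A) (fun _ => hA)
    (MatrixPolyBdd.const A) j
  have hCn : ∀ x : ι → κ → ℂ, ‖A * res z x * Ω j * res z x * Ω j‖ ≤ w ^ 3 / z.im ^ 3 := fun x => by
    have hq := (isUnit_gram_sub x hz).2
    have k1 : ‖A * res z x‖ ≤ b * (1 / z.im) := (Matrix.l2_opNorm_mul _ _).trans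
      (mul_le_mul hA hq (norm_nonneg _) (by positivity))
    have k2 : ‖A * res z x * Ω j‖ ≤ b * (1 / z.im) * w := (Matrix.l2_opNorm_mul _ _).trans
      (mul_le_mul k1 (hw j) (norm_nonneg _) (by positivity))
    have k3 : ‖A * res z x * Ω j * res z x‖ ≤ b * (1 / z.im) * w * (1 / z.im) :=
      (Matrix.l2_opNorm_mul _ _).trans (mul_le_mul k2 hq (norm_nonneg _) (by positivity))
    refine (Matrix.l2_opNorm_mul _ _).trans
      ((mul_le_mul k3 (hw j) (norm_nonneg _) (by positivity)).trans_eq ?_)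
    rw [hb]
    field_simp
  have hr := hγ.integral_norm_colForm_sq_le hw hcard hz hCn pC j
  -- The weight G balances a factor of order 1 in L² with a squared fluctuation whose second moment
  -- is at most 40G², so the product has order G, that is 1/n².
  have b1 := norm_integral_mul_le ps pa2 hG0 hs hV4
  have b2 := norm_integral_mul_le pt pa one_pos hVt' hV
  have b3 := norm_integral_mul_le (μ := γ) (PolyBdd.const 1) pr one_pos
    (F := 1) (by simp) hr
  have hn2 : ‖1 / (Fintype.card ι : ℂ) ^ 2‖ = 1 / n ^ 2 := by
    rw [norm_div, norm_one, norm_pow, Complex.norm_natCast]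
  rw [key]
  refine (norm_add_le _ _).trans ((add_le_add (norm_sub_le _ _) le_rfl).trans ?_)
  rw [norm_mul, hn2]
  refine (add_le_add (add_le_add b1 b2)
    (mul_le_mul_of_nonneg_left b3 (by positivity))).trans_eq ?_
  -- The 21 in `errorConst` collects 20 from 40G/2 in `b1` and 1 from the variance of t in `b2`;
  -- (w/Im z)² comes from the other variance in `b2`, and the last summand from `b3`.
  rw [errorConst, ← hc, ← hb]
  have hGne := hG0.ne'
  have h40 : 40 * G ^ 2 / G = 40 * G := by field_simp
  rw [h40, hGeq]
  field_simp
  ring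

/-- If `W - Wᴴ = 2 i y S` with `S` positive, then
`Im tr (Ω W) = y tr (Ω S) ≥ 0`. -/
theorem im_trace_mul_nonneg {B W S : Matrix κ κ ℂ} (hB : B.PosSemidef) (hS : S.PosSemidef)
    {y : ℝ} (hy : 0 ≤ y) (h : W - Wᴴ = (2 * Complex.I * y) • S) : 0 ≤ (B * W).trace.im := by
  have h1 : (B * W).trace - star (B * W).trace = 2 * Complex.I * y * (B * S).trace := by
    rw [← Matrix.trace_conjTranspose, Matrix.conjTranspose_mul, hB.isHermitian.eq,
      Matrix.trace_mul_comm Wᴴ, ← Matrix.trace_sub, ← Matrix.mul_sub, h, Matrix.mul_smul,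
      Matrix.trace_smul, smul_eq_mul]
  have h2 := Complex.le_def.1 (trace_mul_nonneg hB hS)
  have h3 := congrArg Complex.im h1
  have h4 : (B * S).trace = (((B * S).trace.re : ℝ) : ℂ) :=
    Complex.ext rfl (by simpa using h2.2.symm)
  rw [h4] at h3
  simp at h3
  have h5 : 0 ≤ y * (B * S).trace.re := mul_nonneg hy (by simpa using h2.1)
  linarith

/-- Q − Qᴴ = 2i Im z · QQᴴ and zQ − (zQ)ᴴ = 2i Im z · Q·gram·Qᴴ; both right factors are positive. -/
theorem im_traceRes_nonneg {B : Matrix κ κ ℂ} (hB : B.PosSemidef) (hz : 0 < z.im)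
    (x : ι → κ → ℂ) : 0 ≤ (traceRes B z x).im ∧ 0 ≤ (z * traceRes B z x).im := by
  set P := gram x - z • (1 : Matrix κ κ ℂ) with hP
  have hu := (Matrix.isUnit_iff_isUnit_det _).1 (isUnit_gram_sub x hz).1
  have hQP : res z x * P = 1 := Matrix.nonsing_inv_mul _ hu
  have hPQ : Pᴴ * (res z x)ᴴ = 1 := by
    rw [← Matrix.conjTranspose_mul, hQP, Matrix.conjTranspose_one]
  have hg := (gram_posSemidef x).isHermitian.eq
  have hPh : Pᴴ = gram x - star z • (1 : Matrix κ κ ℂ) := by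
    rw [hP, Matrix.conjTranspose_sub, hg, Matrix.conjTranspose_smul, Matrix.conjTranspose_one]
  have hzz : z - star z = 2 * Complex.I * z.im := by
    apply Complex.ext
    · simp
    · simp; ring
  have hc : (1 / (Fintype.card ι : ℂ)) = ((1 / (Fintype.card ι : ℝ) : ℝ) : ℂ) := by
    push_cast; rfl
  have h1 : 0 ≤ (B * res z x).trace.im := by
    refine im_trace_mul_nonneg (S := res z x * (res z x)ᴴ) hB
      (Matrix.posSemidef_self_mul_conjTranspose _) hz.le ?_
    calc res z x - (res z x)ᴴ = res z x * (Pᴴ - P) * (res z x)ᴴ := by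
          rw [Matrix.mul_sub, Matrix.sub_mul, Matrix.mul_assoc, hPQ, hQP, Matrix.mul_one,
            Matrix.one_mul]
      _ = _ := by
          rw [hPh, hP, sub_sub_sub_cancel_left, ← sub_smul, hzz, Matrix.mul_smul, Matrix.smul_mul,
            Matrix.mul_one]
  have h2 : 0 ≤ (B * (z • res z x)).trace.im := by
    refine im_trace_mul_nonneg (S := res z x * gram x * (res z x)ᴴ) hB
      ((gram_posSemidef x).mul_mul_conjTranspose_same _) hz.le ?_
    calc z • res z x - (z • res z x)ᴴ
        = res z x * (z • Pᴴ - star z • P) * (res z x)ᴴ := by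
          rw [Matrix.mul_sub, Matrix.sub_mul, Matrix.mul_smul, Matrix.mul_smul, hQP,
            Matrix.smul_mul, Matrix.smul_mul, Matrix.mul_assoc, hPQ, Matrix.mul_one,
            Matrix.one_mul, Matrix.conjTranspose_smul]
      _ = _ := by
          have : z • Pᴴ - star z • P = (2 * Complex.I * z.im) • gram x := by
            rw [hPh, hP, ← hzz, sub_smul, smul_sub, smul_sub, smul_smul, smul_smul, mul_comm z]
            abel
          rw [this, Matrix.mul_smul, Matrix.smul_mul]
  constructor
  · rw [traceRes, hc, Complex.im_ofReal_mul]
    exact mul_nonneg (by positivity) h1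
  · have : z * traceRes B z x =
        (1 / (Fintype.card ι : ℂ)) * (B * (z • res z x)).trace := by
      rw [traceRes, Matrix.mul_smul, Matrix.trace_smul, smul_eq_mul]; ring
    rw [this, hc, Complex.im_ofReal_mul]
    exact mul_nonneg (by positivity) h2

theorem norm_traceRes_le (B : Matrix κ κ ℂ) (hz : 0 < z.im) {b : ℝ} (hB : ‖B‖ ≤ b)
    (x : ι → κ → ℂ) :
    ‖traceRes B z x‖ ≤ Fintype.card κ / Fintype.card ι * (b / z.im) := by
  have hb0 : 0 ≤ b := (norm_nonneg _).trans hB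
  rw [traceRes, norm_mul, norm_div, norm_one, Complex.norm_natCast]
  have h1 : ‖B * res z x‖ ≤ b * (1 / z.im) := (Matrix.l2_opNorm_mul _ _).trans
    (mul_le_mul hB (isUnit_gram_sub x hz).2 (norm_nonneg _) hb0)
  have h2 := (norm_trace_le (B * res z x)).trans
    (mul_le_mul_of_nonneg_left h1 (Nat.cast_nonneg _))
  calc 1 / (Fintype.card ι : ℝ) * ‖(B * res z x).trace‖
      ≤ 1 / (Fintype.card ι : ℝ) * (Fintype.card κ * (b * (1 / z.im))) :=
        mul_le_mul_of_nonneg_left h2 (by positivity)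
    _ = _ := by ring

theorem im_integral_traceRes_nonneg [IsGaussian γ] {B : Matrix κ κ ℂ} (hB : B.PosSemidef)
    (hz : 0 < z.im) :
    0 ≤ (∫ x, traceRes B z x ∂γ).im ∧ 0 ≤ (z * ∫ x, traceRes B z x ∂γ).im := by
  have hi := (polyBdd_traceRes (ι := ι) B hz).integrable γ
  constructor
  · have h : ∫ x, (traceRes B z x).im ∂γ = (∫ x, traceRes B z x ∂γ).im := integral_im hi
    rw [← h]
    exact integral_nonneg fun x => (im_traceRes_nonneg hB hz x).1
  · rw [← integral_const_mul]
    have h : ∫ x, (z * traceRes B z x).im ∂γ = (∫ x, z * traceRes B z x ∂γ).im :=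
      integral_im (hi.const_mul z)
    rw [← h]
    exact integral_nonneg fun x => (im_traceRes_nonneg hB hz x).2

theorem norm_integral_traceRes_le [IsProbabilityMeasure γ] (B : Matrix κ κ ℂ) (hz : 0 < z.im)
    {b : ℝ} (hB : ‖B‖ ≤ b) :
    ‖∫ x, traceRes B z x ∂γ‖ ≤ Fintype.card κ / Fintype.card ι * (b / z.im) := by
  have := norm_integral_le_of_norm_le_const (μ := γ)
    (ae_of_all _ fun x => norm_traceRes_le (ι := ι) B hz hB x)
  simpa using this

/-- Resolvent identity Q − T = (Q T⁻¹ − 1)T. Since 1 + zQ = Q·gram, the bracket is (1/n)∑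
QΩ_j/(1+d_j) − Q·gram, and the trace with the Gram matrix splits into the quadratic forms of the
columns. -/
theorem traceRes_sub_eq [Nonempty ι] (hΩ : ∀ i, (Ω i).PosSemidef) (hz : 0 < z.im) {d : ι → ℂ}
    (hd : ∀ i, 0 ≤ (d i).im) (i : ι) (x : ι → κ → ℂ) :
    traceRes (Ω i) z x - (1 / (Fintype.card ι : ℂ)) * (Ω i * (detPencil Ω d z)⁻¹).trace =
      (1 / (Fintype.card ι : ℂ)) * ∑ j, (1 / (1 + d j) *
        traceRes (Ω j * ((detPencil Ω d z)⁻¹ * Ω i)) z x -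
          colForm ((detPencil Ω d z)⁻¹ * Ω i * res z x) x j) := by
  set M := detPencil Ω d z with hM
  set A := M⁻¹ * Ω i with hA
  have hn : (Fintype.card ι : ℂ) ≠ 0 := by simp
  have hdet : IsUnit M.det := (Matrix.isUnit_iff_isUnit_det _).1 (isUnit_detPencil hΩ hz hd).1
  have h1 : Ω i * res z x - Ω i * M⁻¹ = Ω i * ((res z x * M - 1) * M⁻¹) := by
    rw [Matrix.sub_mul, Matrix.mul_assoc, Matrix.mul_nonsing_inv _ hdet, Matrix.mul_one,
      Matrix.one_mul, Matrix.mul_sub]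
  have h2 : res z x * M - 1 = (1 / (Fintype.card ι : ℂ)) • ∑ j, (1 / (1 + d j)) • (res z x * Ω j) -
      res z x * gram x := by
    rw [res_mul_gram x hz, hM, detPencil, Matrix.mul_sub, Matrix.mul_smul, Matrix.mul_smul,
      Matrix.mul_one, Matrix.mul_sum]
    simp only [Matrix.mul_smul]
    abel
  have h3 : (Ω i * ((res z x * M - 1) * M⁻¹)).trace = (A * (res z x * M - 1)).trace := by
    rw [← Matrix.mul_assoc, Matrix.trace_mul_comm, ← Matrix.mul_assoc]
  have h4 : (A * (res z x * gram x)).trace = ∑ j, colForm (A * res z x) x j := by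
    rw [gram, Matrix.mul_smul, Matrix.mul_smul, Matrix.trace_smul, ← Matrix.mul_assoc,
      ← Matrix.mul_assoc, Matrix.trace_mul_comm, smul_eq_mul, Matrix.trace, Finset.mul_sum]
    refine Finset.sum_congr rfl fun j _ => ?_
    rw [colForm, Matrix.diag_apply, Matrix.mul_assoc (colMat x)ᴴ]
  have h5 : ∀ j, (A * (res z x * Ω j)).trace = (Fintype.card ι : ℂ) * traceRes (Ω j * A) z x :=
    fun j => by
      rw [traceRes, ← Matrix.mul_assoc A, Matrix.trace_mul_comm, ← Matrix.mul_assoc]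
      field_simp
  rw [traceRes, ← mul_sub, ← Matrix.trace_sub, h1, h3, h2, Matrix.mul_sub, Matrix.trace_sub, h4,
    Matrix.mul_smul, Matrix.trace_smul, Matrix.mul_sum, Matrix.trace_sum, Finset.sum_sub_distrib]
  congr 2
  rw [smul_eq_mul, Finset.mul_sum]
  refine Finset.sum_congr rfl fun j _ => ?_
  rw [Matrix.mul_smul, Matrix.trace_smul, h5, smul_eq_mul]
  field_simp

/-- The means `α_i = E (1/n) tr (Ω_i Q)` solve the canonical equation up to `O(1/n²)`. -/
theorem IsCircularLaw.norm_integral_traceRes_sub_le [Nonempty ι] (hγ : IsCircularLaw γ Ω)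
    (hΩ : ∀ i, (Ω i).PosSemidef) {w : ℝ} (hw0 : 0 < w) (hw : ∀ i, ‖Ω i‖ ≤ w)
    (hcard : Fintype.card κ ≤ Fintype.card ι) (hz : 0 < z.im) (i : ι) :
    ‖∫ x, traceRes (Ω i) z x ∂γ - (1 / (Fintype.card ι : ℂ)) *
      (Ω i * (detPencil Ω (fun j => ∫ x, traceRes (Ω j) z x ∂γ) z)⁻¹).trace‖ ≤
        (‖z‖ / z.im) ^ 2 * errorConst w z / (Fintype.card ι : ℝ) ^ 2 := by
  have := hγ.gaussian
  set α : ι → ℂ := fun j => ∫ x, traceRes (Ω j) z x ∂γ with hα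
  have hα0 : ∀ j, 0 ≤ (α j).im := fun j => (im_integral_traceRes_nonneg (hΩ j) hz).1
  have hα1 : ∀ j, 0 ≤ (z * α j).im := fun j => (im_integral_traceRes_nonneg (hΩ j) hz).2
  set T := (detPencil Ω α z)⁻¹ with hT
  have hA : ‖T * Ω i‖ ≤ w / z.im := by
    refine (Matrix.l2_opNorm_mul _ _).trans ((mul_le_mul (isUnit_detPencil hΩ hz hα0).2 (hw i)
      (norm_nonneg _) (by positivity)).trans_eq ?_)
    ring
  have pT : ∀ B : Matrix κ κ ℂ, PolyBdd fun x : ι → κ → ℂ => traceRes B z x :=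
    fun B => polyBdd_traceRes B hz
  have ps : ∀ j, PolyBdd fun x : ι → κ → ℂ => colForm (T * Ω i * res z x) x j := fun j =>
    polyBdd_colForm ((MatrixPolyBdd.const _).mul (matrixPolyBdd_res hz)) j
  have pj : ∀ j, PolyBdd fun x : ι → κ → ℂ => 1 / (1 + α j) * traceRes (Ω j * (T * Ω i)) z x -
      colForm (T * Ω i * res z x) x j := fun j => ((PolyBdd.const _).mul (pT _)).sub (ps j)
  have e : ∫ x, traceRes (Ω i) z x ∂γ - (1 / (Fintype.card ι : ℂ)) * (Ω i * T).trace =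
      (1 / (Fintype.card ι : ℂ)) * ∑ j, (1 / (1 + α j) *
        ∫ x, traceRes (Ω j * (T * Ω i)) z x ∂γ - ∫ x, colForm (T * Ω i * res z x) x j ∂γ) := by
    have e1 : ∫ x, (traceRes (Ω i) z x - (1 / (Fintype.card ι : ℂ)) * (Ω i * T).trace) ∂γ =
        ∫ x, traceRes (Ω i) z x ∂γ - (1 / (Fintype.card ι : ℂ)) * (Ω i * T).trace := by
      rw [integral_sub ((pT _).integrable γ) (integrable_const _)]
      simp
    rw [← e1]
    simp only [hT, traceRes_sub_eq hΩ hz hα0]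
    rw [integral_const_mul, integral_finsetSum _ fun j _ => (pj j).integrable γ]
    congr 1
    refine Finset.sum_congr rfl fun j _ => ?_
    rw [integral_sub (((PolyBdd.const _).mul (pT _)).integrable γ) ((ps j).integrable γ),
      integral_const_mul]
  rw [e]
  have hbd : ∀ j, ‖1 / (1 + α j) * ∫ x, traceRes (Ω j * (T * Ω i)) z x ∂γ -
      ∫ x, colForm (T * Ω i * res z x) x j ∂γ‖ ≤
        (‖z‖ / z.im) ^ 2 * (errorConst w z / (Fintype.card ι : ℝ) ^ 2) := fun j => by
    obtain ⟨h1, h2⟩ := norm_one_div_one_add_le hz (hα1 j)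
    have h3 := hγ.norm_colForm_sub_traceRes_le hw0 hw hcard hz hA j
    -- Exhibits each summand as −(1+α_j)⁻² times the quantity bounded in
    -- `norm_colForm_sub_traceRes_le`; this is the source of the factor (|z|/Im z)².
    have e2 : 1 / (1 + α j) * ∫ x, traceRes (Ω j * (T * Ω i)) z x ∂γ -
        ∫ x, colForm (T * Ω i * res z x) x j ∂γ = -(1 / (1 + α j)) ^ 2 *
          ((1 + α j) * ((1 + α j) * ∫ x, colForm (T * Ω i * res z x) x j ∂γ -
            ∫ x, traceRes (Ω j * (T * Ω i)) z x ∂γ)) := by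
      field_simp
      ring
    rw [e2, norm_mul, norm_neg, norm_pow]
    exact mul_le_mul (pow_le_pow_left₀ (norm_nonneg _) h2 2) h3 (norm_nonneg _) (by positivity)
  have hn0 : (0 : ℝ) < Fintype.card ι := by exact_mod_cast Fintype.card_pos
  rw [norm_mul, norm_div, norm_one, Complex.norm_natCast]
  refine (mul_le_mul_of_nonneg_left ((norm_sum_le _ _).trans
    (Finset.sum_le_sum fun j _ => hbd j)) (by positivity)).trans_eq ?_
  rw [Finset.sum_const, Finset.card_univ, nsmul_eq_mul]
  field_simp

end MainEstimate

end CorrelatedGaussian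

namespace CorrelatedGaussian

open scoped unitInterval Topology

/-! ### Stieltjes transforms on a compactification of the half-line. -/

section CompactStieltjes

/-- The Stieltjes kernel `1 / (t - z)` in the coordinate `s = 1 / (1 + t)` on `[0, 1]`. -/
def compactKernel (z : ℂ) (s : I) : ℂ := (s : ℝ) / (1 - (s : ℝ) - z * (s : ℝ))

/-- The Stieltjes transform of a measure on the compactified half-line. -/
def compactStieltjes (μ : Measure I) (z : ℂ) : ℂ := ∫ s, compactKernel z s ∂μ

theorem compactKernel_den_ne_zero {z : ℂ} (hz : ¬ (z.im = 0 ∧ 0 ≤ z.re)) (s : I) :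
    (1 : ℂ) - (s : ℝ) - z * (s : ℝ) ≠ 0 := by
  intro h
  have hre := congrArg Complex.re h
  have him := congrArg Complex.im h
  simp at hre him
  rcases him with him | him
  · have hneg : z.re < 0 := not_le.1 fun h0 => hz ⟨him, h0⟩
    have h1 := s.2.1
    have h2 := s.2.2
    have h3 : z.re * (s : ℝ) ≤ 0 := mul_nonpos_of_nonpos_of_nonneg hneg.le h1
    have h4 : (s : ℝ) = 1 := by linarith
    rw [h4] at hre
    linarith
  · simp [him] at hre

/-- Continuity up to s = 0, the point at infinity, makes the transform weakly continuous in the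
measure even if mass escapes to infinity. -/
theorem continuous_compactKernel {z : ℂ} (hz : ¬ (z.im = 0 ∧ 0 ≤ z.re)) :
    Continuous (compactKernel z) := by
  refine Continuous.div (by fun_prop) (by fun_prop) fun s => compactKernel_den_ne_zero hz s

theorem not_mem_of_im_pos {z : ℂ} (hz : 0 < z.im) : ¬ (z.im = 0 ∧ 0 ≤ z.re) := fun h => hz.ne' h.1

theorem integrable_compactKernel {z : ℂ} (hz : ¬ (z.im = 0 ∧ 0 ≤ z.re)) (μ : Measure I)
    [IsFiniteMeasure μ] : Integrable (compactKernel z) μ := by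
  obtain ⟨C, hC⟩ := isCompact_univ.exists_bound_of_continuousOn
    (continuous_compactKernel hz).continuousOn
  exact Integrable.of_bound (continuous_compactKernel hz).aestronglyMeasurable C
    (ae_of_all _ fun s => hC s (Set.mem_univ s))

theorem continuous_compactStieltjes {z : ℂ} (hz : ¬ (z.im = 0 ∧ 0 ≤ z.re)) :
    Continuous fun μ : FiniteMeasure I => compactStieltjes μ z :=
  continuous_iff_continuousAt.2 fun _ =>
    (FiniteMeasure.tendsto_iff_forall_integral_rclike_tendsto ℂ).1 tendsto_id
      (BoundedContinuousFunction.mkOfCompact ⟨_, continuous_compactKernel hz⟩)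

theorem compactKernel_im (z : ℂ) (s : I) : (compactKernel z s).im =
    z.im * (s : ℝ) ^ 2 / ‖(1 : ℂ) - (s : ℝ) - z * (s : ℝ)‖ ^ 2 := by
  rw [compactKernel, Complex.div_im, Complex.normSq_eq_norm_sq]
  simp
  ring

theorem mul_compactKernel_im (z : ℂ) (s : I) : (z * compactKernel z s).im =
    z.im * ((s : ℝ) * (1 - (s : ℝ))) / ‖(1 : ℂ) - (s : ℝ) - z * (s : ℝ)‖ ^ 2 := by
  rw [compactKernel, ← mul_div_assoc, Complex.div_im, Complex.normSq_eq_norm_sq]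
  simp
  ring

theorem integral_im_nonneg {α : Type*} [MeasurableSpace α] {μ : Measure α} {f : α → ℂ}
    (hf : Integrable f μ) (h : ∀ x, 0 ≤ (f x).im) : 0 ≤ (∫ x, f x ∂μ).im := by
  have h1 : ∫ x, (f x).im ∂μ = (∫ x, f x ∂μ).im := integral_im hf
  rw [← h1]
  exact integral_nonneg h

theorem im_compactStieltjes_nonneg (μ : Measure I) [IsFiniteMeasure μ] {z : ℂ} (hz : 0 < z.im) :
    0 ≤ (compactStieltjes μ z).im ∧ 0 ≤ (z * compactStieltjes μ z).im := by
  have hint := integrable_compactKernel (not_mem_of_im_pos hz) μ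
  refine ⟨integral_im_nonneg hint fun s => ?_, ?_⟩
  · rw [compactKernel_im]
    positivity
  · rw [compactStieltjes, ← integral_const_mul]
    refine integral_im_nonneg (hint.const_mul z) fun s => ?_
    rw [mul_compactKernel_im]
    have := s.2.1
    have := sub_nonneg.2 s.2.2
    positivity

theorem compactStieltjes_conj (μ : Measure I) (z : ℂ) :
    compactStieltjes μ (star z) = star (compactStieltjes μ z) := by
  refine Eq.trans ?_ (integral_conj (𝕜 := ℂ) (μ := μ) (f := compactKernel z))
  refine integral_congr_ae (ae_of_all _ fun s => ?_)
  simp [compactKernel]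

theorem compactStieltjes_ofReal_nonneg (μ : Measure I) {x : ℝ} (hx : x < 0) :
    ∃ r : ℝ, 0 ≤ r ∧ compactStieltjes μ x = r := by
  refine ⟨∫ s : I, (s : ℝ) / (1 - s - x * s) ∂μ, integral_nonneg fun s => ?_, ?_⟩
  · have h0 := s.2.1
    have h1 := s.2.2
    exact div_nonneg h0 (by nlinarith)
  · rw [compactStieltjes, ← integral_complex_ofReal]
    refine integral_congr_ae (ae_of_all _ fun s => ?_)
    simp [compactKernel]

/-- Allows equations valid in the upper half-plane to be carried to the negative axis. The real part
of the denominator is (1−s)·1 + s·(−x), a convex combination, hence at least min(1, −x). -/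
theorem continuous_compactStieltjes_add_mul_I (μ : Measure I) [IsFiniteMeasure μ] {x : ℝ}
    (hx : x < 0) : Continuous fun ε : ℝ => compactStieltjes μ (x + ε * Complex.I) := by
  have hz : ∀ ε : ℝ, ¬ ((x + ε * Complex.I : ℂ).im = 0 ∧ 0 ≤ (x + ε * Complex.I : ℂ).re) :=
    fun ε h => by
      have := h.2
      simp at this
      linarith
  refine continuous_of_dominated (bound := fun _ => 1 / min 1 (-x))
    (fun ε => (continuous_compactKernel (hz ε)).aestronglyMeasurable)
    (fun ε => ae_of_all _ fun s => ?_) (integrable_const _) (ae_of_all _ fun s => ?_)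
  · have h0 := s.2.1
    have h1 := s.2.2
    have hm : 0 < min 1 (-x) := lt_min one_pos (by linarith)
    have h2 : min 1 (-x) ≤ ‖(1 : ℂ) - (s : ℝ) - (x + ε * Complex.I) * (s : ℝ)‖ := by
      refine le_trans ?_ ((le_abs_self _).trans (Complex.abs_re_le_norm _))
      have h3 : ((1 : ℂ) - (s : ℝ) - (x + ε * Complex.I) * (s : ℝ)).re = 1 - s - x * s := by simp
      rw [h3]
      nlinarith [min_le_left 1 (-x), min_le_right 1 (-x)]
    rw [compactKernel, norm_div, Complex.norm_real, Real.norm_of_nonneg h0]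
    exact div_le_div₀ zero_le_one h1 hm h2
  · exact Continuous.div (by fun_prop) (by fun_prop) fun ε => compactKernel_den_ne_zero (hz ε) s

/-- The measure on the half-line corresponding to a measure on its compactification. -/
def halfLineMeasure (μ : Measure I) : Measure ℝ :=
  (μ.restrict {s | s ≠ 0}).map fun s : I => (1 - (s : ℝ)) / s

theorem measurable_halfLine : Measurable fun s : I => (1 - (s : ℝ)) / (s : ℝ) := by fun_prop

theorem halfLineMeasure_Iio (μ : Measure I) : halfLineMeasure μ (Set.Iio 0) = 0 := by
  rw [halfLineMeasure, Measure.map_apply measurable_halfLine measurableSet_Iio]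
  convert measure_empty (μ := μ.restrict {s | s ≠ 0})
  ext s
  simpa using div_nonneg (sub_nonneg.2 s.2.2) s.2.1

theorem stieltjes_halfLineMeasure (μ : Measure I) (z : ℂ) :
    stieltjes (halfLineMeasure μ) z = compactStieltjes μ z := by
  have hm : Measurable fun t : ℝ => ((t : ℂ) - z)⁻¹ := by fun_prop
  rw [stieltjes, halfLineMeasure, integral_map measurable_halfLine.aemeasurable
    hm.aestronglyMeasurable, compactStieltjes]
  -- The kernel vanishes at s = 0, so discarding the mass at infinity does not change the transform.
  have hzero : ∫ s in {s : I | s ≠ 0}, compactKernel z s ∂μ = ∫ s, compactKernel z s ∂μ :=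
    setIntegral_eq_integral_of_forall_compl_eq_zero fun s hs => by
      have : s = 0 := by simpa using hs
      simp [this, compactKernel]
  rw [← hzero]
  refine setIntegral_congr_fun (measurableSet_singleton (0 : I)).compl fun s hs => ?_
  have hs' : ((s : ℝ) : ℂ) ≠ 0 := by
    have : (s : ℝ) ≠ 0 := fun h => hs (Subtype.ext h)
    exact_mod_cast this
  simp only [compactKernel]
  push_cast
  rw [div_sub' hs', inv_div, mul_comm z]

end CompactStieltjes

end CorrelatedGaussian

namespace CorrelatedGaussian

open scoped unitInterval Topology Matrix ComplexOrder Matrix.Norms.L2Operator Kronecker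

/-! ### Spectral measures of positive matrices. -/

section SpectralMeasure

variable {κ : Type*} [Fintype κ] [DecidableEq κ]

/-- `tr (B (A - z)⁻¹)` is a Stieltjes transform. -/
theorem exists_compactStieltjes_eq_trace {A B : Matrix κ κ ℂ} (hA : A.PosSemidef)
    (hB : B.PosSemidef) : ∃ μ : FiniteMeasure I, (μ.mass : ℝ) = B.trace.re ∧
      ∀ z : ℂ, 0 < z.im → compactStieltjes μ z = (B * (A - z • (1 : Matrix κ κ ℂ))⁻¹).trace := by
  set U : Matrix κ κ ℂ := (hA.isHermitian.eigenvectorUnitary : Matrix κ κ ℂ) with hU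
  set e := hA.isHermitian.eigenvalues with he
  have hUU : U * Uᴴ = 1 := Matrix.mem_unitaryGroup_iff.1 hA.isHermitian.eigenvectorUnitary.2
  have hUU' : Uᴴ * U = 1 := Matrix.mem_unitaryGroup_iff'.1 hA.isHermitian.eigenvectorUnitary.2
  have he0 : ∀ k, 0 ≤ e k := hA.eigenvalues_nonneg
  have hspec : A = U * Matrix.diagonal (fun k => (e k : ℂ)) * Uᴴ :=
    hA.isHermitian.spectral_theorem
  have hB' : (Uᴴ * B * U).PosSemidef := hB.conjTranspose_mul_mul_same U
  have hw : ∀ k, 0 ≤ ((Uᴴ * B * U) k k).re ∧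
      (Uᴴ * B * U) k k = (((Uᴴ * B * U) k k).re : ℂ) := fun k => by
    have h := Complex.le_def.1 (hB'.diag_nonneg (i := k))
    exact ⟨h.1, Complex.ext rfl (by simpa using h.2.symm)⟩
  have hs : ∀ k, 1 / (1 + e k) ∈ I := fun k =>
    ⟨by have := he0 k; positivity,
      by rw [div_le_one (by linarith [he0 k])]; linarith [he0 k]⟩
  -- In an eigenbasis of A, the eigenvalue e_k becomes the point 1/(1+e_k) of [0,1] and carries the
  -- k-th diagonal entry of B as its mass.
  let ν : Measure I := Measure.sum fun k =>
    ENNReal.ofReal ((Uᴴ * B * U) k k).re • Measure.dirac (⟨_, hs k⟩ : I)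
  have hν : ν Set.univ = ENNReal.ofReal B.trace.re := by
    have h1 : B.trace = ∑ k, (((Uᴴ * B * U) k k).re : ℂ) := by
      rw [← Finset.sum_congr rfl fun k _ => (hw k).2]
      change _ = (Uᴴ * B * U).trace
      rw [Matrix.trace_mul_comm, ← Matrix.mul_assoc, hUU, Matrix.one_mul]
    have h2 : B.trace.re = ∑ k, ((Uᴴ * B * U) k k).re := by
      rw [h1, Complex.re_sum]
      exact Finset.sum_congr rfl fun k _ => Complex.ofReal_re _
    rw [h2, ENNReal.ofReal_sum_of_nonneg fun k _ => (hw k).1, Measure.sum_apply _ MeasurableSet.univ,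
      tsum_fintype]
    refine Finset.sum_congr rfl fun k _ => ?_
    rw [Measure.smul_apply, measure_univ, smul_eq_mul, mul_one]
  have hB0 : 0 ≤ B.trace.re := (Complex.le_def.1 hB.trace_nonneg).1
  have : IsFiniteMeasure ν := ⟨by rw [hν]; exact ENNReal.ofReal_lt_top⟩
  refine ⟨⟨ν, this⟩, ?_, fun z hz => ?_⟩
  · change ((ν Set.univ).toNNReal : ℝ) = _
    rw [hν]
    exact ENNReal.toReal_ofReal hB0
  · have hne : ∀ k, (e k : ℂ) - z ≠ 0 := fun k h => by
      have := congrArg Complex.im h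
      simp at this
      exact hz.ne' this
    have hinv : (A - z • (1 : Matrix κ κ ℂ))⁻¹ =
        U * Matrix.diagonal (fun k => ((e k : ℂ) - z)⁻¹) * Uᴴ := by
      refine Matrix.inv_eq_right_inv ?_
      have h1 : A - z • (1 : Matrix κ κ ℂ) =
          U * Matrix.diagonal (fun k => (e k : ℂ) - z) * Uᴴ := by
        have h2 : Matrix.diagonal (fun k => (e k : ℂ) - z) =
            Matrix.diagonal (fun k => (e k : ℂ)) - z • (1 : Matrix κ κ ℂ) := by
          rw [← Matrix.diagonal_one, ← Matrix.diagonal_smul, Matrix.diagonal_sub]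
          simp
        rw [h2, Matrix.mul_sub, Matrix.sub_mul, ← hspec, Matrix.mul_smul, Matrix.smul_mul,
          Matrix.mul_one, hUU]
      calc (A - z • (1 : Matrix κ κ ℂ)) * (U * Matrix.diagonal (fun k => ((e k : ℂ) - z)⁻¹) * Uᴴ)
          = U * Matrix.diagonal (fun k => (e k : ℂ) - z) * (Uᴴ * U) *
              Matrix.diagonal (fun k => ((e k : ℂ) - z)⁻¹) * Uᴴ := by
            rw [h1]; simp only [Matrix.mul_assoc]
        _ = 1 := by
            rw [hUU', Matrix.mul_one, Matrix.mul_assoc U, Matrix.diagonal_mul_diagonal]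
            simp [mul_inv_cancel₀ (hne _), hUU]
    have htr : (B * (A - z • (1 : Matrix κ κ ℂ))⁻¹).trace =
        ∑ k, (Uᴴ * B * U) k k * ((e k : ℂ) - z)⁻¹ := by
      rw [hinv, ← Matrix.mul_assoc, Matrix.trace_mul_comm, ← Matrix.mul_assoc, ← Matrix.mul_assoc,
        Matrix.trace]
      simp [Matrix.mul_diagonal]
    have hk := integrable_compactKernel (not_mem_of_im_pos hz) ν
    change ∫ s, compactKernel z s ∂ν = _
    rw [integral_sum_measure hk, tsum_fintype, htr]
    refine Finset.sum_congr rfl fun k _ => ?_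
    rw [integral_smul_measure, integral_dirac, ENNReal.toReal_ofReal (hw k).1, (hw k).2,
      Complex.ofReal_re, Complex.real_smul]
    congr 1
    have h1 : (1 : ℂ) + e k ≠ 0 := by
      have : 1 + e k ≠ 0 := by linarith [he0 k]
      exact_mod_cast this
    simp only [compactKernel]
    push_cast
    rw [← one_div ((e k : ℂ) - z)]
    have h2 := hne k
    have h3 : (1 : ℂ) - 1 / (1 + e k) - z * (1 / (1 + e k)) = (e k - z) / (1 + e k) := by
      field_simp
      ring
    rw [h3]
    field_simp

end SpectralMeasure

/-! ### Enlarging the model by a tensor factor leaves the deterministic system unchanged. -/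

section Enlargement

variable {ι κ l m : Type*} [Fintype ι] [Fintype κ] [Fintype l] [Fintype m] [DecidableEq ι]
  [DecidableEq κ] [DecidableEq l] [DecidableEq m]

theorem kronecker_one_mul_conjTranspose (A : Matrix κ l ℂ) :
    (A ⊗ₖ (1 : Matrix m m ℂ)) * (A ⊗ₖ (1 : Matrix m m ℂ))ᴴ = (A * Aᴴ) ⊗ₖ (1 : Matrix m m ℂ) := by
  rw [Matrix.conjTranspose_kronecker, ← Matrix.mul_kronecker_mul, Matrix.conjTranspose_one,
    Matrix.mul_one]

theorem opNorm_kronecker_one_le (A : Matrix κ κ ℂ) : ‖A ⊗ₖ (1 : Matrix m m ℂ)‖ ≤ ‖A‖ := by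
  refine opNorm_le_of_vnorm_le _ (norm_nonneg _) fun v => ?_
  refine abs_le_of_sq_le_sq' ?_ (by have := vnorm_nonneg v; positivity) |>.2
  have h1 : ∀ u : κ × m → ℂ, vnorm u ^ 2 = ∑ b, vnorm (fun a => u (a, b)) ^ 2 := fun u => by
    simp only [vnorm_sq]
    rw [Fintype.sum_prod_type_right]
  rw [mul_pow, h1, h1 v, Finset.mul_sum]
  refine Finset.sum_le_sum fun b _ => ?_
  have h2 : (fun a => ((A ⊗ₖ (1 : Matrix m m ℂ)) *ᵥ v) (a, b)) = A *ᵥ fun a => v (a, b) := by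
    funext a
    simp [Matrix.mulVec, dotProduct, Fintype.sum_prod_type, Matrix.one_apply]
  rw [h2, ← mul_pow]
  exact pow_le_pow_left₀ (vnorm_nonneg _) (vnorm_mulVec_le _ _) 2

/-- Each index occurs once for every element of `m`, which cancels the extra factor in the
normalization 1/card(ι × m). The enlarged system thus has the same solutions in higher dimension. -/
theorem detPencil_kronecker_one [Nonempty m] (Ω : ι → Matrix κ κ ℂ) (d : ι → ℂ) (z : ℂ) :
    detPencil (fun p : ι × m => Ω p.1 ⊗ₖ (1 : Matrix m m ℂ)) (fun p => d p.1) z =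
      detPencil Ω d z ⊗ₖ (1 : Matrix m m ℂ) := by
  have hm : (Fintype.card m : ℂ) ≠ 0 := by simp
  have h1 : ∑ p : ι × m, (1 / (1 + d p.1)) • (Ω p.1 ⊗ₖ (1 : Matrix m m ℂ)) =
      (Fintype.card m : ℂ) • ((∑ i, (1 / (1 + d i)) • Ω i) ⊗ₖ (1 : Matrix m m ℂ)) := by
    rw [Fintype.sum_prod_type]
    simp only [Finset.sum_const, Finset.card_univ, ← Nat.cast_smul_eq_nsmul ℂ]
    rw [← Finset.smul_sum]
    congr 1
    ext a b
    simp [Matrix.sum_apply, Finset.sum_mul, mul_assoc]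
  have h2 : (1 : Matrix (κ × m) (κ × m) ℂ) = (1 : Matrix κ κ ℂ) ⊗ₖ (1 : Matrix m m ℂ) :=
    Matrix.one_kronecker_one.symm
  rw [detPencil, h1, h2, smul_smul, Fintype.card_prod, detPencil, sub_eq_add_neg, sub_eq_add_neg,
    Matrix.add_kronecker, Matrix.smul_kronecker, ← neg_smul, ← neg_smul, Matrix.smul_kronecker]
  congr 2
  push_cast
  field_simp

theorem trace_kronecker_one_detPencil_inv [Nonempty m] (Ω : ι → Matrix κ κ ℂ) (d : ι → ℂ) (z : ℂ)
    (B : Matrix κ κ ℂ) :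
    (1 / (Fintype.card (ι × m) : ℂ)) * (B ⊗ₖ (1 : Matrix m m ℂ) *
      (detPencil (fun p : ι × m => Ω p.1 ⊗ₖ (1 : Matrix m m ℂ)) (fun p => d p.1) z)⁻¹).trace =
      (1 / (Fintype.card ι : ℂ)) * (B * (detPencil Ω d z)⁻¹).trace := by
  have hm : (Fintype.card m : ℂ) ≠ 0 := by simp
  rw [detPencil_kronecker_one, Matrix.inv_kronecker, ← Matrix.mul_kronecker_mul,
    Matrix.trace_kronecker, inv_one, Matrix.mul_one, Matrix.trace_one, Fintype.card_prod]
  push_cast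
  field_simp

end Enlargement

/-! ### Lipschitz dependence of the system on its unknowns. -/

section Lipschitz

variable {ι κ : Type*} [Fintype ι] [Fintype κ] [DecidableEq κ] {Ω : ι → Matrix κ κ ℂ} {z : ℂ}
  {a d : ι → ℂ} {w ε : ℝ}

theorem norm_detPencil_sub_le [Nonempty ι] (hw : ∀ i, ‖Ω i‖ ≤ w) (hz : 0 < z.im)
    (ha : ∀ i, 0 ≤ (z * a i).im) (hd : ∀ i, 0 ≤ (z * d i).im) (hε : ∀ i, ‖a i - d i‖ ≤ ε) :
    ‖detPencil Ω d z - detPencil Ω a z‖ ≤ (‖z‖ / z.im) ^ 2 * ε * w := by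
  have hc : (0 : ℝ) < Fintype.card ι := by exact_mod_cast Fintype.card_pos
  have h1 : detPencil Ω d z - detPencil Ω a z = (1 / (Fintype.card ι : ℂ)) •
      ∑ i, ((1 / (1 + a i)) * (1 / (1 + d i)) * (a i - d i)) • Ω i := by
    rw [detPencil, detPencil, sub_sub_sub_cancel_right, ← smul_sub, ← Finset.sum_sub_distrib]
    congr 1
    refine Finset.sum_congr rfl fun i _ => ?_
    rw [← sub_smul]
    congr 1
    have h2 := (norm_one_div_one_add_le hz (ha i)).1
    have h3 := (norm_one_div_one_add_le hz (hd i)).1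
    field_simp
    ring
  have h2 : ‖∑ i, ((1 / (1 + a i)) * (1 / (1 + d i)) * (a i - d i)) • Ω i‖ ≤
      Fintype.card ι * ((‖z‖ / z.im) ^ 2 * ε * w) := by
    refine (norm_sum_le _ _).trans ((Finset.sum_le_sum
      (g := fun _ => (‖z‖ / z.im) ^ 2 * ε * w) fun i _ => ?_).trans (by simp))
    rw [norm_smul, norm_mul, norm_mul, sq]
    have h4 := (norm_one_div_one_add_le hz (ha i)).2
    have h5 := (norm_one_div_one_add_le hz (hd i)).2
    have h6 := hε i
    have h7 := hw i
    have : 0 ≤ ε := (norm_nonneg _).trans h6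
    gcongr
  rw [h1, norm_smul, norm_div, norm_one, Complex.norm_natCast, one_div, inv_mul_le_iff₀ hc]
  exact h2

theorem norm_trace_detPencil_inv_sub_le [Nonempty ι] (hΩ : ∀ i, (Ω i).PosSemidef)
    (hw : ∀ i, ‖Ω i‖ ≤ w) (hcard : Fintype.card κ ≤ Fintype.card ι) (hz : 0 < z.im)
    (ha0 : ∀ i, 0 ≤ (a i).im) (hd0 : ∀ i, 0 ≤ (d i).im)
    (ha : ∀ i, 0 ≤ (z * a i).im) (hd : ∀ i, 0 ≤ (z * d i).im) (hε : ∀ i, ‖a i - d i‖ ≤ ε) (i : ι) :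
    ‖(1 / (Fintype.card ι : ℂ)) * (Ω i * (detPencil Ω a z)⁻¹).trace -
      (1 / (Fintype.card ι : ℂ)) * (Ω i * (detPencil Ω d z)⁻¹).trace‖ ≤
      w * (1 / z.im * ((‖z‖ / z.im) ^ 2 * ε * w) * (1 / z.im)) := by
  have hc : (0 : ℝ) < Fintype.card ι := by exact_mod_cast Fintype.card_pos
  have hw0 : 0 ≤ w := (norm_nonneg _).trans (hw i)
  have hε0 : 0 ≤ ε := (norm_nonneg _).trans (hε i)
  have hA := isUnit_detPencil hΩ hz ha0
  have hD := isUnit_detPencil hΩ hz hd0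
  have h1 : (detPencil Ω a z)⁻¹ - (detPencil Ω d z)⁻¹ =
      (detPencil Ω a z)⁻¹ * (detPencil Ω d z - detPencil Ω a z) * (detPencil Ω d z)⁻¹ := by
    rw [Matrix.mul_sub, Matrix.sub_mul, Matrix.mul_assoc,
      Matrix.mul_nonsing_inv _ ((Matrix.isUnit_iff_isUnit_det _).1 hD.1),
      Matrix.nonsing_inv_mul _ ((Matrix.isUnit_iff_isUnit_det _).1 hA.1), Matrix.mul_one,
      Matrix.one_mul]
  rw [← mul_sub, ← Matrix.trace_sub, ← Matrix.mul_sub, h1, norm_mul, norm_div, norm_one,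
    Complex.norm_natCast, one_div, inv_mul_le_iff₀ hc]
  have h2 : ‖Ω i * ((detPencil Ω a z)⁻¹ * (detPencil Ω d z - detPencil Ω a z) *
      (detPencil Ω d z)⁻¹)‖ ≤ w * (1 / z.im * ((‖z‖ / z.im) ^ 2 * ε * w) * (1 / z.im)) := by
    refine (norm_mul_le _ _).trans (mul_le_mul (hw i) ?_ (norm_nonneg _) hw0)
    refine (norm_mul_le _ _).trans (mul_le_mul ?_ hD.2 (norm_nonneg _) (by positivity))
    exact (norm_mul_le _ _).trans (mul_le_mul hA.2 (norm_detPencil_sub_le hw hz ha hd hε)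
      (norm_nonneg _) (by positivity))
  refine (norm_trace_le _).trans (mul_le_mul ?_ h2 (norm_nonneg _) hc.le)
  exact_mod_cast hcard

end Lipschitz

end CorrelatedGaussian

namespace CorrelatedGaussian

open scoped unitInterval Topology Matrix ComplexOrder Matrix.Norms.L2Operator Kronecker

/-! ### Approximate solutions from typical realizations. -/

section ApproximateSolutions

variable {ι κ l β : Type*} [Fintype ι] [Fintype κ] [Fintype l] [DecidableEq ι]
  [DecidableEq κ] [DecidableEq l]

/-- Chebyshev's argument: some x makes the sum of all squared deviations, each divided by its
tolerance squared, at most its mean, hence at most 1. All finitely many traces are then close to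
their means simultaneously. -/
theorem IsCircularLaw.exists_traceRes_near [Nonempty ι] {γ : Measure (ι → κ → ℂ)}
    {Ω : ι → Matrix κ κ ℂ} (hγ : IsCircularLaw γ Ω) {w : ℝ} (hw : ∀ i, ‖Ω i‖ ≤ w)
    (hcard : Fintype.card κ ≤ Fintype.card ι) {ι' : Type*} [Fintype ι'] {B : ι' → Matrix κ κ ℂ}
    {c : ℝ} (hB : ∀ i, ‖B i‖ ≤ c) (u : Finset β) {z : β → ℂ} {τ : β → ℝ}
    (hz : ∀ b, 0 < (z b).im) (hτ : ∀ b, 0 < τ b)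
    (hsum : ∑ b ∈ u, ∑ _i : ι',
      1 / τ b ^ 2 * (2 * (c ^ 2 * gradBound w (z b) (Fintype.card ι))) ≤ 1) :
    ∃ x : ι → κ → ℂ, ∀ b ∈ u, ∀ i, ‖traceRes (B i) (z b) x - ∫ x', traceRes (B i) (z b) x' ∂γ‖ ≤ τ b := by
  have := hγ.gaussian
  have hint : ∀ b i, Integrable (fun x => 1 / τ b ^ 2 *
      ‖traceRes (B i) (z b) x - ∫ x', traceRes (B i) (z b) x' ∂γ‖ ^ 2) γ := fun b i =>
    (((polyBdd_traceRes (B i) (hz b)).sub (PolyBdd.const _)).integrable_norm_sq γ).const_mul _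
  have hint' : ∀ b, Integrable (fun x => ∑ i, 1 / τ b ^ 2 *
      ‖traceRes (B i) (z b) x - ∫ x', traceRes (B i) (z b) x' ∂γ‖ ^ 2) γ := fun b =>
    integrable_finsetSum _ fun i _ => hint b i
  obtain ⟨x, hx⟩ := exists_le_integral (integrable_finsetSum u fun b _ => hint' b)
  refine ⟨x, fun b hb i => ?_⟩
  have h1 : ∑ b ∈ u, ∑ i, 1 / τ b ^ 2 *
      ‖traceRes (B i) (z b) x - ∫ x', traceRes (B i) (z b) x' ∂γ‖ ^ 2 ≤ 1 := by
    refine hx.trans (le_trans ?_ hsum)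
    rw [integral_finsetSum _ fun b _ => hint' b]
    refine Finset.sum_le_sum fun b _ => ?_
    rw [integral_finsetSum _ fun i _ => hint b i]
    refine Finset.sum_le_sum fun i _ => ?_
    rw [integral_const_mul]
    exact mul_le_mul_of_nonneg_left (hγ.variance_traceRes_le _ hw hcard (hz b) (hB i))
      (by positivity)
  have h2 : 1 / τ b ^ 2 * ‖traceRes (B i) (z b) x - ∫ x', traceRes (B i) (z b) x' ∂γ‖ ^ 2 ≤ 1 := by
    refine le_trans ?_ h1
    refine le_trans ?_ (Finset.single_le_sum (f := fun b => ∑ i, 1 / τ b ^ 2 *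
      ‖traceRes (B i) (z b) x - ∫ x', traceRes (B i) (z b) x' ∂γ‖ ^ 2)
      (fun b _ => Finset.sum_nonneg fun i _ => by positivity) hb)
    exact Finset.single_le_sum (f := fun i => 1 / τ b ^ 2 *
      ‖traceRes (B i) (z b) x - ∫ x', traceRes (B i) (z b) x' ∂γ‖ ^ 2)
      (fun i _ => by positivity) (Finset.mem_univ i)
  rw [one_div, inv_mul_le_iff₀ (by have := hτ b; positivity), mul_one] at h2
  exact abs_le_of_sq_le_sq' h2 (hτ b).le |>.2

theorem exists_compactStieltjes_eq_traceRes {B : Matrix κ κ ℂ} (hB : B.PosSemidef) {w : ℝ}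
    (hw : ‖B‖ ≤ w) (hcard : Fintype.card κ ≤ Fintype.card ι) (x : ι → κ → ℂ) :
    ∃ μ : FiniteMeasure I, (μ.mass : ℝ) ≤ w ∧
      ∀ z : ℂ, 0 < z.im → compactStieltjes μ z = traceRes B z x := by
  have hc : (1 / (Fintype.card ι : ℂ)) = ((1 / (Fintype.card ι : ℝ) : ℝ) : ℂ) := by push_cast; rfl
  have hB' : ((1 / (Fintype.card ι : ℂ)) • B).PosSemidef := hB.smul (by
    rw [hc]
    exact_mod_cast (by positivity : (0 : ℝ) ≤ 1 / (Fintype.card ι : ℝ)))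
  obtain ⟨μ, hμ, h⟩ := exists_compactStieltjes_eq_trace (gram_posSemidef x) hB'
  refine ⟨μ, ?_, fun z hz => ?_⟩
  · rw [hμ, Matrix.trace_smul, smul_eq_mul, hc, Complex.re_ofReal_mul]
    have h1 : B.trace.re ≤ Fintype.card κ * w :=
      (Complex.re_le_norm _).trans ((norm_trace_le B).trans
        (mul_le_mul_of_nonneg_left hw (Nat.cast_nonneg _)))
    have h2 : (Fintype.card κ : ℝ) ≤ Fintype.card ι := by exact_mod_cast hcard
    have hw0 : 0 ≤ w := (norm_nonneg _).trans hw
    rcases (Nat.cast_nonneg (α := ℝ) (Fintype.card ι)).eq_or_lt with h0 | h0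
    · rw [← h0]; simpa using hw0
    · rw [one_div, inv_mul_le_iff₀ h0]
      exact h1.trans (mul_le_mul_of_nonneg_right h2 hw0)
  · rw [h z hz, Matrix.smul_mul, Matrix.trace_smul, smul_eq_mul]
    rfl

/-- The system has approximate solutions among Stieltjes transforms, given by the spectral measures
of a typical realization of the model with covariances `Ω_i ⊗ 1`. -/
theorem exists_approx_solution [Nonempty ι] (Θ : ι → Matrix κ l ℂ) {w : ℝ} (hw0 : 0 < w)
    (hw : ∀ i, ‖Θ i * (Θ i)ᴴ‖ ≤ w) (hcard : Fintype.card κ ≤ Fintype.card ι)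
    (u : Finset β) {z : β → ℂ} {ε : β → ℝ} (hz : ∀ b, 0 < (z b).im) (hε : ∀ b, 0 < ε b) :
    ∃ μ : ι → FiniteMeasure I, (∀ i, ((μ i).mass : ℝ) ≤ w) ∧ ∀ b ∈ u, ∀ i,
      ‖compactStieltjes (μ i) (z b) - (1 / (Fintype.card ι : ℂ)) * (Θ i * (Θ i)ᴴ *
        (detPencil (fun j => Θ j * (Θ j)ᴴ) (fun j => compactStieltjes (μ j) (z b))
          (z b))⁻¹).trace‖ ≤ ε b := by
  set Ω : ι → Matrix κ κ ℂ := fun j => Θ j * (Θ j)ᴴ with hΩdef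
  have hΩ : ∀ i, (Ω i).PosSemidef := fun i => Matrix.posSemidef_self_mul_conjTranspose _
  -- L is the Lipschitz constant of the right side of the system. The tolerance τ satisfies τ + Lτ =
  -- ε/2; the other ε/2 is left for the error of the means.
  let L : β → ℝ := fun b => w * (1 / (z b).im * ((‖z b‖ / (z b).im) ^ 2 * w) * (1 / (z b).im))
  have hL : ∀ b, 0 ≤ L b := fun b => by have := hz b; positivity
  let τ : β → ℝ := fun b => ε b / 2 / (1 + L b)
  have hτ : ∀ b, 0 < τ b := fun b => by
    have := hL b
    have := hε b
    positivity
  have hcι : (0 : ℝ) < Fintype.card ι := by exact_mod_cast Fintype.card_pos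
  have hlim : Tendsto (fun m : ℕ => ((Fintype.card (ι × Fin (m + 1)) : ℝ)) ^ 2) atTop atTop := by
    refine (tendsto_pow_atTop two_ne_zero).comp ?_
    simp only [Fintype.card_prod, Fintype.card_fin, Nat.cast_mul]
    refine Tendsto.const_mul_atTop hcι ?_
    exact tendsto_natCast_atTop_atTop.comp (tendsto_add_atTop_nat 1)
  have hev1 : ∀ᶠ m : ℕ in atTop, ∀ b ∈ u, (‖z b‖ / (z b).im) ^ 2 * errorConst w (z b) /
      (Fintype.card (ι × Fin (m + 1)) : ℝ) ^ 2 ≤ ε b / 2 := by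
    refine (Filter.eventually_all_finset u).2 fun b _ => ?_
    exact (hlim.const_div_atTop _).eventually_le_const (half_pos (hε b))
  have hev2 : ∀ᶠ m : ℕ in atTop, ∑ b ∈ u, ∑ _i : ι,
      1 / τ b ^ 2 * (2 * (w ^ 2 * gradBound w (z b) (Fintype.card (ι × Fin (m + 1))))) ≤ 1 := by
    have h0 : Tendsto (fun m : ℕ => ∑ b ∈ u, ∑ _i : ι,
        1 / τ b ^ 2 * (2 * (w ^ 2 * gradBound w (z b) (Fintype.card (ι × Fin (m + 1)))))) atTop
        (𝓝 (∑ b ∈ u, ∑ _i : ι, 1 / τ b ^ 2 * (2 * (w ^ 2 * 0)))) := by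
      refine tendsto_finsetSum _ fun b _ => tendsto_finsetSum _ fun i _ => ?_
      refine Tendsto.const_mul _ (Tendsto.const_mul _ (Tendsto.const_mul _ ?_))
      refine Tendsto.const_div_atTop (Tendsto.const_mul_atTop ?_ hlim) _
      have := hz b
      positivity
    simp only [mul_zero, Finset.sum_const_zero] at h0
    exact h0.eventually_le_const one_pos
  -- The tensor factor has dimension m + 1, hence is never empty. One m serves all the points of the
  -- finite set `u`.
  obtain ⟨m, hm1, hm2⟩ := (hev1.and hev2).exists
  have hγ := isCircularLaw_pi fun p : ι × Fin (m + 1) =>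
    Θ p.1 ⊗ₖ (1 : Matrix (Fin (m + 1)) (Fin (m + 1)) ℂ)
  simp only [kronecker_one_mul_conjTranspose] at hγ
  set γ := Measure.pi fun p : ι × Fin (m + 1) =>
    gaussianLaw (Θ p.1 ⊗ₖ (1 : Matrix (Fin (m + 1)) (Fin (m + 1)) ℂ)) with hγdef
  let Ω' : ι → Matrix (κ × Fin (m + 1)) (κ × Fin (m + 1)) ℂ := fun i => Ω i ⊗ₖ 1
  have hΩ' : ∀ i, (Ω' i).PosSemidef := fun i => by
    change ((Θ i * (Θ i)ᴴ) ⊗ₖ (1 : Matrix (Fin (m + 1)) (Fin (m + 1)) ℂ)).PosSemidef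
    rw [← kronecker_one_mul_conjTranspose]
    exact Matrix.posSemidef_self_mul_conjTranspose _
  have hw' : ∀ i, ‖Ω' i‖ ≤ w := fun i => (opNorm_kronecker_one_le _).trans (hw i)
  have hcard' : Fintype.card (κ × Fin (m + 1)) ≤ Fintype.card (ι × Fin (m + 1)) := by
    rw [Fintype.card_prod, Fintype.card_prod]
    exact Nat.mul_le_mul_right _ hcard
  have := hγ.gaussian
  obtain ⟨x, hx⟩ := hγ.exists_traceRes_near (fun p => hw' p.1) hcard' hw' u hz hτ hm2
  choose μ hμ1 hμ2 using fun i => exists_compactStieltjes_eq_traceRes (hΩ' i) (hw' i) hcard' x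
  refine ⟨μ, hμ1, fun b hb i => ?_⟩
  simp only [hμ2 _ _ (hz b)]
  set α : ι → ℂ := fun j => ∫ x', traceRes (Ω' j) (z b) x' ∂γ with hα
  have h1 : ‖α i - (1 / (Fintype.card ι : ℂ)) * (Ω i * (detPencil Ω α (z b))⁻¹).trace‖ ≤
      ε b / 2 := by
    have h := hγ.norm_integral_traceRes_sub_le (fun p => hΩ' p.1) hw0 (fun p => hw' p.1) hcard'
      (hz b) (i, 0)
    refine le_trans (le_of_eq ?_) (h.trans (hm1 b hb))
    rw [← trace_kronecker_one_detPencil_inv (m := Fin (m + 1)) Ω α (z b) (Ω i)]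
  have ha := fun j => im_traceRes_nonneg (hΩ' j) (hz b) x
  have hd := fun j => im_integral_traceRes_nonneg (γ := γ) (hΩ' j) (hz b)
  have h2 := norm_trace_detPencil_inv_sub_le hΩ hw hcard (hz b) (fun j => (ha j).1)
    (fun j => (hd j).1) (fun j => (ha j).2) (fun j => (hd j).2) (hx b hb) i
  have h3 := hx b hb i
  have h4 : τ b + L b * τ b = ε b / 2 := by
    have : 1 + L b ≠ 0 := by linarith [hL b]
    simp only [τ]
    field_simp
  have h5 : w * (1 / (z b).im * ((‖z b‖ / (z b).im) ^ 2 * τ b * w) * (1 / (z b).im)) =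
      L b * τ b := by
    simp only [L]
    ring
  rw [h5] at h2
  have h6 := norm_add₃_le (a := traceRes (Ω' i) (z b) x - α i)
    (b := α i - (1 / (Fintype.card ι : ℂ)) * (Ω i * (detPencil Ω α (z b))⁻¹).trace)
    (c := -((1 / (Fintype.card ι : ℂ)) * (Ω i * (detPencil Ω
      (fun j => traceRes (Ω' j) (z b) x) (z b))⁻¹).trace -
      (1 / (Fintype.card ι : ℂ)) * (Ω i * (detPencil Ω α (z b))⁻¹).trace))
  rw [norm_neg] at h6
  refine (le_of_eq ?_).trans (h6.trans ((add_le_add (add_le_add h3 h1) h2).trans (by linarith)))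
  congr 1
  ring

end ApproximateSolutions

end CorrelatedGaussian

namespace CorrelatedGaussian

open scoped unitInterval Topology Matrix ComplexOrder Matrix.Norms.L2Operator

/-! ### Existence of an exact solution and the properties of δ. -/

section Existence

variable {ι κ l : Type*} [Fintype ι] [Fintype κ] [Fintype l] [DecidableEq ι]
  [DecidableEq κ] [DecidableEq l] {Ω : ι → Matrix κ κ ℂ}

theorem tendsto_trace_mul_detPencil_inv {α : Type*} {f : Filter α} {d : α → ι → ℂ} {z : α → ℂ}
    {d₀ : ι → ℂ} {z₀ : ℂ} (hd : ∀ i, Tendsto (fun a => d a i) f (𝓝 (d₀ i)))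
    (hz : Tendsto z f (𝓝 z₀)) (h1 : ∀ i, 1 + d₀ i ≠ 0) (hu : IsUnit (detPencil Ω d₀ z₀))
    (B : Matrix κ κ ℂ) : Tendsto (fun a => (B * (detPencil Ω (d a) (z a))⁻¹).trace) f
      (𝓝 (B * (detPencil Ω d₀ z₀)⁻¹).trace) := by
  have h2 : Tendsto (fun a => detPencil Ω (d a) (z a)) f (𝓝 (detPencil Ω d₀ z₀)) := by
    refine Tendsto.sub (Tendsto.const_smul (tendsto_finsetSum _ fun i _ => ?_) _)
      (hz.smul tendsto_const_nhds)
    exact (tendsto_const_nhds.div (tendsto_const_nhds.add (hd i)) (h1 i)).smul tendsto_const_nhds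
  have h3 : Tendsto (fun a => (detPencil Ω (d a) (z a))⁻¹) f (𝓝 (detPencil Ω d₀ z₀)⁻¹) := by
    obtain ⟨v, hv⟩ := hu
    have h4 := NormedRing.inverse_continuousAt v
    rw [ContinuousAt, hv] at h4
    simp only [Matrix.nonsing_inv_eq_ringInverse]
    exact h4.comp h2
  exact ((continuous_const.mul continuous_id).matrix_trace.tendsto _).comp h3

/-- The system of equations at the point `z`. -/
def SolvesAt (Ω : ι → Matrix κ κ ℂ) (μ : ι → FiniteMeasure I) (z : ℂ) : Prop :=
  ∀ i, compactStieltjes (μ i) z = (1 / (Fintype.card ι : ℂ)) *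
    (Ω i * (detPencil Ω (fun j => compactStieltjes (μ j) z) z)⁻¹).trace

theorem continuous_trace_mul_detPencil_inv (hΩ : ∀ i, (Ω i).PosSemidef) {z : ℂ} (hz : 0 < z.im)
    (B : Matrix κ κ ℂ) : Continuous fun μ : ι → FiniteMeasure I =>
      (B * (detPencil Ω (fun j => compactStieltjes (μ j) z) z)⁻¹).trace := by
  have him := fun (μ : ι → FiniteMeasure I) j => im_compactStieltjes_nonneg (μ j : Measure I) hz
  refine continuous_iff_continuousAt.2 fun μ => tendsto_trace_mul_detPencil_inv (fun i => ?_)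
    tendsto_const_nhds (fun i => (norm_one_div_one_add_le hz (him μ i).2).1)
    (isUnit_detPencil hΩ hz fun i => (him μ i).1).1 B
  exact ((continuous_compactStieltjes (not_mem_of_im_pos hz)).comp (continuous_apply i)).tendsto μ

theorem exists_solvesAt_of_im_pos [Nonempty ι] (Θ : ι → Matrix κ l ℂ) {w : ℝ} (hw0 : 0 < w)
    (hw : ∀ i, ‖Θ i * (Θ i)ᴴ‖ ≤ w) (hcard : Fintype.card κ ≤ Fintype.card ι) :
    ∃ μ : ι → FiniteMeasure I, ∀ z : ℂ, 0 < z.im → SolvesAt (fun i => Θ i * (Θ i)ᴴ) μ z := by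
  set Ω : ι → Matrix κ κ ℂ := fun j => Θ j * (Θ j)ᴴ with hΩdef
  have hΩ : ∀ i, (Ω i).PosSemidef := fun i => Matrix.posSemidef_self_mul_conjTranspose _
  let D (μ : ι → FiniteMeasure I) (z : ℂ) (i : ι) : ℂ := compactStieltjes (μ i) z -
    (1 / (Fintype.card ι : ℂ)) *
      (Ω i * (detPencil Ω (fun j => compactStieltjes (μ j) z) z)⁻¹).trace
  -- One closed condition for each point z and each tolerance ε. Finitely many are jointly
  -- satisfiable by approximate solutions of mass at most w, so compactness yields measures that
  -- satisfy them all.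
  let β := {p : ℂ × ℝ // 0 < p.1.im ∧ 0 < p.2}
  let t : β → Set (ι → FiniteMeasure I) := fun b => {μ | ∀ i, ‖D μ b.1.1 i‖ ≤ b.1.2}
  have hcont : ∀ z : ℂ, 0 < z.im → ∀ i, Continuous fun μ => D μ z i := fun z hz i =>
    ((continuous_compactStieltjes (not_mem_of_im_pos hz)).comp (continuous_apply i)).sub
      (continuous_const.mul (continuous_trace_mul_detPencil_inv hΩ hz (Ω i)))
  have hclosed : ∀ b, IsClosed (t b) := fun b => by
    have : t b = ⋂ i, {μ | ‖D μ b.1.1 i‖ ≤ b.1.2} := by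
      ext μ
      simp [t]
    rw [this]
    exact isClosed_iInter fun i =>
      isClosed_le (hcont _ b.2.1 i).norm continuous_const
  have hcompact : IsCompact (Set.pi Set.univ fun _ : ι =>
      {μ : FiniteMeasure I | μ.mass ≤ (⟨w, hw0.le⟩ : NNReal)}) :=
    isCompact_univ_pi fun _ => isCompact_setOfPred_finiteMeasure_le_of_compactSpace I _
  obtain ⟨μ, -, hμ⟩ := hcompact.inter_iInter_nonempty t hclosed fun u => by
    obtain ⟨μ, h1, h2⟩ := exists_approx_solution Θ hw0 hw hcard u (fun b => b.2.1) fun b => b.2.2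
    exact ⟨μ, fun i _ => h1 i, Set.mem_iInter₂.2 fun b hb => h2 b hb⟩
  refine ⟨μ, fun z hz i => sub_eq_zero.1 (norm_le_zero_iff.1 (le_of_forall_pos_le_add
    fun ε hε => ?_))⟩
  rw [zero_add]
  exact Set.mem_iInter.1 hμ ⟨(z, ε), hz, hε⟩ i

theorem detPencil_star (hΩ : ∀ i, (Ω i).PosSemidef) (d : ι → ℂ) (z : ℂ) :
    detPencil Ω (fun j => star (d j)) (star z) = (detPencil Ω d z)ᴴ := by
  have h1 : ∀ i, (Ω i)ᴴ = Ω i := fun i => (hΩ i).isHermitian.eq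
  simp [detPencil, Matrix.conjTranspose_sub, Matrix.conjTranspose_smul, Matrix.conjTranspose_sum,
    h1]

theorem SolvesAt.conj (hΩ : ∀ i, (Ω i).PosSemidef) {μ : ι → FiniteMeasure I} {z : ℂ}
    (h : SolvesAt Ω μ z) : SolvesAt Ω μ (star z) := by
  intro i
  simp only [compactStieltjes_conj]
  rw [detPencil_star hΩ, ← Matrix.conjTranspose_nonsing_inv, h i]
  rw [star_mul', Matrix.trace_mul_comm (Ω i) (_)ᴴ]
  nth_rw 2 [← (hΩ i).isHermitian.eq]
  rw [← Matrix.conjTranspose_mul, Matrix.trace_conjTranspose]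
  simp

/-- On the negative axis the pencil is positive definite; multiplying by −i rotates its numerical
range into the lower half-plane, where `isUnit_of_im_le` applies. -/
theorem isUnit_detPencil_of_neg (hΩ : ∀ i, (Ω i).PosSemidef) {x : ℝ} (hx : x < 0) {r : ι → ℝ}
    (hr : ∀ i, 0 ≤ r i) : IsUnit (detPencil Ω (fun i => (r i : ℂ)) x) := by
  have h : IsUnit ((-Complex.I) • detPencil Ω (fun i => (r i : ℂ)) x) := by
    refine (isUnit_of_im_le (neg_pos.2 hx) fun v => ?_).1
    have hq : ∀ i, ∃ q : ℝ, 0 ≤ q ∧ star v ⬝ᵥ Ω i *ᵥ v = q := fun i => by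
      have := (hΩ i).dotProduct_mulVec_nonneg v
      exact ⟨_, (Complex.le_def.1 this).1,
        Complex.ext rfl (by simpa using (Complex.le_def.1 this).2.symm)⟩
    choose q hq0 hq using hq
    have h1 : star v ⬝ᵥ ((-Complex.I) • detPencil Ω (fun i => (r i : ℂ)) x) *ᵥ v =
        (-Complex.I) * (((1 / (Fintype.card ι : ℝ)) * ∑ i, (1 / (1 + r i)) * q i -
          x * vnorm v ^ 2 : ℝ) : ℂ) := by
      simp only [detPencil, Matrix.sub_mulVec, Matrix.smul_mulVec, dotProduct_sub,
        dotProduct_smul, Matrix.one_mulVec, star_dotProduct_self, smul_eq_mul, Matrix.sum_mulVec,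
        dotProduct_sum, hq]
      push_cast
      rfl
    rw [h1, Complex.im_mul_ofReal]
    have h2 : 0 ≤ (1 / (Fintype.card ι : ℝ)) * ∑ i, (1 / (1 + r i)) * q i := by
      refine mul_nonneg (by positivity) (Finset.sum_nonneg fun i _ => ?_)
      have := hr i
      have := hq0 i
      positivity
    simp only [Complex.neg_im, Complex.I_im]
    linarith
  have h2 : detPencil Ω (fun i => (r i : ℂ)) x =
      (Units.mk0 Complex.I Complex.I_ne_zero) •
        ((-Complex.I) • detPencil Ω (fun i => (r i : ℂ)) x) := by
    rw [Units.smul_def, smul_smul]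
    simp
  rw [h2]
  exact h.smul _

/-- Let ε → 0⁺ in the system at x + iε. The limits of the unknowns are nonnegative reals, so 1 + δ_j
≠ 0 and the pencil stays invertible. -/
theorem solvesAt_of_neg (hΩ : ∀ i, (Ω i).PosSemidef) {μ : ι → FiniteMeasure I}
    (h : ∀ z : ℂ, 0 < z.im → SolvesAt Ω μ z) {x : ℝ} (hx : x < 0) : SolvesAt Ω μ x := by
  intro i
  choose r hr0 hr using fun j => compactStieltjes_ofReal_nonneg (μ j : Measure I) hx
  have hlim : ∀ j, Tendsto (fun ε : ℝ => compactStieltjes (μ j) (x + ε * Complex.I)) (𝓝[>] 0)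
      (𝓝 (compactStieltjes (μ j) x)) := fun j => by
    have := ((continuous_compactStieltjes_add_mul_I (μ j : Measure I) hx).tendsto 0).mono_left
      (nhdsWithin_le_nhds (s := Set.Ioi 0))
    simpa using this
  have hz : Tendsto (fun ε : ℝ => (x + ε * Complex.I : ℂ)) (𝓝[>] 0) (𝓝 x) := by
    have : Continuous fun ε : ℝ => (x + ε * Complex.I : ℂ) := by fun_prop
    have := (this.tendsto 0).mono_left (nhdsWithin_le_nhds (s := Set.Ioi 0))
    simpa using this
  have h1 := tendsto_trace_mul_detPencil_inv (Ω := Ω) hlim hz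
    (fun j => by
      rw [hr j]
      have : 1 + r j ≠ 0 := by linarith [hr0 j]
      exact_mod_cast this)
    (by simpa only [hr] using isUnit_detPencil_of_neg hΩ hx hr0) (Ω i)
  refine tendsto_nhds_unique ((hlim i).congr' ?_) (h1.const_mul (1 / (Fintype.card ι : ℂ)))
  filter_upwards [self_mem_nhdsWithin] with ε hε
  exact h _ (by simpa using hε) i

theorem exists_solvesSystem {n N M : ℕ} (hn : 0 < n) (hN : N ≤ n)
    (Θ : Fin n → Matrix (Fin N) (Fin M) ℂ) {w : ℝ} (hw0 : 0 < w) (hw : ∀ i, ‖cov Θ i‖ ≤ w) :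
    ∃ μ, SolvesSystem (cov Θ) μ := by
  have : Nonempty (Fin n) := ⟨⟨0, hn⟩⟩
  have hΩ : ∀ i, (cov Θ i).PosSemidef := fun i => Matrix.posSemidef_self_mul_conjTranspose _
  obtain ⟨μ, hμ⟩ := exists_solvesAt_of_im_pos Θ hw0 hw (by simpa using hN)
  -- The lower half-plane is reached by conjugation and the negative axis by a limit.
  have hall : ∀ z : ℂ, ¬ (z.im = 0 ∧ 0 ≤ z.re) → SolvesAt (cov Θ) μ z := fun z hz => by
    rcases lt_trichotomy z.im 0 with h | h | h
    · have := SolvesAt.conj hΩ (hμ (star z) (by simpa using h))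
      rwa [star_star] at this
    · have h1 : z = (z.re : ℂ) := Complex.ext rfl (by simpa using h)
      rw [h1]
      exact solvesAt_of_neg hΩ hμ (not_le.1 fun h0 => hz ⟨h, h0⟩)
    · exact hμ z h
  refine ⟨fun i => halfLineMeasure (μ i), ⟨fun i => ?_, fun i => halfLineMeasure_Iio _,
    fun z hz i => ?_⟩⟩
  · rw [halfLineMeasure]
    infer_instance
  · simp only [stieltjes_halfLineMeasure, detResolvent_eq_inv]
    simpa using hall z hz i

/-- The solution is a Stieltjes transform of measures on `[0, ∞)` which solves the system. -/
theorem delta_spec {n N M : ℕ} (hn : 0 < n) (hN : N ≤ n)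
    (Θ : Fin n → Matrix (Fin N) (Fin M) ℂ) {w : ℝ} (hw0 : 0 < w) (hw : ∀ i, ‖cov Θ i‖ ≤ w) :
    SolvesSystem (cov Θ) (Classical.epsilon (SolvesSystem (cov Θ))) :=
  Classical.epsilon_spec (exists_solvesSystem hn hN Θ hw0 hw)

theorem integrable_stieltjes {μ : Measure ℝ} [IsFiniteMeasure μ] {z : ℂ} (hz : 0 < z.im) :
    Integrable (fun t : ℝ => ((t : ℂ) - z)⁻¹) μ := by
  refine Integrable.of_bound (by fun_prop) (1 / z.im) (ae_of_all _ fun t => ?_)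
  rw [norm_inv, ← one_div]
  refine one_div_le_one_div_of_le hz (le_trans ?_ (Complex.abs_im_le_norm _))
  simp [abs_of_pos hz]

theorem im_stieltjes_nonneg {μ : Measure ℝ} [IsFiniteMeasure μ] (hμ : μ (Set.Iio 0) = 0) {z : ℂ}
    (hz : 0 < z.im) : 0 ≤ (stieltjes μ z).im ∧ 0 ≤ (z * stieltjes μ z).im := by
  have hint := integrable_stieltjes (μ := μ) hz
  have hpos : ∀ᵐ t ∂μ, 0 ≤ t := by
    rw [ae_iff]
    simpa [Set.Iio] using hμ
  constructor
  · refine integral_im_nonneg hint fun t => ?_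
    rw [Complex.inv_im]
    have : -((t : ℂ) - z).im = z.im := by simp
    rw [this]
    exact div_nonneg hz.le (Complex.normSq_nonneg _)
  · rw [stieltjes, ← integral_const_mul]
    have h1 : ∫ t, (z * ((t : ℂ) - z)⁻¹).im ∂μ = (∫ t, z * ((t : ℂ) - z)⁻¹ ∂μ).im :=
      integral_im (hint.const_mul z)
    rw [← h1]
    refine integral_nonneg_of_ae ?_
    filter_upwards [hpos] with t ht
    have h2 : (z * ((t : ℂ) - z)⁻¹).im = t * z.im / Complex.normSq ((t : ℂ) - z) := by
      rw [← div_eq_mul_inv, Complex.div_im]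
      simp
      ring
    simp only [h2, Pi.zero_apply]
    exact div_nonneg (mul_nonneg ht hz.le) (Complex.normSq_nonneg _)

theorem delta_properties {n N M : ℕ} (hn : 0 < n) (hN : N ≤ n)
    (Θ : Fin n → Matrix (Fin N) (Fin M) ℂ) {w : ℝ} (hw0 : 0 < w) (hw : ∀ i, ‖cov Θ i‖ ≤ w) {z : ℂ}
    (hz : 0 < z.im) (i : Fin n) :
    0 ≤ (delta (cov Θ) z i).im ∧ 0 ≤ (z * delta (cov Θ) z i).im ∧
      delta (cov Θ) z i = (1 / (n : ℂ)) *
        (cov Θ i * detResolvent (cov Θ) (delta (cov Θ) z) z).trace := by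
  have h := delta_spec hn hN Θ hw0 hw
  have := h.finite i
  have him := im_stieltjes_nonneg (h.carried i) hz
  exact ⟨him.1, him.2, h.system z (not_mem_of_im_pos hz) i⟩

end Existence

end CorrelatedGaussian

namespace CorrelatedGaussian

open scoped Topology Matrix ComplexOrder

/-! ### From eigenvalue bounds to quadratic form and norm bounds. -/

section SpectralBounds

open scoped Matrix.Norms.L2Operator

variable {κ : Type*} [Fintype κ] [DecidableEq κ]

theorem vnorm_unitary_mulVec {U : Matrix κ κ ℂ} (hU : Uᴴ * U = 1) (v : κ → ℂ) :
    vnorm (U *ᵥ v) = vnorm v := by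
  rw [← sq_eq_sq₀ (vnorm_nonneg _) (vnorm_nonneg _)]
  have h := star_dotProduct_self (U *ᵥ v)
  rw [Matrix.star_mulVec, ← Matrix.dotProduct_mulVec, Matrix.mulVec_mulVec, hU,
    Matrix.one_mulVec, star_dotProduct_self] at h
  exact_mod_cast h.symm

theorem bounds_of_eigenvalues {A : Matrix κ κ ℂ} (hA : A.IsHermitian) {a b : ℝ} (ha : 0 ≤ a)
    (h : ∀ k, a ≤ hA.eigenvalues k ∧ hA.eigenvalues k ≤ b) (v : κ → ℂ) :
    a * vnorm v ^ 2 ≤ (star v ⬝ᵥ A *ᵥ v).re ∧ vnorm (A *ᵥ v) ≤ b * vnorm v := by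
  set U : Matrix κ κ ℂ := (hA.eigenvectorUnitary : Matrix κ κ ℂ) with hU
  set e := hA.eigenvalues with he
  have hUU : Uᴴᴴ * Uᴴ = 1 := by
    rw [Matrix.conjTranspose_conjTranspose]
    exact Matrix.mem_unitaryGroup_iff.1 hA.eigenvectorUnitary.2
  have hUU' : Uᴴ * U = 1 := Matrix.mem_unitaryGroup_iff'.1 hA.eigenvectorUnitary.2
  have hspec : A = U * Matrix.diagonal (fun k => (e k : ℂ)) * Uᴴ := hA.spectral_theorem
  set x := Uᴴ *ᵥ v with hx
  have hxv : vnorm x = vnorm v := vnorm_unitary_mulVec hUU v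
  have hAv : A *ᵥ v = U *ᵥ (Matrix.diagonal (fun k => (e k : ℂ)) *ᵥ x) := by
    rw [hx, Matrix.mulVec_mulVec, Matrix.mulVec_mulVec, ← hspec]
  have hsx : star x = star v ᵥ* U := by
    rw [hx, Matrix.star_mulVec, Matrix.conjTranspose_conjTranspose]
  constructor
  · rw [hAv, Matrix.dotProduct_mulVec, ← hsx, dotProduct, Complex.re_sum, ← hxv, vnorm_sq,
      Finset.mul_sum]
    refine Finset.sum_le_sum fun k _ => ?_
    have h1 : star x k * (Matrix.diagonal (fun k => (e k : ℂ)) *ᵥ x) k =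
        ((e k * ‖x k‖ ^ 2 : ℝ) : ℂ) := by
      rw [Matrix.mulVec_diagonal, Pi.star_apply, mul_left_comm, mul_comm (star (x k)),
        ← starRingEnd_apply, Complex.mul_conj, Complex.normSq_eq_norm_sq]
      push_cast
      rfl
    rw [h1, Complex.ofReal_re]
    exact mul_le_mul_of_nonneg_right (h k).1 (by positivity)
  · rw [hAv, vnorm_unitary_mulVec hUU', ← hxv]
    rcases isEmpty_or_nonempty κ with hκ | ⟨⟨k₀⟩⟩
    · simp [vnorm, EuclideanSpace.norm_eq]
    have hb : 0 ≤ b := ha.trans ((h k₀).1.trans (h k₀).2)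
    refine abs_le_of_sq_le_sq' ?_ (by have := vnorm_nonneg x; positivity) |>.2
    rw [mul_pow, vnorm_sq, vnorm_sq, Finset.mul_sum]
    refine Finset.sum_le_sum fun k _ => ?_
    rw [Matrix.mulVec_diagonal, norm_mul, mul_pow, Complex.norm_real]
    refine mul_le_mul_of_nonneg_right ?_ (by positivity)
    rw [Real.norm_of_nonneg (ha.trans (h k).1)]
    exact pow_le_pow_left₀ (ha.trans (h k).1) (h k).2 2

theorem norm_trace_div_le {n N : ℕ} {w y : ℝ} {A T : Matrix (Fin N) (Fin N) ℂ}
    (hA : ‖A‖ ≤ w) (hT : ‖T‖ ≤ 1 / y) :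
    ‖(1 / (n : ℂ)) * (A * T).trace‖ ≤ N / n * (w / y) := by
  have hw : 0 ≤ w := (norm_nonneg _).trans hA
  have h1 : ‖(A * T).trace‖ ≤ N * (w / y) := by
    refine (norm_trace_le _).trans ?_
    rw [Fintype.card_fin, div_eq_mul_one_div w]
    exact mul_le_mul_of_nonneg_left ((norm_mul_le _ _).trans (mul_le_mul hA hT (norm_nonneg _) hw))
      (Nat.cast_nonneg _)
  rw [norm_mul, norm_div, norm_one, Complex.norm_natCast]
  exact (mul_le_mul_of_nonneg_left h1 (by positivity)).trans (le_of_eq (by ring))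

end SpectralBounds

/-! ### Identification of α as a mean over the product Gaussian law. -/

section Alpha

variable {S : Type*} [MeasurableSpace S] {P : Measure S} [IsProbabilityMeasure P]

theorem map_eq_pi_of_iIndepFun {n N M : ℕ} {Θ : Fin n → Matrix (Fin N) (Fin M) ℂ}
    {ξ : Fin n → S → Fin N → ℂ} (hindep : iIndepFun ξ P)
    (hlaw : ∀ i, P.map (ξ i) = complexGaussian (Θ i)) :
    AEMeasurable (fun ω i => ξ i ω) P ∧
      P.map (fun ω i => ξ i ω) = Measure.pi fun i => gaussianLaw (Θ i) := by
  -- The image measure of a map that is not almost everywhere measurable is 0 by convention, which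
  -- is excluded because the prescribed law is a probability measure.
  have hmeas : ∀ i, AEMeasurable (ξ i) P := fun i => by
    by_contra h
    have h1 := hlaw i
    rw [Measure.map_of_not_aemeasurable h] at h1
    have h2 : complexGaussian (Θ i) = gaussianLaw (Θ i) := rfl
    have := isGaussian_gaussianLaw (Θ i)
    have h3 : IsProbabilityMeasure (gaussianLaw (Θ i)) := inferInstance
    rw [← h2, ← h1] at h3
    exact h3.ne_zero _ rfl
  refine ⟨aemeasurable_pi_lambda _ hmeas, ?_⟩
  rw [(iIndepFun_iff_map_fun_eq_pi_map hmeas).1 hindep]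
  congr 1
  funext i
  exact hlaw i

theorem alpha_eq_integral_traceRes {n N M : ℕ} {Θ : Fin n → Matrix (Fin N) (Fin M) ℂ}
    {ξ : Fin n → S → Fin N → ℂ} (hindep : iIndepFun ξ P)
    (hlaw : ∀ i, P.map (ξ i) = complexGaussian (Θ i)) (Ω : Fin n → Matrix (Fin N) (Fin N) ℂ)
    {z : ℂ} (hz : 0 < z.im) (k : Fin n) :
    alpha P Ω ξ z k = ∫ x, traceRes (Ω k) z x ∂(Measure.pi fun i => gaussianLaw (Θ i)) := by
  obtain ⟨hmeas, hmap⟩ := map_eq_pi_of_iIndepFun hindep hlaw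
  set γ := Measure.pi fun i => gaussianLaw (Θ i) with hγ
  have hG : IsGaussian γ := (isCircularLaw_pi Θ).gaussian
  have hres := matrixPolyBdd_res (ι := Fin n) (κ := Fin N) hz
  have hQ : ∀ a b, meanQ P ξ z a b = ∫ x, res z x a b ∂γ := fun a b => by
    rw [meanQ, Matrix.of_apply, ← hmap, integral_map hmeas]
    · simp only [resolventQ_eq_res]
    · rw [hmap]
      exact ((hres a b).integrable γ).aestronglyMeasurable
  simp only [alpha, traceRes, Fintype.card_fin]
  rw [integral_const_mul]
  congr 1
  simp only [Matrix.trace, Matrix.diag_apply, Matrix.mul_apply, hQ]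
  have h : ∀ a b, PolyBdd fun x : Fin n → Fin N → ℂ => Ω k a b * res z x b a := fun a b =>
    (PolyBdd.const _).mul (hres b a)
  rw [integral_finsetSum _ fun a _ => (PolyBdd.sum _ fun b _ => h a b).integrable _]
  refine Finset.sum_congr rfl fun a _ => ?_
  rw [integral_finsetSum _ fun b _ => (h a b).integrable _]
  exact Finset.sum_congr rfl fun b _ => (integral_const_mul _ _).symm

end Alpha

/-! ### Polynomial bounds for the error and the choice of the region. -/

section Region

theorem posCoeffs_C_mul_X_add_one_pow {c : ℝ} (hc : 0 < c) (p : ℕ) :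
    PosCoeffs (Polynomial.C c * (Polynomial.X + 1) ^ p) := by
  intro i hi
  rw [Polynomial.natDegree_C_mul hc.ne', ← Polynomial.C_1, Polynomial.natDegree_pow_X_add_C] at hi
  rw [Polynomial.coeff_C_mul, Polynomial.coeff_X_add_one_pow]
  have := Nat.choose_pos hi
  positivity

/-- All terms are dominated by one monomial in 1+w, |z|+1 and 1/Im z + 1. The constant is 94 = 4(1 +
21 + 1) + 2. -/
theorem errorConst_le {w : ℝ} (hw : 0 < w) {z : ℂ} (hz : 0 < z.im) :
    0 ≤ errorConst w z ∧ errorConst w z ≤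
      94 * (1 + w) ^ 7 * (‖z‖ + 1) ^ 2 * (z.im⁻¹ + 1) ^ 8 := by
  have ht : 0 ≤ ‖z‖ := norm_nonneg z
  have hs : 0 < z.im⁻¹ := inv_pos.2 hz
  have he : errorConst w z = 4 * w ^ 3 * ((1 + ‖z‖ * z.im⁻¹) * z.im⁻¹) * z.im⁻¹ ^ 2 *
      ((w * z.im⁻¹) ^ 2 * ((1 + ‖z‖ * z.im⁻¹) * z.im⁻¹) * w / 2 + 21 + (w * z.im⁻¹) ^ 2) +
      (1 + (w ^ 3 * z.im⁻¹ ^ 3) ^ 2 * ((1 + ‖z‖ * z.im⁻¹) * z.im⁻¹) * w) / 2 := by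
    simp only [errorConst, div_eq_mul_inv, inv_pow]
  generalize ‖z‖ = t at *
  generalize z.im⁻¹ = s at *
  rw [he]
  clear he
  refine ⟨by positivity, ?_⟩
  set A := t + 1 with hA
  set B := s + 1 with hB
  set W := 1 + w with hW
  have hA1 : 1 ≤ A := by linarith
  have hB1 : 1 ≤ B := by linarith
  have hW1 : 1 ≤ W := by linarith
  have hsB : s ≤ B := by linarith
  have hwW : w ≤ W := by linarith
  have hts : 1 + t * s ≤ A * B := by simp only [hA, hB]; nlinarith
  clear_value A B W
  have h1 : (1 + t * s) * s ≤ A * B * B := mul_le_mul hts hsB hs.le (by positivity)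
  have hone : 1 ≤ W ^ 3 * A * B ^ 4 :=
    one_le_mul_of_one_le_of_one_le (one_le_mul_of_one_le_of_one_le (one_le_pow₀ hW1) hA1)
      (one_le_pow₀ hB1)
  have h2 : (w * s) ^ 2 * ((1 + t * s) * s) * w / 2 ≤ W ^ 3 * A * B ^ 4 := by
    calc (w * s) ^ 2 * ((1 + t * s) * s) * w / 2 ≤ (w * s) ^ 2 * ((1 + t * s) * s) * w :=
          half_le_self (by positivity)
      _ ≤ (W * B) ^ 2 * (A * B * B) * W := by gcongr
      _ = _ := by ring
  have h3 : (w * s) ^ 2 ≤ W ^ 3 * A * B ^ 4 := by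
    calc (w * s) ^ 2 ≤ (W * B) ^ 2 := by gcongr
      _ ≤ (W * B) ^ 2 * (W * A * B ^ 2) := le_mul_of_one_le_right (by positivity)
          (one_le_mul_of_one_le_of_one_le (one_le_mul_of_one_le_of_one_le hW1 hA1)
            (one_le_pow₀ hB1))
      _ = _ := by ring
  have h4 : 4 * w ^ 3 * ((1 + t * s) * s) * s ^ 2 *
      ((w * s) ^ 2 * ((1 + t * s) * s) * w / 2 + 21 + (w * s) ^ 2) ≤
      92 * (W ^ 6 * A ^ 2 * B ^ 8) := by
    calc _ ≤ 4 * W ^ 3 * (A * B * B) * B ^ 2 * (W ^ 3 * A * B ^ 4 + 21 * (W ^ 3 * A * B ^ 4) +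
          W ^ 3 * A * B ^ 4) := by
          gcongr
          linarith
      _ = _ := by ring
  have h5 : (1 + (w ^ 3 * s ^ 3) ^ 2 * ((1 + t * s) * s) * w) / 2 ≤ 2 * (W ^ 7 * A ^ 2 * B ^ 8) := by
    have h6 : (w ^ 3 * s ^ 3) ^ 2 * ((1 + t * s) * s) * w ≤ W ^ 7 * A ^ 2 * B ^ 8 := by
      calc (w ^ 3 * s ^ 3) ^ 2 * ((1 + t * s) * s) * w
          ≤ (W ^ 3 * B ^ 3) ^ 2 * (A * B * B) * W := by gcongr
        _ = W ^ 7 * A ^ 1 * B ^ 8 := by ring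
        _ ≤ _ := by
          gcongr
          norm_num
    have h7 : 1 ≤ W ^ 7 * A ^ 2 * B ^ 8 :=
      one_le_mul_of_one_le_of_one_le (one_le_mul_of_one_le_of_one_le (one_le_pow₀ hW1)
        (one_le_pow₀ hA1)) (one_le_pow₀ hB1)
    linarith
  have h8 : W ^ 6 * A ^ 2 * B ^ 8 ≤ W ^ 7 * A ^ 2 * B ^ 8 := by
    gcongr
    norm_num
  linarith

/-- Here t = |z| and s = 1/Im z. Collecting powers gives the exponents 6 = 2+2+2, 13 = 2+8+2+1 and 9
= 7+2 of the two polynomials that define the region. -/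
theorem error_mul_le {w wmin t s E : ℝ} (hw : 0 < w) (hwmin : 0 < wmin) (ht : 0 < t) (hs : 0 < s)
    (hE0 : 0 ≤ E) (hE : E ≤ 94 * (1 + w) ^ 7 * (t + 1) ^ 2 * (s + 1) ^ 8) :
    (t * s) ^ 2 * E * (2 * (t * (w * s + 1)) ^ 2 * s / wmin) ≤
      2 * (94 * (1 + w) ^ 9 / wmin * (t + 1) ^ 6 * (s + 1) ^ 13) := by
  have h3 : w * s + 1 ≤ (1 + w) * (s + 1) := by nlinarith
  have h4 : t ≤ t + 1 := by linarith
  have h5 : s ≤ s + 1 := by linarith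
  have hA : 0 < t + 1 := by positivity
  have hB : 0 < s + 1 := by positivity
  have hW : 0 < 1 + w := by positivity
  generalize t + 1 = A at *
  generalize s + 1 = B at *
  generalize 1 + w = W at *
  calc (t * s) ^ 2 * E * (2 * (t * (w * s + 1)) ^ 2 * s / wmin)
      ≤ (A * B) ^ 2 * (94 * W ^ 7 * A ^ 2 * B ^ 8) *
        (2 * (A * (W * B)) ^ 2 * B / wmin) := by gcongr
    _ = _ := by ring

/-- The error is of order 1/n² and the available slack of order N/n; N ≤ n enters through N² ≤ Nn.
-/
theorem div_sq_le_of_mul_le {F wmin t s y D N n : ℝ} (hwmin : 0 < wmin) (ht : 0 < t) (hy : 0 < y)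
    (hsy : y * s = 1) (hD : 0 < D) (hN : 0 < N) (hNn : N ≤ n)
    (h : F * (2 * (t * D) ^ 2 * s / wmin) ≤ N ^ 2) :
    F / n ^ 2 ≤ 1 / 2 * (y * (1 / n) * (wmin * (N / (t * D) ^ 2))) := by
  have hn : 0 < n := hN.trans_le hNn
  have h5 : F ≤ N ^ 2 * (y * wmin / (2 * (t * D) ^ 2)) := by
    have h6 : F * (2 * (t * D) ^ 2 * s / wmin) * (y * wmin / (2 * (t * D) ^ 2)) =
        F * (y * s) := by
      field_simp
    rw [hsy, mul_one] at h6
    rw [← h6]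
    exact mul_le_mul_of_nonneg_right h (by positivity)
  have h7 : N ^ 2 ≤ N * n := by nlinarith
  calc F / n ^ 2 ≤ N ^ 2 * (y * wmin / (2 * (t * D) ^ 2)) / n ^ 2 := by gcongr
    _ ≤ (N * n) * (y * wmin / (2 * (t * D) ^ 2)) / n ^ 2 := by gcongr
    _ = _ := by field_simp

/-- On the region, the error of the main estimate is small enough for the stability argument. -/
theorem error_le_of_mem_regionE {w wmin : ℝ} (hw : 0 < w) (hwmin : 0 < wmin) {n N : ℕ}
    (hN : 0 < N) (hNn : N ≤ n) {z : ℂ}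
    (hz : z ∈ regionE (Polynomial.C (94 * (1 + w) ^ 9 / wmin) * (Polynomial.X + 1) ^ 6)
      (Polynomial.C 1 * (Polynomial.X + 1) ^ 13) N) :
    (‖z‖ / z.im) ^ 2 * errorConst w z / (n : ℝ) ^ 2 ≤
      1 / 2 * (z.im * (1 / n) * (wmin * (N / (‖z‖ * (w / z.im + 1)) ^ 2))) := by
  obtain ⟨hy, hz⟩ := hz
  have hN' : (0 : ℝ) < N := by exact_mod_cast hN
  have ht : 0 < ‖z‖ := hy.trans_le ((le_abs_self _).trans (Complex.abs_im_le_norm z))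
  obtain ⟨hE0, hE⟩ := errorConst_le hw hy
  simp only [Polynomial.eval_mul, Polynomial.eval_C, Polynomial.eval_pow, Polynomial.eval_add,
    Polynomial.eval_X, Polynomial.eval_one, abs_of_pos hy] at hz
  rw [one_mul, mul_assoc, one_div, inv_mul_le_iff₀ (by positivity)] at hz
  rw [div_eq_mul_inv ‖z‖, div_eq_mul_inv w]
  refine div_sq_le_of_mul_le hwmin ht hy (mul_inv_cancel₀ hy.ne') (by positivity) hN'
    (by exact_mod_cast hNn) ((error_mul_le hw hwmin ht (inv_pos.2 hy) hE0 hE).trans ?_)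
  refine (mul_le_mul_of_nonneg_left hz zero_le_two).trans (le_of_eq ?_)
  ring

end Region

end CorrelatedGaussian

namespace CorrelatedGaussian

/-! ### The bounds for C and B. -/

section Conclusion

variable {n N M : ℕ} {Θ : Fin n → Matrix (Fin N) (Fin M) ℂ} {wmin w : ℝ}

open scoped ComplexOrder in
theorem posSemidef_cov (i : Fin n) : (cov Θ i).PosSemidef :=
  Matrix.posSemidef_self_mul_conjTranspose _

open scoped Matrix.Norms.L2Operator in
theorem opNorm_cov_le (hw0 : 0 < w) (hw : ∀ i v, vnorm ((cov Θ i).mulVec v) ≤ w * vnorm v)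
    (i : Fin n) : ‖cov Θ i‖ ≤ w :=
  opNorm_le_of_vnorm_le _ hw0.le (hw i)

theorem matC_bounds (hN : 0 < N) (hNn : N ≤ n) (hwmin : 0 < wmin) (hw0 : 0 < w)
    (hlow : ∀ i v, wmin * vnorm v ^ 2 ≤ (star v ⬝ᵥ (cov Θ i).mulVec v).re)
    (hw : ∀ i v, vnorm ((cov Θ i).mulVec v) ≤ w * vnorm v) {z : ℂ} (hz : 0 < z.im) :
    spectralRadius ℂ (matC (cov Θ) z) < 1 ∧
      ‖(1 - matC (cov Θ) z)⁻¹‖ ≤ 4 * w / wmin * (w ^ 2 + ‖z‖ ^ 2) ^ 2 / |z.im| ^ 4 := by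
  have hn := hN.trans_le hNn
  have hδ := delta_properties hn hNn Θ hw0 (opNorm_cov_le hw0 hw) hz
  refine spectralRadius_and_norm_of_approx_solution hN hn posSemidef_cov hwmin hw0 hlow hw hz
    (fun i => (hδ i).1) (fun i => (hδ i).2.1) (fun i => ?_) (fun i => ?_) rfl
  · rw [(hδ i).2.2, detResolvent_eq_inv]
    exact (Complex.im_le_norm _).trans (norm_trace_div_le (opNorm_cov_le hw0 hw i)
      (isUnit_detPencil posSemidef_cov hz fun j => (hδ j).1).2)
  · rw [← (hδ i).2.2, sub_self, norm_zero]
    positivity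

theorem matB_bounds {S : Type*} [MeasurableSpace S] {P : Measure S} [IsProbabilityMeasure P]
    {ξ : Fin n → S → Fin N → ℂ} (hindep : iIndepFun ξ P)
    (hlaw : ∀ i, P.map (ξ i) = complexGaussian (Θ i)) (hN : 0 < N) (hNn : N ≤ n)
    (hwmin : 0 < wmin) (hw0 : 0 < w)
    (hlow : ∀ i v, wmin * vnorm v ^ 2 ≤ (star v ⬝ᵥ (cov Θ i).mulVec v).re)
    (hw : ∀ i v, vnorm ((cov Θ i).mulVec v) ≤ w * vnorm v) {z : ℂ}
    (hzE : z ∈ regionE (Polynomial.C (94 * (1 + w) ^ 9 / wmin) * (Polynomial.X + 1) ^ 6)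
      (Polynomial.C 1 * (Polynomial.X + 1) ^ 13) N) :
    spectralRadius ℂ (matB P (cov Θ) ξ z) < 1 ∧
      ‖(1 - matB P (cov Θ) ξ z)⁻¹‖ ≤ 4 * w / wmin * (w ^ 2 + ‖z‖ ^ 2) ^ 2 / |z.im| ^ 4 := by
  have hz : 0 < z.im := hzE.1
  have hn := hN.trans_le hNn
  have : Nonempty (Fin n) := ⟨⟨0, hn⟩⟩
  have hγ : IsCircularLaw (Measure.pi fun i => gaussianLaw (Θ i)) (cov Θ) := isCircularLaw_pi Θ
  have hG := hγ.gaussian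
  have hα := funext (alpha_eq_integral_traceRes hindep hlaw (cov Θ) hz)
  refine spectralRadius_and_norm_of_approx_solution (d := alpha P (cov Θ) ξ z) hN hn
    posSemidef_cov hwmin hw0 hlow hw hz ?_ ?_ ?_ ?_ rfl <;> rw [hα] <;> intro i
  · exact (im_integral_traceRes_nonneg (posSemidef_cov i) hz).1
  · exact (im_integral_traceRes_nonneg (posSemidef_cov i) hz).2
  · have h := norm_integral_traceRes_le (ι := Fin n) (γ := Measure.pi fun i => gaussianLaw (Θ i))
      _ hz (opNorm_cov_le hw0 hw i)
    rw [Fintype.card_fin, Fintype.card_fin] at h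
    exact (Complex.im_le_norm _).trans h
  · have h := hγ.norm_integral_traceRes_sub_le posSemidef_cov hw0 (opNorm_cov_le hw0 hw)
      (by simpa using hNn) hz i
    rw [Fintype.card_fin] at h
    rw [detResolvent_eq_inv]
    exact h.trans (error_le_of_mem_regionE hw0 hwmin hN hNn hzE)

end Conclusion

end CorrelatedGaussian

end

theorem mainTheorem5
    -- dimensions, with `n N` columns in dimension `N`, and the asymptotic regime
    (n Nbar : ℕ → ℕ) (hn : ∀ N, N ≤ n N) (hNbar : ∀ N, N ≤ Nbar N)
    (hliminf : 0 < liminf (fun N : ℕ => (N : ℝ) / (n N : ℝ)) atTop)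
    (hlimsup : limsup (fun N : ℕ => (N : ℝ) / (n N : ℝ)) atTop < 1)
    -- the factors of the covariances, with uniform spectral bounds
    (Θ : ∀ N, Fin (n N) → Matrix (Fin N) (Fin (Nbar N)) ℂ)
    (wmin wmax : ℝ) (hwmin : 0 < wmin)
    (hΘ : ∀ (N : ℕ) (i : Fin (n N)) (k : Fin N),
      wmin ≤ (Matrix.isHermitian_mul_conjTranspose_self (Θ N i)).eigenvalues k ∧
      (Matrix.isHermitian_mul_conjTranspose_self (Θ N i)).eigenvalues k ≤ wmax)
    -- the independent Gaussian columns
    {S : Type*} [MeasurableSpace S] (P : Measure S) [IsProbabilityMeasure P]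
    (ξ : ∀ N, Fin (n N) → S → Fin N → ℂ)
    (hindep : ∀ N, iIndepFun (ξ N) P)
    (hlaw : ∀ N i, P.map (ξ N i) = CorrelatedGaussian.complexGaussian (Θ N i)) :
    (∃ K η : ℝ, 0 < K ∧ 0 < η ∧ ∀ N : ℕ, 1 ≤ N → ∀ z : ℂ, 0 < z.im →
      spectralRadius ℂ (CorrelatedGaussian.matC (CorrelatedGaussian.cov (Θ N)) z) < 1 ∧
      ‖(1 - CorrelatedGaussian.matC (CorrelatedGaussian.cov (Θ N)) z)⁻¹‖
        ≤ K * (η ^ 2 + ‖z‖ ^ 2) ^ 2 / |z.im| ^ 4) ∧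
    (∃ Q₁ Q₂ : Polynomial ℝ,
      CorrelatedGaussian.PosCoeffs Q₁ ∧ CorrelatedGaussian.PosCoeffs Q₂ ∧
      ∃ K η : ℝ, 0 < K ∧ 0 < η ∧ ∀ᶠ N : ℕ in atTop,
        ∀ z ∈ CorrelatedGaussian.regionE Q₁ Q₂ N,
          spectralRadius ℂ
            (CorrelatedGaussian.matB P (CorrelatedGaussian.cov (Θ N)) (ξ N) z) < 1 ∧
          ‖(1 - CorrelatedGaussian.matB P (CorrelatedGaussian.cov (Θ N)) (ξ N) z)⁻¹‖
            ≤ K * (η ^ 2 + ‖z‖ ^ 2) ^ 2 / |z.im| ^ 4) := by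
  have hspec := fun N i => CorrelatedGaussian.bounds_of_eigenvalues
    (Matrix.isHermitian_mul_conjTranspose_self (Θ N i)) hwmin.le (hΘ N i)
  -- In dimension N = 1 there is an actual eigenvalue, lying between the two bounds.
  have hwmax : 0 < wmax := by
    have h := hΘ 1 ⟨0, hn 1⟩ 0
    exact hwmin.trans_le (h.1.trans h.2)
  refine ⟨⟨4 * wmax / wmin, wmax, by positivity, hwmax, fun N hN z hz => ?_⟩,
    Polynomial.C (94 * (1 + wmax) ^ 9 / wmin) * (Polynomial.X + 1) ^ 6,
    Polynomial.C 1 * (Polynomial.X + 1) ^ 13,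
    CorrelatedGaussian.posCoeffs_C_mul_X_add_one_pow (by positivity) _,
    CorrelatedGaussian.posCoeffs_C_mul_X_add_one_pow one_pos _,
    4 * wmax / wmin, wmax, by positivity, hwmax, ?_⟩
  · exact CorrelatedGaussian.matC_bounds hN (hn N) hwmin hwmax (fun i v => (hspec N i v).1)
      (fun i v => (hspec N i v).2) hz
  · filter_upwards [eventually_ge_atTop 1] with N hN z hz
    exact CorrelatedGaussian.matB_bounds (hindep N) (hlaw N) hN (hn N) hwmin hwmax
      (fun i v => (hspec N i v).1) (fun i v => (hspec N i v).2) hz
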